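/- **Notation.** Let $0<x<1$, $r>1$ be real, $k\ge 1$ an integer, $p=x^{2r}$, and $\tau=-\pi i/(r\log x)$, so that $p=e^{-2\pi i/\tau}$. With $\tilde p=e^{2\pi i\tau}$ let $\vartheta_1(u|\tau)=2\tilde p^{1/8}(\tilde p;\tilde p)_\infty\sin \pi u\prod_{n\ge1}(1-2\tilde p^n\cos 2\pi u+\tilde p^{2n})$, $\vartheta_0(u|\tau)=-ie^{\pi i(u+\tau/4)}\vartheta_1(u+\tfrac\tau2|\tau)$, $\vartheta_2(u|\tau)=\vartheta_1(u+\tfrac12|\tau)$, $\vartheta_3(u|\tau)=e^{\pi i(u+\tau/4)}\vartheta_1(u+\tfrac{\tau+1}2|\tau)$, and $[u]=C\,\vartheta_1(u/r|\tau)$ with $C=x^{-r/4}e^{-\pi i/4}\tau^{1/2}$. Assume that $r$ is generic in the sense that $[j]\neq0$ for $1\le j\le k$. Write $I_k=\{-k,-k+2,\dots,k\}$. A complex number $u$ is called *generic* if $[u+n]\ne0$ for all $n\in\mathbb Z$. *Vertex side.* The eight-vertex $R$-matrix on $V\otimes V$, $V=\mathbb Cv_+\oplus\mathbb Cv_-$,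 is $R(u)v_{\varepsilon_1}\otimes v_{\varepsilon_2}=\sum R(u)^{\varepsilon_1\varepsilon_2}_{\varepsilon_1'\varepsilon_2'}v_{\varepsilon_1'}\otimes v_{\varepsilon_2'}$ with $R^{\pm\pm}_{\pm\pm}=R_0a$, $R^{\pm\mp}_{\pm\mp}=R_0b$, $R^{\pm\mp}_{\mp\pm}=R_0c$, $R^{\pm\pm}_{\mp\mp}=R_0d$ and all other entries zero; here, with all theta functions taken at modulus $\tau/2$, $$a(u)=\frac{\vartheta_2(\frac1{2r})\vartheta_2(\frac u{2r})}{\vartheta_2(0)\vartheta_2(\frac{1+u}{2r})},\quad b(u)=\frac{\vartheta_2(\frac1{2r})\vartheta_1(\frac u{2r})}{\vartheta_2(0)\vartheta_1(\frac{1+u}{2r})},\quad c(u)=\frac{\vartheta_1(\frac1{2r})\vartheta_2(\frac u{2r})}{\vartheta_2(0)\vartheta_1(\frac{1+u}{2r})},\quad d(u)=-\frac{\vartheta_1(\frac1{2r})\vartheta_1(\frac u{2r})}{\vartheta_2(0)\vartheta_2(\frac{1+u}{2r})},$$ $$R_0(u)=z^{-\frac{r-1}{2r}}\frac{\{px^2z\}\{x^2z\}\{p/z\}\{x^4/z\}}{\{px^2/z\}\{x^2/z\}\{pz\}\{x^4z\}},\qquad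 z=x^{2u},\quad \{z\}=\prod_{i,j\ge0}(1-zx^{4i}p^j).$$ Let $\Pi$ be the symmetrizer on $V^{\otimes k}$, and let $v^{(k)}_\varepsilon=\Pi\,v_{\varepsilon_1}\otimes\cdots\otimes v_{\varepsilon_k}$ ($\varepsilon=\sum\varepsilon_i\in I_k$) be the basis of the symmetric tensors. The fused $R$-matrix is $R^{(k,k)}(u)=\Pi_{\bar1\cdots\bar k}R_{1\cdots k,\bar k}(u)R_{1\cdots k,\overline{k-1}}(u-1)\cdots R_{1\cdots k,\bar1}(u-k+1)$, where $R_{1\cdots k,\bar j}(u)=\Pi_{1\cdots k}R_{1\bar j}(u+k-1)\cdots R_{k\bar j}(u)$; its matrix elements are taken in the basis $v^{(k)}_{\varepsilon_1}\otimes v^{(k)}_{\varepsilon_2}$. *SOS side.* For integers the face weight $W\binom{a\ b}{d\ c}(u)$ vanishes unless adjacent heights differ by $\pm1$; otherwise $W\binom{n\ \ n\pm1}{n\pm1\ n\pm2}=R_0(u)$, $W\binom{n\ \ n\pm1}{n\pm1\ n}=R_0(u)\frac{[n\mp u][1]}{[n][1+u]}$, $W\binom{n\ \ n\pm1}{n\mp1\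 n}=R_0(u)\frac{[n\pm1][u]}{[n][1+u]}$. Fix for all $a,b$ with $a-b\in I_k$ the path of $k$ steps $\pm1$ from $a$ to $b$ that first goes up and then down. Put $$W^{(k,1)}\binom{a\ b}{d\ c}(u)=\sum_{d_1,\dots,d_{k-1}}\prod_{i=0}^{k-1}W\binom{a_i\ a_{i+1}}{d_i\ d_{i+1}}(u+k-1-i),\qquad W^{(k,k)}\binom{a\ b}{d\ c}(u)=\sum_{a_1,\dots,a_{k-1}}\prod_{j=0}^{k-1}W^{(k,1)}\binom{a_j\ \ b_j}{a_{j+1}\ b_{j+1}}(u-k+1+j),$$ where $a=a_0,\dots,a_k=b$ (in $W^{(k,1)}$) and $b=b_0,\dots,b_k=c$ (in $W^{(k,k)}$) are the fixed paths, the sums are over $\pm1$-step paths from $d$ to $c$ and from $a$ to $d$ respectively, and $W^{(k,1)}$, $W^{(k,k)}$ are zero unless $a-b\in I_k$, respectively $b-c\in I_k$. Let $$G^{(k)}_{a,b}=\frac{g_a}{g_b\,(a,b)_k},\quad g_a=s_a\sqrt{[a]},\quad s_a=\pm1,\ s_as_{a+1}=(-1)^a,\quad (a,b)_k=\left(\prod_{i=0}^{B-1}\frac{[k-i]}{[B-i]}\right)^{-1}\frac{\prod_{i=0}^k[\frac{a+b-k}2+i]}{\sqrt{[a]}\sqrt{[b]}},\quad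 B=\tfrac{a-b+k}2.$$ *Intertwining vectors.* For $|a-b|=1$ let $\psi_+(u)^a_b=\vartheta_0(\frac{(a-b)u+a}{2r}|\frac\tau2)$, $\psi_-(u)^a_b=\vartheta_3(\frac{(a-b)u+a}{2r}|\frac\tau2)$ and $\psi^*_\varepsilon(u)^a_b=-\varepsilon\frac{a-b}{2[b][u]}C^2\psi_{-\varepsilon}(u-1)^a_b$. For $a-b\in I_k$ and $\varepsilon\in I_k$ let $$\psi^{(k)}_\varepsilon(u)^a_b=\sum_{\varepsilon_1+\cdots+\varepsilon_k=\varepsilon}\psi_{\varepsilon_1}(u+k-1)^a_{c_1}\cdots\psi_{\varepsilon_k}(u)^{c_{k-1}}_b,\qquad \psi^{*(k)}_\varepsilon(u)^a_b=\sum_{c_1,\dots,c_{k-1}}\psi^*_{\varepsilon_1}(u+k-1)^{c_1}_b\psi^*_{\varepsilon_2}(u+k-2)^{c_2}_{c_1}\cdots\psi^*_{\varepsilon_k}(u)^a_{c_{k-1}},$$ with the fixed path $a,c_1,\dots,c_{k-1},b$ in the first formula, and with the signs $(\varepsilon_1,\dots,\varepsilon_k)=(+,\dots,+,-,\dots,-)$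 of sum $\varepsilon$ in the second. **SOS half transfer matrices.** Fix $m\in\mathbb Z$; for $\ell\in\{0,\dots,k\}$ put $\bar\ell=k-\ell$. A system of SOS half transfer matrices consists of complex vector spaces $H^{(\ell)}_{m,a}$ ($a\in m+\ell+2\mathbb Z$; the spaces of states with central height $a$) and linear maps $\Phi_{b,a}(u):H^{(\ell)}_{m,a}\to H^{(\bar\ell)}_{m,b}$ ($u\in\mathbb C$) which, with $\Phi^*_{b,a}(u)=\Phi_{b,a}(u-1)/G^{(k)}_{b,a}$, satisfy the SOS relations * $\Phi_{c,b}(u_2)\Phi_{b,a}(u_1)=\sum_{d\in a+I_k}W^{(k,k)}\binom{c\ d}{b\ a}(u_1-u_2)\,\Phi_{c,d}(u_1)\Phi_{d,a}(u_2)$ for $c-b,\ b-a\in I_k$, whenever $u_1-u_2$ is generic and $[n]\ne0$ for all integers $n$ with $|n-c|+|n-a|\le 2k-2$; * $\sum_{a\in b+I_k}\Phi^*_{b,a}(u)\Phi_{a,b}(u)=\mathrm{id}$ whenever $[n]\neq0$ for all integers $n$ with $|n-b|\le k$. Given a function $f$ on $\mathbb C$ and $u_0\in\mathbb C$, define operators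 $\bigoplus_{a\in m+\ell+2\mathbb Z}H^{(\ell)}_{m,a}\to\bigoplus_{a'\in m+\bar\ell+2\mathbb Z}H^{(\bar\ell)}_{m,a'}$, for $\varepsilon\in I_k$, by $$\Phi^{(\bar\ell,\ell)}_\varepsilon(u;u_0)=f(u-u_0)\bigoplus_{a,\ a'\in a+I_k}\psi^{(k)}_\varepsilon(u-u_0)^{a'}_a\,\Phi_{a',a}(u),\qquad \Phi^{*(\bar\ell,\ell)}_\varepsilon(u;u_0)=f(u-u_0)^{-1}\bigoplus_{a,\ a'\in a+I_k}\psi^{*(k)}_\varepsilon(u-u_0)^{a'}_a\,\Phi^*_{a',a}(u).$$ **Theorem.** For every system of SOS half transfer matrices, every $\ell$, $f$ and $u_0$ (suppressed below): (i) If $u_1-u_2$ is generic, then for all $\varepsilon_1,\varepsilon_2\in I_k$ $$\Phi^{(\ell,\bar\ell)}_{\varepsilon_2}(u_2)\Phi^{(\bar\ell,\ell)}_{\varepsilon_1}(u_1)=\sum_{\varepsilon_1',\varepsilon_2'\in I_k}R^{(k,k)}(u_1-u_2)^{\varepsilon_1'\varepsilon_2'}_{\varepsilon_1\varepsilon_2}\,\Phi^{(\ell,\bar\ell)}_{\varepsilon_1'}(u_1)\Phi^{(\bar\ell,\ell)}_{\varepsilon_2'}(u_2)$$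 on every component $H^{(\ell)}_{m,a}\to H^{(\ell)}_{m,c}$ with $[n]\neq0$ for all integers $n$ with $|n-c|+|n-a|\le2k-2$. (ii) If $f(u-u_0)\ne0$ and $[u-u_0+j]\neq0$ for $0\le j<k$, then $$\sum_{\varepsilon\in I_k}\Phi^{*(\ell,\bar\ell)}_\varepsilon(u)\Phi^{(\bar\ell,\ell)}_\varepsilon(u)=\mathrm{id}$$ on every component $H^{(\ell)}_{m,a}\to H^{(\ell)}_{m,c}$ with $[n]\ne0$ for all integers $n$ with $|n-c|\le k$. Moreover the operator $\Phi^*$ is the $Q$-transform of $\Phi$ at $u-1$ when $f$ is normalised accordingly: let $v=u-u_0$, $[v+j]\ne0$ for $0\le j<k$, and let a matrix $Q=(Q^{\varepsilon'}_\varepsilon)$ and a number $C^{(k)}(v)$ be such that $\psi^{*(k)}_\varepsilon(v)^{a'}_a=C^{(k)}(v)\,G^{(k)}_{a',a}\sum_{\varepsilon'}Q^{\varepsilon'}_\varepsilon\psi^{(k)}_{\varepsilon'}(v-1)^{a'}_a$ for all $\varepsilon\in I_k$ and all $a\in m+\ell+2\mathbb Z$, $a'\in a+I_k$ such that $[n]\neq0$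 for all integers $n$ with $|n-a|+|n-a'|\le k$. If $f(v)\neq0$ and $f(v)f(v-1)=C^{(k)}(v)$, then $\Phi^{*(\bar\ell,\ell)}_\varepsilon(u)=\sum_{\varepsilon'}Q^{\varepsilon'}_\varepsilon\Phi^{(\bar\ell,\ell)}_{\varepsilon'}(u-1)$ on the components $H^{(\ell)}_{m,a}\to H^{(\bar\ell)}_{m,a'}$ with these $a,a'$. -/

import Mathlib

open scoped DirectSum

noncomputable section

namespace FusionVF

/-! ### Theta functions and the symbol `[u]` -/

/-- The modular parameter `τ` attached to `x ∈ (0,1)` and `r` by `x ^ (2r) = exp (-2πi/τ)`. -/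
def tau (x r : ℝ) : ℂ := -(Real.pi * Complex.I) / (r * Real.log x)

/-- `ϑ₁(u|t) = 2 P^{1/8} (P;P)_∞ sin(πu) ∏_{n≥1} (1 - 2 Pⁿ cos(2πu) + P^{2n})`, `P = exp(2πi t)`. -/
def theta1 (u t : ℂ) : ℂ :=
  2 * Complex.exp (2 * Real.pi * Complex.I * t / 8) *
    (∏' n : ℕ, (1 - Complex.exp (2 * Real.pi * Complex.I * t) ^ (n + 1))) *
    Complex.sin (Real.pi * u) *
    ∏' n : ℕ, (1 - 2 * Complex.exp (2 * Real.pi * Complex.I * t) ^ (n + 1) *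
        Complex.cos (2 * Real.pi * u) +
      Complex.exp (2 * Real.pi * Complex.I * t) ^ (2 * (n + 1)))

/-- `ϑ₀(u|t) = -i e^{πi(u+t/4)} ϑ₁(u + t/2 | t)`. -/
def theta0 (u t : ℂ) : ℂ :=
  -Complex.I * Complex.exp (Real.pi * Complex.I * (u + t / 4)) * theta1 (u + t / 2) t

/-- `ϑ₂(u|t) = ϑ₁(u + 1/2 | t)`. -/
def theta2 (u t : ℂ) : ℂ := theta1 (u + 1 / 2) t

/-- `ϑ₃(u|t) = e^{πi(u+t/4)} ϑ₁(u + (t+1)/2 | t)`. -/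
def theta3 (u t : ℂ) : ℂ :=
  Complex.exp (Real.pi * Complex.I * (u + t / 4)) * theta1 (u + (t + 1) / 2) t

/-- The constant `C = x^{-r/4} e^{-πi/4} τ^{1/2}`. -/
def thetaConst (x r : ℝ) : ℂ :=
  (x : ℂ) ^ (-(r : ℂ) / 4) * Complex.exp (-(Real.pi * Complex.I) / 4) *
    tau x r ^ (1 / 2 : ℂ)

/-- `[u] = C ϑ₁(u/r | τ)` (which is also `x^{u²/r - u} Θ_{x^{2r}}(x^{2u})`). -/
def br (x r : ℝ) (u : ℂ) : ℂ := thetaConst x r * theta1 (u / r) (tau x r)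

/-! ### The eight-vertex `R`-matrix -/

/-- `(z; x⁴, x^{2r})_∞`. -/
def poch2 (x r : ℝ) (z : ℂ) : ℂ :=
  ∏' n : ℕ × ℕ, (1 - z * (x : ℂ) ^ (4 * n.1) * ((x ^ (2 * r) : ℝ) : ℂ) ^ n.2)

/-- The scalar factor `R₀(u)`, with `z = x^{2u}`, `p = x^{2r}` and `q² = x²`. -/
def R0 (x r : ℝ) (u : ℂ) : ℂ :=
  let z : ℂ := (x : ℂ) ^ (2 * u)
  let p : ℂ := ((x ^ (2 * r) : ℝ) : ℂ)
  let q2 : ℂ := (x : ℂ) ^ 2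
  (x : ℂ) ^ (-(u * (r - 1) / r)) *
    (poch2 x r (p * q2 * z) * poch2 x r (q2 * z) * poch2 x r (p / z) * poch2 x r (q2 ^ 2 / z)) /
    (poch2 x r (p * q2 / z) * poch2 x r (q2 / z) * poch2 x r (p * z) * poch2 x r (q2 ^ 2 * z))

/-- The weight `a(u)` (without the factor `R₀`). -/
def wtA (x r : ℝ) (u : ℂ) : ℂ :=
  theta2 (1 / (2 * r)) (tau x r / 2) * theta2 (u / (2 * r)) (tau x r / 2) /
    (theta2 0 (tau x r / 2) * theta2 ((1 + u) / (2 * r)) (tau x r / 2))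

/-- The weight `b(u)`. -/
def wtB (x r : ℝ) (u : ℂ) : ℂ :=
  theta2 (1 / (2 * r)) (tau x r / 2) * theta1 (u / (2 * r)) (tau x r / 2) /
    (theta2 0 (tau x r / 2) * theta1 ((1 + u) / (2 * r)) (tau x r / 2))

/-- The weight `c(u)`. -/
def wtC (x r : ℝ) (u : ℂ) : ℂ :=
  theta1 (1 / (2 * r)) (tau x r / 2) * theta2 (u / (2 * r)) (tau x r / 2) /
    (theta2 0 (tau x r / 2) * theta1 ((1 + u) / (2 * r)) (tau x r / 2))

/-- The weight `d(u)`. -/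
def wtD (x r : ℝ) (u : ℂ) : ℂ :=
  -(theta1 (1 / (2 * r)) (tau x r / 2) * theta1 (u / (2 * r)) (tau x r / 2)) /
    (theta2 0 (tau x r / 2) * theta2 ((1 + u) / (2 * r)) (tau x r / 2))

/-- The matrix element `R(u)^{s₁ s₂}_{t₁ t₂}`: the coefficient of `v_{t₁} ⊗ v_{t₂}` in
`R(u) (v_{s₁} ⊗ v_{s₂})`.  The spins `±` are the Booleans, `true` standing for `+`. -/
def Rmat (x r : ℝ) (u : ℂ) (s₁ s₂ t₁ t₂ : Bool) : ℂ :=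
  R0 x r u *
    if s₁ = s₂ then
      if t₁ = s₁ ∧ t₂ = s₂ then wtA x r u
      else if t₁ = !s₁ ∧ t₂ = !s₂ then wtD x r u else 0
    else
      if t₁ = s₁ ∧ t₂ = s₂ then wtB x r u
      else if t₁ = !s₁ ∧ t₂ = !s₂ then wtC x r u else 0

/-! ### Fusion of the `R`-matrix

An operator on `V^{⊗k} ⊗ V^{⊗k}` is a matrix indexed by pairs of spin configurations
`(s, s̄)`, rows being outputs and columns inputs.  The `k + 1` basis vectors `v^{(k)}_ε` of the
space of symmetric tensors, `ε ∈ {-k, -k+2, …, k}`, are labelled by the number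
`e = (k + ε)/2 ∈ {0, …, k}` of `+` signs. -/

/-- Basis labels of `V^{⊗k} ⊗ V^{⊗k}`. -/
abbrev Conf (k : ℕ) : Type := (Fin k → Bool) × (Fin k → Bool)

/-- The number of `+` signs. -/
def plus {k : ℕ} (s : Fin k → Bool) : ℕ := (Finset.univ.filter fun i => s i = true).card

/-- A spin configuration with `e` plus signs: the first `e` spins are `+`. -/
def canon (k e : ℕ) : Fin k → Bool := fun i => decide ((i : ℕ) < e)

/-- `R_{i j̄}(u)` acting on the `i`-th factor of the first and the `j`-th factor of the second
`V^{⊗k}`. -/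
def Rsite (x r : ℝ) {k : ℕ} (u : ℂ) (i j : Fin k) : Matrix (Conf k) (Conf k) ℂ := fun t s =>
  if (∀ i', i' ≠ i → t.1 i' = s.1 i') ∧ (∀ j', j' ≠ j → t.2 j' = s.2 j') then
    Rmat x r u (s.1 i) (s.2 j) (t.1 i) (t.2 j)
  else 0

/-- The symmetrizer `Π_{1⋯k}` of the first `V^{⊗k}`. -/
def sym1 (k : ℕ) : Matrix (Conf k) (Conf k) ℂ := fun t s =>
  (k.factorial : ℂ)⁻¹ *
    ∑ g : Equiv.Perm (Fin k), if t.1 = s.1 ∘ g ∧ t.2 = s.2 then 1 else 0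

/-- The symmetrizer `Π_{1̄⋯k̄}` of the second `V^{⊗k}`. -/
def sym2 (k : ℕ) : Matrix (Conf k) (Conf k) ℂ := fun t s =>
  (k.factorial : ℂ)⁻¹ *
    ∑ g : Equiv.Perm (Fin k), if t.1 = s.1 ∧ t.2 = s.2 ∘ g then 1 else 0

/-- `R_{1⋯k, j̄}(u) = Π_{1⋯k} R_{1 j̄}(u+k-1) ⋯ R_{k-1 j̄}(u+1) R_{k j̄}(u)`. -/
def Rrow (x r : ℝ) {k : ℕ} (u : ℂ) (j : Fin k) : Matrix (Conf k) (Conf k) ℂ :=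
  sym1 k * (List.ofFn fun i : Fin k => Rsite x r (u + (k - 1 - (i : ℕ) : ℂ)) i j).prod

/-- `R^{(k,k)}(u) = Π_{1̄⋯k̄} R_{1⋯k, k̄}(u) R_{1⋯k, (k-1)‾}(u-1) ⋯ R_{1⋯k, 1̄}(u-k+1)`. -/
def Rkk (x r : ℝ) (k : ℕ) (u : ℂ) : Matrix (Conf k) (Conf k) ℂ :=
  sym2 k * (List.ofFn fun j : Fin k => Rrow x r (u - ((j : ℕ) : ℂ)) j.rev).prod

/-- `v^{(k)}_ε = Π_{1⋯k} (v_{ε₁} ⊗ ⋯ ⊗ v_{ε_k})` for a configuration with `e` plus signs. -/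
def vSym (k e : ℕ) : (Fin k → Bool) → ℂ := fun s =>
  (k.factorial : ℂ)⁻¹ * ∑ g : Equiv.Perm (Fin k), if s = canon k e ∘ g then 1 else 0

/-- The matrix element `R^{(k,k)}(u)^{e₁ e₂}_{f₁ f₂}`: the coefficient of
`v^{(k)}_{f₁} ⊗ v^{(k)}_{f₂}` in `R^{(k,k)}(u) (v^{(k)}_{e₁} ⊗ v^{(k)}_{e₂})`.  The coefficient of
`v^{(k)}_f` in a symmetric tensor is the sum of its entries over the configurations with `f`
plus signs. -/
def RkkComp (x r : ℝ) (k : ℕ) (u : ℂ) (e₁ e₂ f₁ f₂ : Fin (k + 1)) : ℂ :=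
  ∑ t : Conf k, if plus t.1 = f₁ ∧ plus t.2 = f₂ then
    (Rkk x r k u).mulVec (fun s => vSym k e₁ s.1 * vSym k e₂ s.2) t else 0

/-! ### The SOS face weights and their fusion -/

/-- The face weight `W(a b; d c | u)` (`a`, `b` upper left and right, `d`, `c` lower left and
right); it vanishes on inadmissible configurations. -/
def faceW (x r : ℝ) (a b d c : ℤ) (u : ℂ) : ℂ :=
  if (a - b).natAbs = 1 ∧ (b - c).natAbs = 1 ∧ (c - d).natAbs = 1 ∧ (d - a).natAbs = 1 then
    if b = d then
      if a = c then
        R0 x r u * (br x r (a - (b - a) * u) * br x r 1) / (br x r a * br x r (1 + u))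
      else R0 x r u
    else R0 x r u * (br x r b * br x r u) / (br x r a * br x r (1 + u))
  else 0

/-- `a - b ∈ {-k, -k+2, …, k}`. -/
def Adm (k : ℕ) (a b : ℤ) : Prop := ∃ j : Fin (k + 1), a - b = 2 * (j : ℕ) - k

instance (k : ℕ) (a b : ℤ) : Decidable (Adm k a b) := by unfold Adm; infer_instance

/-- The `i`-th height of the path that starts at `a` and has the steps `±1` given by `s`. -/
def walk {k : ℕ} (a : ℤ) (s : Fin k → Bool) (i : ℕ) : ℤ :=
  a + ∑ j : Fin k, if (j : ℕ) < i then (if s j then 1 else -1) else 0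

/-- For `a - b ∈ {-k, …, k}`, the path of `k` steps `±1` from `a` (at `i = 0`) to `b` (at `i = k`)
that first goes up and then down.  It is the reference path in all the fused quantities that do
not depend on the choice of such a path. -/
def refPath (k : ℕ) (a b : ℤ) (i : ℕ) : ℤ := min (a + i) (b + (k - i))

/-- `W^{(k,1)}(a b; d c | u) = ∑_{d₁,…,d_{k-1}} ∏_{i<k} W(a_i a_{i+1}; d_i d_{i+1} | u+k-1-i)`. -/
def Wk1 (x r : ℝ) (k : ℕ) (a b d c : ℤ) (u : ℂ) : ℂ :=
  if Adm k a b then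
    ∑ s : Fin k → Bool, if walk d s k = c then
      ∏ i : Fin k, faceW x r (refPath k a b i) (refPath k a b (i + 1))
        (walk d s i) (walk d s (i + 1)) (u + (k - 1 - (i : ℕ) : ℂ))
    else 0
  else 0

/-- `W^{(k,k)}(a b; d c | u) =
∑_{a₁,…,a_{k-1}} ∏_{j<k} W^{(k,1)}(a_j b_j; a_{j+1} b_{j+1} | u-k+1+j)`. -/
def Wkk (x r : ℝ) (k : ℕ) (a b d c : ℤ) (u : ℂ) : ℂ :=
  if Adm k b c then
    ∑ s : Fin k → Bool, if walk a s k = d then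
      ∏ j : Fin k, Wk1 x r k (walk a s j) (refPath k b c j)
        (walk a s (j + 1)) (refPath k b c (j + 1)) (u - k + 1 + ((j : ℕ) : ℂ))
    else 0
  else 0

/-! ### Intertwining vectors -/

/-- `ψ_ε(u)^a_b` for `|a - b| = 1`. -/
def psi (x r : ℝ) (ε : Bool) (u : ℂ) (a b : ℤ) : ℂ :=
  if ε then theta0 (((a - b) * u + a) / (2 * r)) (tau x r / 2)
  else theta3 (((a - b) * u + a) / (2 * r)) (tau x r / 2)

/-- `ψ*_ε(u)^a_b = -ε (a-b)/(2[b][u]) C² ψ_{-ε}(u-1)^a_b` for `|a - b| = 1`. -/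
def psiStar (x r : ℝ) (ε : Bool) (u : ℂ) (a b : ℤ) : ℂ :=
  -(if ε then 1 else -1) * ((a - b) / (2 * br x r b * br x r u)) * thetaConst x r ^ 2 *
    psi x r (!ε) (u - 1) a b

/-- `ψ^{(k)}_ε(u)^a_b`, the coefficients of
`Π_{1⋯k} ψ(u+k-1)^a_{c₁} ⊗ ψ(u+k-2)^{c₁}_{c₂} ⊗ ⋯ ⊗ ψ(u)^{c_{k-1}}_b` in the basis `v^{(k)}_ε`. -/
def psiK (x r : ℝ) (k : ℕ) (e : Fin (k + 1)) (u : ℂ) (a b : ℤ) : ℂ :=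
  if Adm k a b then
    ∑ s : Fin k → Bool, if plus s = e then
      ∏ i : Fin k, psi x r (s i) (u + (k - 1 - (i : ℕ) : ℂ))
        (refPath k a b i) (refPath k a b (i + 1))
    else 0
  else 0

/-- `ψ^{*(k)}_ε(u)^a_b = ∑_{c₁,…,c_{k-1}}
ψ*_{ε₁}(u+k-1)^{c₁}_b ψ*_{ε₂}(u+k-2)^{c₂}_{c₁} ⋯ ψ*_{ε_k}(u)^a_{c_{k-1}}`
with `ε = ε₁ + ⋯ + ε_k`. -/
def psiStarK (x r : ℝ) (k : ℕ) (e : Fin (k + 1)) (u : ℂ) (a b : ℤ) : ℂ :=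
  ∑ s : Fin k → Bool, if walk b s k = a then
    ∏ i : Fin k, psiStar x r (canon k e i) (u + (k - 1 - (i : ℕ) : ℂ))
      (walk b s (i + 1)) (walk b s i)
  else 0

/-! ### The gauge factor `G^{(k)}` -/

/-- The elliptic binomial coefficient `[A][A-1]⋯[A-B+1] / ([B][B-1]⋯[1])`. -/
def ellBinom (x r : ℝ) (A B : ℕ) : ℂ :=
  ∏ i ∈ Finset.range B, br x r ((A : ℂ) - i) / br x r ((B : ℂ) - i)

/-- A square root `√[a]`. -/
def sqrtBr (x r : ℝ) (a : ℤ) : ℂ := br x r a ^ (1 / 2 : ℂ)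

/-- `(a,b)_k`, for `a - b ∈ {-k, …, k}`; the denominator `√([a][b])` is `√[a] √[b]`. -/
def gaugeSym (x r : ℝ) (k : ℕ) (a b : ℤ) : ℂ :=
  (ellBinom x r k ((a - b + k) / 2).toNat)⁻¹ *
    (∏ i ∈ Finset.range (k + 1), br x r (((a + b - k) / 2 + i : ℤ) : ℂ)) /
    (sqrtBr x r a * sqrtBr x r b)

/-- Signs `s_a = ±1` with `s_a s_{a+1} = (-1)^a`. -/
def heightSign (a : ℤ) : ℂ := if a % 4 = 0 ∨ a % 4 = 1 then 1 else -1

/-- `g_a = s_a √[a]`. -/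
def gFac (x r : ℝ) (a : ℤ) : ℂ := heightSign a * sqrtBr x r a

/-- `G^{(k)}_{a,b} = g_a / (g_b (a,b)_k)`. -/
def gaugeG (x r : ℝ) (k : ℕ) (a b : ℤ) : ℂ := gFac x r a / (gFac x r b * gaugeSym x r k a b)

/-! ### Domains of definition -/

/-- No shift of `u` by an integer is a zero of `[·]`, so that none of the weights
`R₀(u+j)`, `R(u+j)`, `W(⋯|u+j)` with `j ∈ ℤ` has a pole or vanishing denominator in `u`. -/
def Generic (x r : ℝ) (u : ℂ) : Prop := ∀ n : ℤ, br x r (u + n) ≠ 0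

/-- The heights at which the face weights inside a `k × k` block with upper left height `c` and
lower right height `a` have a denominator satisfy `[n] ≠ 0`. -/
def FaceRegular (x r : ℝ) (k : ℕ) (c a : ℤ) : Prop :=
  ∀ n : ℤ, |n - c| + |n - a| ≤ 2 * (k : ℤ) - 2 → br x r n ≠ 0

/-- `[n] ≠ 0` for all heights within distance `k` of `a`. -/
def HeightRegular (x r : ℝ) (k : ℕ) (a : ℤ) : Prop :=
  ∀ n : ℤ, |n - a| ≤ k → br x r n ≠ 0

/-- `[n] ≠ 0` for all heights on paths of `k` steps between `a` and `b`. -/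
def EdgeRegular (x r : ℝ) (k : ℕ) (a b : ℤ) : Prop :=
  ∀ n : ℤ, |n - a| + |n - b| ≤ k → br x r n ≠ 0

/-! ### SOS half transfer matrices -/

/-- The central heights `a ∈ m + ℓ + 2ℤ`. -/
abbrev Height (m : ℤ) (ℓ : ℕ) : Type := {a : ℤ // ∃ n : ℤ, a = m + ℓ + 2 * n}

/-- The neighbour `a + 2j - k ∈ a + {-k, -k+2, …, k}` of `a ∈ m + ℓ + 2ℤ`; it lies in
`m + ℓ' + 2ℤ` if `ℓ + ℓ' = k`. -/
def nbr {m : ℤ} {k ℓ ℓ' : ℕ} (h : ℓ + ℓ' = k) (a : Height m ℓ) (j : Fin (k + 1)) :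
    Height m ℓ' :=
  ⟨a.1 + 2 * (j : ℕ) - k, by
    obtain ⟨n, hn⟩ := a.2
    refine ⟨n + (j : ℕ) - ℓ', ?_⟩
    subst h
    push_cast
    rw [hn]
    ring⟩

section SOS

variable (x r : ℝ) {k : ℕ} {m : ℤ} {H : (ℓ : ℕ) → Height m ℓ → Type*}
  [∀ ℓ a, AddCommGroup (H ℓ a)] [∀ ℓ a, Module ℂ (H ℓ a)]
  (Φ : ∀ {ℓ ℓ' : ℕ}, ℓ + ℓ' = k → (b : Height m ℓ') → (a : Height m ℓ) → ℂ →
    (H ℓ a →ₗ[ℂ] H ℓ' b))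

/-- The dual half transfer matrix `Φ*_{b,a}(u) = Φ_{b,a}(u-1) / G^{(k)}_{b,a}`. -/
def dualHTM {ℓ ℓ' : ℕ} (h : ℓ + ℓ' = k) (b : Height m ℓ') (a : Height m ℓ) (u : ℂ) :
    H ℓ a →ₗ[ℂ] H ℓ' b :=
  (gaugeG x r k b a)⁻¹ • Φ h b a (u - 1)

/-- The half transfer matrices `Φ_{b,a}(u) : H^{(ℓ)}_{m,a} → H^{(ℓ̄)}_{m,b}`, `ℓ̄ = k - ℓ`, of the
`k × k` fusion SOS model: systems of linear maps on spaces of states with central heights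
`a ∈ m + ℓ + 2ℤ`, governed by the exchange relation with the face weights `W^{(k,k)}` and by the
inversion relation, wherever these weights are defined. -/
structure IsSOSHalfTransfer : Prop where
  exchange : ∀ {ℓ ℓ' : ℕ} (h : ℓ + ℓ' = k) (h' : ℓ' + ℓ = k)
    (c : Height m ℓ) (b : Height m ℓ') (a : Height m ℓ) (u₁ u₂ : ℂ),
    Adm k c b → Adm k b a → FaceRegular x r k c a → Generic x r (u₁ - u₂) →
    Φ h' c b u₂ ∘ₗ Φ h b a u₁ =
      ∑ j : Fin (k + 1), Wkk x r k c (nbr h a j) b a (u₁ - u₂) •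
        (Φ h' c (nbr h a j) u₁ ∘ₗ Φ h (nbr h a j) a u₂)
  inversion : ∀ {ℓ ℓ' : ℕ} (h : ℓ + ℓ' = k) (h' : ℓ' + ℓ = k) (b : Height m ℓ) (u : ℂ),
    HeightRegular x r k b →
    ∑ j : Fin (k + 1), dualHTM x r Φ h' b (nbr h b j) u ∘ₗ Φ h (nbr h b j) b u = LinearMap.id

/-! ### The dressed operators -/

/-- `Φ^{(ℓ̄,ℓ)}_ε(u;u₀) = f(u-u₀) ⨁_{a, a'} ψ^{(k)}_ε(u-u₀)^{a'}_a Φ_{a',a}(u)`, from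
`⨁_{a ∈ m+ℓ+2ℤ} H^{(ℓ)}_{m,a}` to `⨁_{a' ∈ m+ℓ̄+2ℤ} H^{(ℓ̄)}_{m,a'}`. -/
def vertexHTM (f : ℂ → ℂ) (u₀ : ℂ) {ℓ ℓ' : ℕ} (h : ℓ + ℓ' = k) (e : Fin (k + 1)) (u : ℂ) :
    (⨁ a : Height m ℓ, H ℓ a) →ₗ[ℂ] (⨁ b : Height m ℓ', H ℓ' b) :=
  f (u - u₀) • DirectSum.toModule ℂ (Height m ℓ) (⨁ b : Height m ℓ', H ℓ' b) fun a =>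
    ∑ j : Fin (k + 1), psiK x r k e (u - u₀) (nbr h a j) a •
      (DirectSum.lof ℂ (Height m ℓ') (H ℓ') (nbr h a j) ∘ₗ Φ h (nbr h a j) a u)

/-- `Φ^{*(ℓ̄,ℓ)}_ε(u;u₀) = f(u-u₀)⁻¹ ⨁_{a, a'} ψ^{*(k)}_ε(u-u₀)^{a'}_a Φ*_{a',a}(u)`. -/
def vertexDualHTM (f : ℂ → ℂ) (u₀ : ℂ) {ℓ ℓ' : ℕ} (h : ℓ + ℓ' = k) (e : Fin (k + 1)) (u : ℂ) :
    (⨁ a : Height m ℓ, H ℓ a) →ₗ[ℂ] (⨁ b : Height m ℓ', H ℓ' b) :=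
  (f (u - u₀))⁻¹ • DirectSum.toModule ℂ (Height m ℓ) (⨁ b : Height m ℓ', H ℓ' b) fun a =>
    ∑ j : Fin (k + 1), psiStarK x r k e (u - u₀) (nbr h a j) a •
      (DirectSum.lof ℂ (Height m ℓ') (H ℓ') (nbr h a j) ∘ₗ dualHTM x r Φ h (nbr h a j) a u)

end SOS

/-- The component of an operator `⨁_a M_a → ⨁_b N_b` from `M_a` to `N_b`. -/
def block {ι κ : Type*} [DecidableEq ι] {M : ι → Type*} {N : κ → Type*}
    [∀ i, AddCommGroup (M i)] [∀ i, Module ℂ (M i)] [∀ i, AddCommGroup (N i)]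
    [∀ i, Module ℂ (N i)] (T : (⨁ i, M i) →ₗ[ℂ] (⨁ i, N i)) (b : κ) (a : ι) : M a →ₗ[ℂ] N b :=
  DirectSum.component ℂ κ N b ∘ₗ T ∘ₗ DirectSum.lof ℂ ι M a

end FusionVF

end

open scoped DirectSum

noncomputable section

namespace FusionVF

open Filter Topology Complex

/-! ### The Jacobi triple product -/

/-! The vertex operators are SOS half transfer matrices dressed with intertwining vectors, so each
block of a vertex-side relation reduces to an SOS relation and a scalar identity between these
vectors. For the exchange relation, the SOS exchange produces sums W·ψψ over the intermediate
height, and the fused vertex-face correspondence `sum_RkkComp_psiK` rewrites them as R·ψψ. For the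
inversion relation, `sum_psiStarK_mul_psiK` makes the sum over ε a Kronecker delta in the outer
heights, and the SOS inversion remains. The statement on Q is a substitution, in which
`gaugeG_ne_zero` allows the gauge factor to cancel.

The elementary correspondence `vertex_face` rests on a diagonalization. On the four symmetric and
antisymmetric combinations of the v⊗v, the matrix R(u)/R₀(u) has eigenvalues
ϑ_i((u-1)/2r)/ϑ_i((u+1)/2r) at modulus τ. By the addition formulae derived from `theta3_mul_theta3`,
the corresponding components of a tensor product of two vectors (ϑ₀,ϑ₃) at modulus τ/2 are
2ϑ_i(X+Y)ϑ_i(X-Y) up to sign. A straight path then needs only the parity of ϑ_i. A turn needs a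
three-term relation, which is Cramer's rule in dimension two because 2ϑ₁(x+y)ϑ₁(x-y) is a
determinant of such vectors. The theta functions are handled as series, to which the triple product
gives access.

Fusion uses that R(w+1)R(w) on neighbouring factors preserves antisymmetric tensors (`wt_fusion`,
`Rmat_fusion`). Hence one symmetrizer on the left absorbs all the others, and only the bare product
of k² matrices matters (`weightForm_Rkk`). It is evaluated face by face along a row
(`rowProd_mulVec`), then row by row (`sym1_blockProd_mulVec`). A row leaves an arbitrary lower path,
which may be replaced by the reference path since a symmetrized tensor of intertwining vectors
depends only on the end points (`sum_pathVec_walk`).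

The dual vectors invert the vectors one step at a time along a path; to pass to fused components one
needs that they are symmetric in their signs (`starSum_perm`). Throughout, a path sum vanishes when
its prescribed end is out of reach, so [n] ≠ 0 is needed only for heights near the corners. -/

/-- `(P; P)_k`. -/
def qPoch (P : ℂ) (k : ℕ) : ℂ := ∏ i ∈ Finset.range k, (1 - P ^ (i + 1))

/-- `1 / (P; P)_m`, extended by zero to negative `m`. -/
def qPochInv (P : ℂ) (m : ℤ) : ℂ := if m < 0 then 0 else (qPoch P m.toNat)⁻¹

lemma one_sub_pow_ne_zero {P : ℂ} (hP : ‖P‖ < 1) (n : ℕ) : 1 - P ^ (n + 1) ≠ 0 := by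
  intro h
  have h1 : ‖P ^ (n + 1)‖ = 1 := by rw [← sub_eq_zero.mp h, norm_one]
  rw [norm_pow] at h1
  exact absurd h1 (pow_lt_one₀ (norm_nonneg _) hP (Nat.succ_ne_zero n)).ne

/-- Extending by zero is what makes this recursion valid for every integer: at m = 0 the factor 1 -
P^0 vanishes together with the left side. -/
lemma qPochInv_sub_one {P : ℂ} (hP : ‖P‖ < 1) (m : ℤ) :
    qPochInv P (m - 1) = (1 - P ^ m) * qPochInv P m := by
  rcases lt_trichotomy m 0 with h | h | h
  · simp [qPochInv, h, show m - 1 < 0 by omega]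
  · subst h; simp [qPochInv]
  · obtain ⟨k, rfl⟩ : ∃ k : ℕ, m = k + 1 := ⟨(m - 1).toNat, by omega⟩
    have h1 : ¬ ((k : ℤ) + 1 < 0) := by omega
    have h2 : ¬ ((k : ℤ) < 0) := by omega
    have h3 : ((k : ℤ) + 1).toNat = k + 1 := by omega
    have h4 : P ^ ((k : ℤ) + 1) = P ^ (k + 1) := by exact_mod_cast zpow_natCast P (k + 1)
    simp only [qPochInv, add_sub_cancel_right, h1, h2, if_false, h3, Int.toNat_natCast, h4]
    rw [qPoch, qPoch, Finset.prod_range_succ, mul_inv, mul_left_comm,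
      mul_inv_cancel₀ (one_sub_pow_ne_zero hP k), mul_one]

/-- The finite form of the triple product. -/
lemma hasSum_finite_triple {P y : ℂ} (hP : ‖P‖ < 1) (hP0 : P ≠ 0) (hy : y ≠ 0) {a : ℤ → ℂ}
    (ha0 : a 0 = 1) (ha : ∀ n, a (n + 1) = -(P ^ n * y) * a n) (N : ℕ) :
    HasSum (fun n : ℤ => qPoch P (2 * N) * qPochInv P (N + n) * qPochInv P (N - n) * a n)
      (∏ i ∈ Finset.range N, (1 - y * P ^ i) * (1 - P ^ (i + 1) / y)) := by
  induction N with
  | zero =>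
    have h : (fun n : ℤ => qPoch P (2 * 0) * qPochInv P ((0 : ℕ) + n) * qPochInv P ((0 : ℕ) - n) *
        a n) = fun n => if n = 0 then 1 else 0 := by
      funext n
      rcases lt_trichotomy n 0 with h | h | h
      · simp [qPochInv, h, h.ne]
      · subst h; simp [qPochInv, qPoch, ha0]
      · simp [qPochInv, h, h.ne']
    rw [h]
    simpa using hasSum_ite_eq (0 : ℤ) (1 : ℂ)
  | succ N ih =>
    -- The new factor expands as (1 + P^(2N+1)) - y P^N - P^(N+1)/y. In the last two terms the power
    -- of y is absorbed by shifting the summation index by one, using the recursion for `a`.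
    have e1 := (Equiv.addRight (-1 : ℤ)).hasSum_iff.mpr ih
    have e2 := (Equiv.addRight (1 : ℤ)).hasSum_iff.mpr ih
    have := ((ih.mul_left (1 + P ^ (2 * N + 1))).add (e1.mul_left (-(y * P ^ N)))).add
      (e2.mul_left (-(P ^ (N + 1) / y)))
    rw [Finset.prod_range_succ]
    have hv : (∏ i ∈ Finset.range N, (1 - y * P ^ i) * (1 - P ^ (i + 1) / y)) *
        ((1 - y * P ^ N) * (1 - P ^ (N + 1) / y)) =
        (1 + P ^ (2 * N + 1)) * (∏ i ∈ Finset.range N, (1 - y * P ^ i) * (1 - P ^ (i + 1) / y)) +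
        -(y * P ^ N) * (∏ i ∈ Finset.range N, (1 - y * P ^ i) * (1 - P ^ (i + 1) / y)) +
        -(P ^ (N + 1) / y) * ∏ i ∈ Finset.range N, (1 - y * P ^ i) * (1 - P ^ (i + 1) / y) := by
      generalize ∏ i ∈ Finset.range N, (1 - y * P ^ i) * (1 - P ^ (i + 1) / y) = S
      field_simp
      ring
    rw [hv]
    refine this.congr_fun fun n => ?_
    · clear this e1 e2 ih hv
      have r1 := ha (n - 1)
      have r2 := ha n
      rw [sub_add_cancel] at r1
      have q : qPoch P (2 * (N + 1)) = qPoch P (2 * N) * (1 - P ^ (2 * N + 1)) *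
          (1 - P ^ (2 * N + 2)) := by
        rw [show 2 * (N + 1) = 2 * N + 1 + 1 by ring, qPoch, Finset.prod_range_succ,
          Finset.prod_range_succ, qPoch]
      have f1 : qPochInv P (N + n) = (1 - P ^ (N + 1 + n : ℤ)) * qPochInv P ((N + 1 : ℕ) + n) := by
        rw [← show ((N + 1 : ℕ) + n - 1 : ℤ) = N + n by push_cast; ring, qPochInv_sub_one hP]
        push_cast; rfl
      have f2 : qPochInv P (N - n) = (1 - P ^ (N + 1 - n : ℤ)) * qPochInv P ((N + 1 : ℕ) - n) := by
        rw [← show ((N + 1 : ℕ) - n - 1 : ℤ) = N - n by push_cast; ring, qPochInv_sub_one hP]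
        push_cast; rfl
      have f3 : qPochInv P (N + (n + -1)) = (1 - P ^ (N + n : ℤ)) * qPochInv P (N + n) := by
        rw [← qPochInv_sub_one hP]; congr 1; ring
      have f4 : qPochInv P (N - (n + 1)) = (1 - P ^ (N - n : ℤ)) * qPochInv P (N - n) := by
        rw [← qPochInv_sub_one hP]; congr 1; ring
      have f5 : qPochInv P (N - (n + -1)) = qPochInv P ((N + 1 : ℕ) - n) := by
        congr 1; push_cast; ring
      have f6 : qPochInv P (N + (n + 1)) = qPochInv P ((N + 1 : ℕ) + n) := by
        congr 1; push_cast; ring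
      simp only [Function.comp_apply, Equiv.coe_addRight]
      rw [f3, f4, f5, f6, f1, f2, q, r2, ← sub_eq_add_neg, r1]
      have hs : P ^ n ≠ 0 := zpow_ne_zero _ hP0
      have z1 : P ^ (N + 1 + n : ℤ) = P ^ N * P * P ^ n := by
        rw [zpow_add₀ hP0, zpow_add₀ hP0]; simp
      have z2 : P ^ (N + 1 - n : ℤ) = P ^ N * P / P ^ n := by
        rw [zpow_sub₀ hP0, zpow_add₀ hP0]; simp
      have z3 : P ^ (N + n : ℤ) = P ^ N * P ^ n := by
        rw [zpow_add₀ hP0]; simp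
      have z4 : P ^ (N - n : ℤ) = P ^ N / P ^ n := by
        rw [zpow_sub₀ hP0]; simp
      have z5 : P ^ (n - 1 : ℤ) = P ^ n / P := by
        rw [zpow_sub₀ hP0]; simp
      rw [z1, z2, z3, z4, z5]
      have p1 : P ^ (2 * N + 1) = (P ^ N) ^ 2 * P := by ring
      have p2 : P ^ (2 * N + 2) = (P ^ N) ^ 2 * P ^ 2 := by ring
      rw [p1, p2, pow_succ P N]
      generalize P ^ n = s at *
      generalize P ^ N = A at *
      generalize qPochInv P _ = E1
      generalize qPochInv P _ = E2
      generalize qPoch P _ = E3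
      generalize a (n - 1) = E4
      field_simp
      ring

lemma summable_norm_pow_succ {P : ℂ} (hP : ‖P‖ < 1) (c : ℂ) :
    Summable fun n : ℕ => ‖-(c * P ^ (n + 1))‖ := by
  simp only [norm_neg, norm_mul, norm_pow, pow_succ]
  exact (((summable_geometric_of_lt_one (norm_nonneg _) hP).mul_right _).mul_left _)

lemma multipliable_one_sub_mul_pow {P : ℂ} (hP : ‖P‖ < 1) (c : ℂ) :
    Multipliable fun n : ℕ => (1 - c * P ^ (n + 1)) := by
  simpa [sub_eq_add_neg] using multipliable_one_add_of_summable (summable_norm_pow_succ hP c)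

lemma tprod_one_sub_mul_pow_ne_zero {P : ℂ} (hP : ‖P‖ < 1) (c : ℂ)
    (hc : ∀ n : ℕ, 1 - c * P ^ (n + 1) ≠ 0) : ∏' n : ℕ, (1 - c * P ^ (n + 1)) ≠ 0 := by
  have := tprod_one_add_ne_zero_of_summable (f := fun n : ℕ => -(c * P ^ (n + 1)))
    (by simpa [sub_eq_add_neg] using hc) (summable_norm_pow_succ hP c)
  simpa [sub_eq_add_neg] using this

lemma tendsto_qPoch {P : ℂ} (hP : ‖P‖ < 1) :
    Tendsto (qPoch P) atTop (𝓝 (∏' n : ℕ, (1 - P ^ (n + 1)))) := by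
  simpa [qPoch] using! (multipliable_one_sub_mul_pow hP 1).tendsto_prod_tprod_nat

lemma tprod_qPoch_ne_zero {P : ℂ} (hP : ‖P‖ < 1) : ∏' n : ℕ, (1 - P ^ (n + 1)) ≠ 0 := by
  simpa using tprod_one_sub_mul_pow_ne_zero hP 1 (by simpa using one_sub_pow_ne_zero hP)

/-- The Jacobi triple product, for the sequence `a n = (-1)ⁿ P^{n(n-1)/2} yⁿ`. -/
lemma tsum_eq_triple_product {P y : ℂ} (hP : ‖P‖ < 1) (hP0 : P ≠ 0) (hy : y ≠ 0) {a : ℤ → ℂ}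
    (ha0 : a 0 = 1) (ha : ∀ n, a (n + 1) = -(P ^ n * y) * a n) (hs : Summable a) :
    ∑' n, a n = (∏' n : ℕ, (1 - P ^ (n + 1))) * (1 - y) *
      ∏' n : ℕ, ((1 - y * P ^ (n + 1)) * (1 - y⁻¹ * P ^ (n + 1))) := by
  set L := ∏' n : ℕ, (1 - P ^ (n + 1)) with hL
  have hL0 : L ≠ 0 := tprod_qPoch_ne_zero hP
  have hq : Tendsto (qPoch P) atTop (𝓝 L) := tendsto_qPoch hP
  have hqi : Tendsto (fun k => (qPoch P k)⁻¹) atTop (𝓝 L⁻¹) := hq.inv₀ hL0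
  obtain ⟨K1, hK1⟩ := (Metric.isBounded_range_of_tendsto _ hq).exists_norm_le
  obtain ⟨K2, hK2⟩ := (Metric.isBounded_range_of_tendsto _ hqi).exists_norm_le
  have hK1' : ∀ k, ‖qPoch P k‖ ≤ K1 := fun k => hK1 _ ⟨k, rfl⟩
  have hK2' : ∀ m, ‖qPochInv P m‖ ≤ K2 := by
    intro m
    by_cases h : m < 0
    · simpa [qPochInv, h] using (norm_nonneg _).trans (hK2 _ ⟨0, rfl⟩)
    · simpa [qPochInv, h] using hK2 _ ⟨m.toNat, rfl⟩
  have hK10 : 0 ≤ K1 := (norm_nonneg _).trans (hK1' 0)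
  have hK20 : 0 ≤ K2 := (norm_nonneg _).trans (hK2' 0)
  have hinv : ∀ g : ℕ → ℤ, Tendsto g atTop atTop →
      Tendsto (fun N => qPochInv P (g N)) atTop (𝓝 L⁻¹) := by
    intro g hg
    have h1 : Tendsto (fun N => (g N).toNat) atTop atTop := by
      refine tendsto_atTop.mpr fun b => ?_
      filter_upwards [hg.eventually_ge_atTop (b : ℤ)] with N hN
      omega
    refine (hqi.comp h1).congr' ?_
    filter_upwards [hg.eventually_ge_atTop 0] with N hN
    simp [qPochInv, not_lt.mpr hN]
  -- Dominated convergence: the q-Pochhammer coefficients are bounded uniformly in N and n, and each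
  -- tends to L · L⁻¹ · L⁻¹.
  have T1 : Tendsto (fun N : ℕ => ∑' n : ℤ, qPoch P (2 * N) * qPochInv P (N + n) *
      qPochInv P (N - n) * a n) atTop (𝓝 (∑' n, L * L⁻¹ * L⁻¹ * a n)) := by
    refine tendsto_tsum_of_dominated_convergence (bound := fun n => K1 * K2 * K2 * ‖a n‖)
      (hs.norm.mul_left _) ?_ ?_
    · intro n
      refine Tendsto.mul_const _ (Tendsto.mul (Tendsto.mul ?_ ?_) ?_)
      · exact hq.comp (tendsto_id.const_mul_atTop' (by norm_num))
      · exact hinv _ (tendsto_atTop_add_const_right _ _ tendsto_natCast_atTop_atTop)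
      · exact hinv _ (tendsto_atTop_add_const_right _ _ tendsto_natCast_atTop_atTop)
    · refine Eventually.of_forall fun N n => ?_
      rw [norm_mul, norm_mul, norm_mul]
      have := hK1' (2 * N)
      have := hK2' (N + n)
      have := hK2' (N - n)
      gcongr
  simp_rw [(hasSum_finite_triple hP hP0 hy ha0 ha _).tsum_eq, tsum_mul_left] at T1
  -- The extra factor tends to 1. It completes the product of the 1 - y P^i over i < N to i ≤ N, so
  -- that 1 - y can be split off and the rest is indexed by P^(i+1).
  have T2 : Tendsto (fun N : ℕ => 1 - y * P ^ N) atTop (𝓝 (1 - y * 0)) :=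
    ((tendsto_pow_atTop_nhds_zero_of_norm_lt_one hP).const_mul y).const_sub 1
  have T3 := T1.mul T2
  have T4 := ((((multipliable_one_sub_mul_pow hP y).mul
    (multipliable_one_sub_mul_pow hP y⁻¹)).tendsto_prod_tprod_nat).const_mul (1 - y))
  have h : (fun N : ℕ => (∏ i ∈ Finset.range N, (1 - y * P ^ i) * (1 - P ^ (i + 1) / y)) *
      (1 - y * P ^ N)) = fun N => (1 - y) * ∏ i ∈ Finset.range N,
      ((1 - y * P ^ (i + 1)) * (1 - y⁻¹ * P ^ (i + 1))) := by
    funext N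
    simp only [Finset.prod_mul_distrib, div_eq_inv_mul]
    have := (Finset.prod_range_succ (fun i => 1 - y * P ^ i) N).symm.trans
      (Finset.prod_range_succ' (fun i => 1 - y * P ^ i) N)
    simp only [pow_zero, mul_one] at this
    linear_combination (∏ x ∈ Finset.range N, (1 - y⁻¹ * P ^ (x + 1))) * this
  rw [h] at T3
  have := tendsto_nhds_unique T3 T4
  rw [mul_assoc L, ← this]
  field_simp
  ring

/-! ### Theta series -/

lemma norm_exp_lt_one {t : ℂ} (ht : 0 < t.im) : ‖exp (2 * Real.pi * I * t)‖ < 1 := by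
  rw [norm_exp, Real.exp_lt_one_iff]
  simp only [mul_re, mul_im, I_re, I_im, ofReal_re, ofReal_im, re_ofNat, im_ofNat]
  have := mul_pos Real.pi_pos ht
  nlinarith

/-- The terms of the series on the right satisfy the recursion of the triple product with P =
exp(2πit), y = exp(2πiu): the shift by 1/2 produces the signs and the shift by t/2 turns n² into
n(n-1). All four theta functions thereby become values of one series. -/
lemma theta1_eq_jacobi {t : ℂ} (ht : 0 < t.im) (u : ℂ) :
    theta1 u t = I * exp (-(Real.pi * I * u) + Real.pi * I * t / 4) *
      jacobiTheta₂ (u - 1 / 2 - t / 2) t := by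
  set P := exp (2 * Real.pi * I * t) with hPdef
  set y := exp (2 * Real.pi * I * u) with hydef
  have hP : ‖P‖ < 1 := norm_exp_lt_one ht
  have key := tsum_eq_triple_product (P := P) (y := y)
    (a := fun n => jacobiTheta₂_term n (u - 1 / 2 - t / 2) t) hP (exp_ne_zero _) (exp_ne_zero _)
    (by simp [jacobiTheta₂_term]) ?_ ((summable_jacobiTheta₂_term_iff _ _).mpr ht)
  swap
  · intro n
    rw [← neg_one_mul, ← exp_pi_mul_I, hPdef, ← exp_int_mul, hydef, jacobiTheta₂_term,
      jacobiTheta₂_term, ← exp_add, ← exp_add, ← exp_add, exp_eq_exp_iff_exists_int]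
    -- The series contributes exp(-πi) where the sign was written as exp(πi), so the exponents
    -- differ by -2πi.
    refine ⟨-1, ?_⟩
    push_cast
    ring
  rw [jacobiTheta₂, key, theta1]
  have h1 : exp (2 * Real.pi * I * t / 8) = exp (Real.pi * I * t / 4) := by congr 1; ring
  have hw : exp (Real.pi * I * u) ≠ 0 := exp_ne_zero _
  have h2 : sin (Real.pi * u) = (exp (-(Real.pi * I * u)) - exp (Real.pi * I * u)) * I / 2 := by
    rw [sin]; congr 4 <;> ring
  have h3 : y = exp (Real.pi * I * u) ^ 2 := by rw [hydef, ← exp_nat_mul]; congr 1; push_cast; ring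
  have h4 : ∀ n : ℕ, 1 - 2 * P ^ (n + 1) * cos (2 * Real.pi * u) + P ^ (2 * (n + 1)) =
      (1 - y * P ^ (n + 1)) * (1 - y⁻¹ * P ^ (n + 1)) := by
    intro n
    have : cos (2 * Real.pi * u) = (y + y⁻¹) / 2 := by
      rw [cos, hydef, ← exp_neg]; congr 3 <;> ring
    rw [this, pow_mul']
    have hy : y ≠ 0 := exp_ne_zero _
    field_simp
    ring
  simp_rw [← hPdef, h4]
  rw [h1, h2, exp_add, exp_neg, h3]
  field_simp

lemma theta3_eq_jacobi {t : ℂ} (ht : 0 < t.im) (u : ℂ) : theta3 u t = jacobiTheta₂ u t := by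
  rw [theta3, theta1_eq_jacobi ht, show u + (t + 1) / 2 - 1 / 2 - t / 2 = u by ring, ← mul_assoc,
    ← mul_assoc, mul_right_comm (exp _) I, ← exp_add]
  rw [show Real.pi * I * (u + t / 4) + (-(Real.pi * I * (u + (t + 1) / 2)) + Real.pi * I * t / 4)
    = -(Real.pi / 2 * I) by ring, exp_neg, exp_pi_div_two_mul_I]
  simp

lemma theta0_eq_jacobi {t : ℂ} (ht : 0 < t.im) (u : ℂ) :
    theta0 u t = jacobiTheta₂ (u + 1 / 2) t := by
  rw [theta0, theta1_eq_jacobi ht, show u + 1 / 2 = (u + t / 2 - 1 / 2 - t / 2) + 1 by ring,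
    jacobiTheta₂_add_left, show ∀ a b c d : ℂ, -I * a * (I * c * d) = (a * c) * d by
      intro a b c d; linear_combination (-a * c * d) * I_sq, ← exp_add]
  · rw [show Real.pi * I * (u + t / 4) + (-(Real.pi * I * (u + t / 2)) + Real.pi * I * t / 4)
      = 0 by ring]
    simp
  · exact 0

lemma theta2_eq_jacobi {t : ℂ} (ht : 0 < t.im) (u : ℂ) :
    theta2 u t = exp (Real.pi * I * (u + t / 4)) * jacobiTheta₂ (u + t / 2) t := by
  have h := jacobiTheta₂_add_left' (u - t / 2) t
  rw [sub_add, show t / 2 - t = - (t / 2) by ring, sub_neg_eq_add] at h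
  rw [theta2, theta1_eq_jacobi ht, h, show u + 1 / 2 - 1 / 2 - t / 2 = u - t / 2 by ring,
    show -(Real.pi * I * (u + 1 / 2)) + Real.pi * I * t / 4 = -(Real.pi / 2 * I) +
      (-(Real.pi * I * u) + Real.pi * I * t / 4) by ring, exp_add, exp_neg, exp_pi_div_two_mul_I,
      ← mul_assoc (exp _), ← exp_add]
  rw [mul_inv_cancel_left₀ I_ne_zero]
  congr 2
  ring

lemma theta3_neg {t : ℂ} (ht : 0 < t.im) (u : ℂ) : theta3 (-u) t = theta3 u t := by
  rw [theta3_eq_jacobi ht, theta3_eq_jacobi ht, jacobiTheta₂_neg_left]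

lemma theta3_add_one {t : ℂ} (ht : 0 < t.im) (u : ℂ) : theta3 (u + 1) t = theta3 u t := by
  rw [theta3_eq_jacobi ht, theta3_eq_jacobi ht, jacobiTheta₂_add_left]

lemma theta3_add_half {t : ℂ} (ht : 0 < t.im) (u : ℂ) : theta3 (u + 1 / 2) t = theta0 u t := by
  rw [theta3_eq_jacobi ht, theta0_eq_jacobi ht]

lemma theta1_neg (u t : ℂ) : theta1 (-u) t = -theta1 u t := by
  simp only [theta1, mul_neg, sin_neg, cos_neg, neg_mul]

lemma theta1_add_one (u t : ℂ) : theta1 (u + 1) t = -theta1 u t := by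
  have h1 : sin (Real.pi * (u + 1)) = -sin (Real.pi * u) := by
    rw [mul_add, mul_one, sin_add_pi]
  have h2 : cos (2 * Real.pi * (u + 1)) = cos (2 * Real.pi * u) := by
    rw [mul_add, mul_one, cos_add_two_pi]
  simp only [theta1, h1, h2, mul_neg, neg_mul]

lemma theta2_add_half (u t : ℂ) : theta2 (u + 1 / 2) t = -theta1 u t := by
  rw [theta2, add_assoc, add_halves, theta1_add_one]

lemma theta2_add_one (u t : ℂ) : theta2 (u + 1) t = -theta2 u t := by
  rw [theta2, theta2, add_right_comm, theta1_add_one]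

lemma theta2_neg (u t : ℂ) : theta2 (-u) t = theta2 u t := by
  rw [theta2, theta2, show -u + 1 / 2 = -(u - 1 / 2) by ring, theta1_neg, ← theta1_add_one]
  congr 1
  ring

lemma theta0_neg {t : ℂ} (ht : 0 < t.im) (u : ℂ) : theta0 (-u) t = theta0 u t := by
  rw [← theta3_add_half ht, ← theta3_add_half ht, ← theta3_neg ht, ← theta3_add_one ht]
  congr 1
  ring

lemma theta3_add_half_period {t : ℂ} (ht : 0 < t.im) (u : ℂ) :
    theta3 (u + t / 2) t = exp (-(Real.pi * I * (u + t / 4))) * theta2 u t := by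
  rw [theta3_eq_jacobi ht, theta2_eq_jacobi ht, ← mul_assoc, ← exp_add, neg_add_cancel, exp_zero,
    one_mul]

lemma theta2_add_half_period {t : ℂ} (ht : 0 < t.im) (u : ℂ) :
    theta2 (u + t / 2) t = exp (-(Real.pi * I * (u + t / 4))) * theta3 u t := by
  rw [theta2_eq_jacobi ht, theta3_eq_jacobi ht, show u + t / 2 + t / 2 = u + t by ring, jacobiTheta₂_add_left',
    ← mul_assoc, ← exp_add]
  congr 2
  ring

/-! ### Addition formulae from modulus T/2 to modulus T -/

/-- The change of variables `(p, q) ↦ (p + q, p - q)`, `(p, q) ↦ (p + q + 1, p - q)` that splits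
`ℤ²` according to the parity of the sum. -/
def paritySplit : (ℤ × ℤ) ⊕ (ℤ × ℤ) ≃ ℤ × ℤ where
  toFun := Sum.elim (fun z => (z.1 + z.2, z.1 - z.2)) (fun z => (z.1 + z.2 + 1, z.1 - z.2))
  invFun z := if (z.1 + z.2) % 2 = 0 then Sum.inl ((z.1 + z.2) / 2, (z.1 - z.2) / 2)
    else Sum.inr ((z.1 + z.2 - 1) / 2, (z.1 - z.2 - 1) / 2)
  left_inv z := by
    rcases z with ⟨p, q⟩ | ⟨p, q⟩
    · have h : (p + q + (p - q)) % 2 = 0 := by omega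
      simp only [Sum.elim_inl, h, if_true, Sum.inl.injEq, Prod.mk.injEq]
      omega
    · have h : ¬ (p + q + 1 + (p - q)) % 2 = 0 := by omega
      simp only [Sum.elim_inr, h, if_false, Sum.inr.injEq, Prod.mk.injEq]
      omega
  right_inv z := by
    rcases z with ⟨m, n⟩
    by_cases h : (m + n) % 2 = 0
    · simp only [h, if_true, Sum.elim_inl, Prod.mk.injEq]
      omega
    · simp only [h, if_false, Sum.elim_inr, Prod.mk.injEq]
      omega

/-- The addition formula from modulus `T / 2` to modulus `T`. -/
lemma theta3_mul_theta3 {T : ℂ} (hT : 0 < T.im) (x y : ℂ) :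
    theta3 x (T / 2) * theta3 y (T / 2) =
      theta3 (x + y) T * theta3 (x - y) T + theta2 (x + y) T * theta2 (x - y) T := by
  have ht : 0 < (T / 2).im := by simpa using hT
  have hn : ∀ {z t : ℂ}, 0 < t.im → Summable fun n => ‖jacobiTheta₂_term n z t‖ := fun {z t} h =>
    ((summable_jacobiTheta₂_term_iff z t).mpr h).norm
  rw [theta3_eq_jacobi ht, theta3_eq_jacobi ht, theta3_eq_jacobi hT, theta3_eq_jacobi hT,
    theta2_eq_jacobi hT, theta2_eq_jacobi hT]
  have hS := summable_mul_of_summable_norm (hn (z := x) ht) (hn (z := y) ht)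
  rw [jacobiTheta₂, jacobiTheta₂, tsum_mul_tsum_of_summable_norm (hn ht) (hn ht),
    ← paritySplit.tsum_eq]
  have hS' := paritySplit.summable_iff.mpr hS
  -- For m = p+q, n = p-q one has m² + n² = 2(p² + q²), which doubles the modulus. In the odd half p
  -- and q are effectively shifted by 1/2, and this gives the ϑ₂ term.
  refine (Summable.tsum_sum (hS'.comp_injective Sum.inl_injective)
    (hS'.comp_injective Sum.inr_injective)).trans ?_
  congr 1
  · rw [jacobiTheta₂, jacobiTheta₂, tsum_mul_tsum_of_summable_norm (hn hT) (hn hT)]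
    refine tsum_congr fun z => ?_
    simp only [paritySplit, Equiv.coe_fn_mk, Function.comp_apply, Sum.elim_inl, jacobiTheta₂_term]
    rw [← exp_add, ← exp_add]
    congr 1
    push_cast
    ring
  · rw [mul_mul_mul_comm, jacobiTheta₂, jacobiTheta₂,
      tsum_mul_tsum_of_summable_norm (hn hT) (hn hT), ← tsum_mul_left]
    refine tsum_congr fun z => ?_
    simp only [paritySplit, Equiv.coe_fn_mk, Function.comp_apply, Sum.elim_inr, jacobiTheta₂_term]
    rw [← exp_add, ← exp_add, ← exp_add, ← exp_add]
    congr 1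
    push_cast
    ring

/-- This and the following addition formulae come from `theta3_mul_theta3` by half-period shifts and
parity: a shift by 1/2 exchanges ϑ₃ with ϑ₀ and ϑ₂ with ϑ₁, a shift by half the modulus exchanges ϑ₃
with ϑ₂. -/
lemma theta0_mul_theta3 {T : ℂ} (hT : 0 < T.im) (x y : ℂ) :
    theta0 x (T / 2) * theta3 y (T / 2) =
      theta0 (x + y) T * theta0 (x - y) T + theta1 (x + y) T * theta1 (x - y) T := by
  have ht : 0 < (T / 2).im := by simpa using hT
  have h := theta3_mul_theta3 hT (x + 1 / 2) y
  rw [theta3_add_half ht, show x + 1 / 2 + y = x + y + 1 / 2 by ring,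
    show x + 1 / 2 - y = x - y + 1 / 2 by ring, theta3_add_half hT, theta3_add_half hT,
    theta2_add_half, theta2_add_half] at h
  rw [h]
  ring

lemma theta3_mul_theta0 {T : ℂ} (hT : 0 < T.im) (x y : ℂ) :
    theta3 x (T / 2) * theta0 y (T / 2) =
      theta0 (x + y) T * theta0 (x - y) T - theta1 (x + y) T * theta1 (x - y) T := by
  rw [mul_comm, theta0_mul_theta3 hT, ← neg_sub x y, theta0_neg hT, theta1_neg, add_comm y x]
  ring

lemma theta0_mul_theta0 {T : ℂ} (hT : 0 < T.im) (x y : ℂ) :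
    theta0 x (T / 2) * theta0 y (T / 2) =
      theta3 (x + y) T * theta3 (x - y) T - theta2 (x + y) T * theta2 (x - y) T := by
  have ht : 0 < (T / 2).im := by simpa using hT
  have h := theta3_mul_theta3 hT (x + 1 / 2) (y + 1 / 2)
  rw [theta3_add_half ht, theta3_add_half ht, show x + 1 / 2 + (y + 1 / 2) = x + y + 1 by ring,
    add_sub_add_right_eq_sub, theta3_add_one hT, theta2_add_one] at h
  rw [h]
  ring

lemma theta2_mul_theta2 {T : ℂ} (hT : 0 < T.im) (x y : ℂ) :
    theta2 x (T / 2) * theta2 y (T / 2) =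
      theta2 (x + y) T * theta3 (x - y) T + theta3 (x + y) T * theta2 (x - y) T := by
  have ht : 0 < (T / 2).im := by simpa using hT
  have h := theta3_mul_theta3 hT (x + T / 2 / 2) (y + T / 2 / 2)
  rw [theta3_add_half_period ht, theta3_add_half_period ht, add_sub_add_right_eq_sub,
    show x + T / 2 / 2 + (y + T / 2 / 2) = x + y + T / 2 by ring, theta3_add_half_period hT,
    theta2_add_half_period hT] at h
  have h2 : exp (-(Real.pi * I * (x + T / 2 / 4))) * exp (-(Real.pi * I * (y + T / 2 / 4))) =
      exp (-(Real.pi * I * (x + y + T / 4))) := by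
    rw [← exp_add]; congr 1; ring
  refine mul_left_cancel₀ (exp_ne_zero (-(Real.pi * I * (x + y + T / 4)))) ?_
  linear_combination h - theta2 x (T / 2) * theta2 y (T / 2) * h2

lemma theta1_mul_theta2 {T : ℂ} (hT : 0 < T.im) (x y : ℂ) :
    theta1 x (T / 2) * theta2 y (T / 2) =
      theta1 (x + y) T * theta0 (x - y) T + theta0 (x + y) T * theta1 (x - y) T := by
  have h := theta2_mul_theta2 hT (x + 1 / 2) y
  rw [theta2_add_half, show x + 1 / 2 + y = x + y + 1 / 2 by ring,
    show x + 1 / 2 - y = x - y + 1 / 2 by ring, theta3_add_half hT, theta3_add_half hT,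
    theta2_add_half, theta2_add_half] at h
  linear_combination -h

lemma theta1_mul_theta1 {T : ℂ} (hT : 0 < T.im) (x y : ℂ) :
    theta1 x (T / 2) * theta1 y (T / 2) =
      theta3 (x + y) T * theta2 (x - y) T - theta2 (x + y) T * theta3 (x - y) T := by
  have h := theta2_mul_theta2 hT (x + 1 / 2) (y + 1 / 2)
  rw [theta2_add_half, theta2_add_half, show x + 1 / 2 + (y + 1 / 2) = x + y + 1 by ring,
    add_sub_add_right_eq_sub, theta3_add_one hT, theta2_add_one] at h
  linear_combination h

/-! ### Non-vanishing of theta functions -/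

/-- `ϑ₁` does not vanish off the lattice in the fundamental strip. -/
lemma theta1_ne_zero {t u : ℂ} (ht : 0 < t.im) (h1 : ‖exp (2 * Real.pi * I * t)‖ <
    ‖exp (2 * Real.pi * I * u)‖) (h2 : ‖exp (2 * Real.pi * I * t)‖ * ‖exp (2 * Real.pi * I * u)‖ < 1)
    (h3 : exp (2 * Real.pi * I * u) ≠ 1) : theta1 u t ≠ 0 := by
  set P := exp (2 * Real.pi * I * t) with hPdef
  set y := exp (2 * Real.pi * I * u) with hydef
  have hP : ‖P‖ < 1 := norm_exp_lt_one ht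
  have hy : y ≠ 0 := exp_ne_zero _
  have h4 : ∀ n : ℕ, 1 - 2 * P ^ (n + 1) * cos (2 * Real.pi * u) + P ^ (2 * (n + 1)) =
      (1 - y * P ^ (n + 1)) * (1 - y⁻¹ * P ^ (n + 1)) := by
    intro n
    have : cos (2 * Real.pi * u) = (y + y⁻¹) / 2 := by
      rw [cos, hydef, ← exp_neg]; congr 3 <;> ring
    rw [this, pow_mul']
    field_simp
    ring
  -- In the strip both ‖y‖ and ‖y⁻¹‖ are less than 1/‖P‖, so this applies to c = y and to c = y⁻¹.
  have hne : ∀ c : ℂ, ‖P‖ * ‖c‖ < 1 → ∏' n : ℕ, (1 - c * P ^ (n + 1)) ≠ 0 := by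
    intro c hc
    refine tprod_one_sub_mul_pow_ne_zero hP c fun n h => ?_
    have h5 : ‖c * P ^ (n + 1)‖ = 1 := by rw [← sub_eq_zero.mp h, norm_one]
    rw [norm_mul, norm_pow, pow_succ'] at h5
    have := pow_le_one₀ (n := n) (norm_nonneg P) hP.le
    have : ‖c‖ * (‖P‖ * ‖P‖ ^ n) ≤ ‖P‖ * ‖c‖ := by
      rw [← mul_assoc, mul_comm ‖c‖]
      exact mul_le_of_le_one_right (by positivity) this
    linarith
  have hsin : sin (Real.pi * u) ≠ 0 := by
    rw [Ne, sin_eq_zero_iff]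
    rintro ⟨k, hk⟩
    refine h3 (exp_eq_one_iff.mpr ⟨k, ?_⟩)
    linear_combination 2 * I * hk
  rw [theta1]
  simp_rw [← hPdef, h4]
  rw [(multipliable_one_sub_mul_pow hP y).tprod_mul (multipliable_one_sub_mul_pow hP y⁻¹)]
  refine mul_ne_zero (mul_ne_zero (mul_ne_zero (mul_ne_zero two_ne_zero (exp_ne_zero _))
    (tprod_qPoch_ne_zero hP)) hsin) (mul_ne_zero (hne y h2) (hne y⁻¹ ?_))
  rw [norm_inv, ← div_eq_mul_inv, div_lt_one (norm_pos_iff.mpr hy)]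
  exact h1

lemma theta2_zero_ne_zero {t : ℂ} (ht : 0 < t.im) : theta2 0 t ≠ 0 := by
  have hy : exp (2 * Real.pi * I * (0 + 1 / 2)) = -1 := by
    rw [← exp_pi_mul_I]; congr 1; ring
  refine theta1_ne_zero ht ?_ ?_ ?_ <;> rw [hy]
  · simpa using norm_exp_lt_one ht
  · simpa using norm_exp_lt_one ht
  · norm_num

lemma theta0_zero_ne_zero {t : ℂ} (ht : 0 < t.im) : theta0 0 t ≠ 0 := by
  have ht2 : 0 < (0 + t / 2).im := by simpa using ht
  have hs := norm_exp_lt_one ht2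
  have hsq : ‖exp (2 * Real.pi * I * t)‖ = ‖exp (2 * Real.pi * I * (0 + t / 2))‖ ^ 2 := by
    rw [← norm_pow, ← exp_nat_mul]; congr 2; push_cast; ring
  have hpos : 0 < ‖exp (2 * Real.pi * I * (0 + t / 2))‖ := norm_pos_iff.mpr (exp_ne_zero _)
  refine mul_ne_zero (mul_ne_zero (neg_ne_zero.mpr I_ne_zero) (exp_ne_zero _))
    (theta1_ne_zero ht ?_ ?_ ?_)
  · rw [hsq]; nlinarith
  · rw [hsq]; nlinarith [mul_pos hpos hpos]
  · intro h
    rw [h, norm_one] at hs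
    exact lt_irrefl _ hs

/-! ### Theta identities of the eight-vertex and SOS models -/

lemma tau_im_pos {x r : ℝ} (hx₀ : 0 < x) (hx₁ : x < 1) (hr : 1 < r) : 0 < (tau x r).im := by
  have h : tau x r = ((-Real.pi / (r * Real.log x) : ℝ) : ℂ) * I := by
    rw [tau]; push_cast; ring
  rw [h, im_ofReal_mul, I_im, mul_one, neg_div, neg_pos]
  exact div_neg_of_pos_of_neg Real.pi_pos
    (mul_neg_of_pos_of_neg (by linarith) (Real.log_neg hx₀ hx₁))

section Theta

variable {T : ℂ} (hT : 0 < T.im)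
include hT

/-- The right side is the determinant of the vectors (ϑ₀,ϑ₃) at x and y; the next three lemmas give
symmetric bilinear forms in the same vectors. These four forms are the components in which R is
diagonal. -/
lemma two_mul_theta1_mul (x y : ℂ) : 2 * (theta1 (x + y) T * theta1 (x - y) T) =
    theta0 x (T / 2) * theta3 y (T / 2) - theta3 x (T / 2) * theta0 y (T / 2) := by
  rw [theta0_mul_theta3 hT, theta3_mul_theta0 hT]; ring

lemma two_mul_theta0_mul (x y : ℂ) : 2 * (theta0 (x + y) T * theta0 (x - y) T) =
    theta0 x (T / 2) * theta3 y (T / 2) + theta3 x (T / 2) * theta0 y (T / 2) := by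
  rw [theta0_mul_theta3 hT, theta3_mul_theta0 hT]; ring

lemma two_mul_theta3_mul (x y : ℂ) : 2 * (theta3 (x + y) T * theta3 (x - y) T) =
    theta0 x (T / 2) * theta0 y (T / 2) + theta3 x (T / 2) * theta3 y (T / 2) := by
  rw [theta0_mul_theta0 hT, theta3_mul_theta3 hT]; ring

lemma two_mul_theta2_mul (x y : ℂ) : 2 * (theta2 (x + y) T * theta2 (x - y) T) =
    theta3 x (T / 2) * theta3 y (T / 2) - theta0 x (T / 2) * theta0 y (T / 2) := by
  rw [theta0_mul_theta0 hT, theta3_mul_theta3 hT]; ring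

/-- Cramer's rule for the vectors `(ϑ₀, ϑ₃)` at modulus `T / 2`. -/
lemma theta_three_term {β : ℂ → ℂ → ℂ} {c : Fin 4 → ℂ} (hβ : ∀ x y, 2 * β x y =
      c 0 * (theta0 x (T / 2) * theta0 y (T / 2)) + c 1 * (theta0 x (T / 2) * theta3 y (T / 2)) +
      c 2 * (theta3 x (T / 2) * theta0 y (T / 2)) + c 3 * (theta3 x (T / 2) * theta3 y (T / 2)))
    (x y z w : ℂ) :
    theta1 (x + y) T * theta1 (x - y) T * β z w + theta1 (y + z) T * theta1 (y - z) T * β x w +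
    theta1 (z + x) T * theta1 (z - x) T * β y w = 0 := by
  -- Three vectors of ℂ² satisfy det(x,y) z + det(y,z) x + det(z,x) y = 0; the form β(·,w) is
  -- applied to this relation.
  have h1 := two_mul_theta1_mul hT x y
  have h2 := two_mul_theta1_mul hT y z
  have h3 := two_mul_theta1_mul hT z x
  refine mul_left_cancel₀ (mul_ne_zero (two_ne_zero (α := ℂ)) (two_ne_zero (α := ℂ))) ?_
  have e : ∀ a b c d e f : ℂ, 2 * 2 * (a * b + c * d + e * f) =
    (2 * a) * (2 * b) + (2 * c) * (2 * d) + (2 * e) * (2 * f) := by intros; ring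
  rw [e, h1, h2, h3, hβ, hβ, hβ]
  ring

lemma theta1_three_term (x y z w : ℂ) :
    theta1 (x + y) T * theta1 (x - y) T * (theta1 (z + w) T * theta1 (z - w) T) +
    theta1 (y + z) T * theta1 (y - z) T * (theta1 (x + w) T * theta1 (x - w) T) +
    theta1 (z + x) T * theta1 (z - x) T * (theta1 (y + w) T * theta1 (y - w) T) = 0 :=
  theta_three_term hT (β := fun x y => theta1 (x + y) T * theta1 (x - y) T) (c := ![0, 1, -1, 0])
    (fun x y => by simp [two_mul_theta1_mul hT]; ring) x y z w

lemma theta0_three_term (x y z w : ℂ) :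
    theta1 (x + y) T * theta1 (x - y) T * (theta0 (z + w) T * theta0 (z - w) T) +
    theta1 (y + z) T * theta1 (y - z) T * (theta0 (x + w) T * theta0 (x - w) T) +
    theta1 (z + x) T * theta1 (z - x) T * (theta0 (y + w) T * theta0 (y - w) T) = 0 :=
  theta_three_term hT (β := fun x y => theta0 (x + y) T * theta0 (x - y) T) (c := ![0, 1, 1, 0])
    (fun x y => by simp [two_mul_theta0_mul hT]) x y z w

lemma theta2_three_term (x y z w : ℂ) :
    theta1 (x + y) T * theta1 (x - y) T * (theta2 (z + w) T * theta2 (z - w) T) +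
    theta1 (y + z) T * theta1 (y - z) T * (theta2 (x + w) T * theta2 (x - w) T) +
    theta1 (z + x) T * theta1 (z - x) T * (theta2 (y + w) T * theta2 (y - w) T) = 0 :=
  theta_three_term hT (β := fun x y => theta2 (x + y) T * theta2 (x - y) T) (c := ![-1, 0, 0, 1])
    (fun x y => by simp [two_mul_theta2_mul hT]; ring) x y z w

lemma theta3_three_term (x y z w : ℂ) :
    theta1 (x + y) T * theta1 (x - y) T * (theta3 (z + w) T * theta3 (z - w) T) +
    theta1 (y + z) T * theta1 (y - z) T * (theta3 (x + w) T * theta3 (x - w) T) +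
    theta1 (z + x) T * theta1 (z - x) T * (theta3 (y + w) T * theta3 (y - w) T) = 0 :=
  theta_three_term hT (β := fun x y => theta3 (x + y) T * theta3 (x - y) T) (c := ![1, 0, 0, 1])
    (fun x y => by simp [two_mul_theta3_mul hT]) x y z w

/-- The addition formula at equal arguments is the duplication formula ϑ₁(w|T/2) ϑ₂(w|T/2) =
ϑ₁(2w|T) ϑ₀(0|T). Thus the single condition [1+u] ≠ 0 controls the u-dependent theta denominators of
the vertex weights. -/
lemma theta_half_ne_zero {w : ℂ} (hw : theta1 (2 * w) T ≠ 0) :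
    theta1 w (T / 2) ≠ 0 ∧ theta2 w (T / 2) ≠ 0 := by
  have h := theta1_mul_theta2 hT w w
  rw [sub_self, ← two_mul, show theta1 0 T = 0 by simp [theta1], mul_zero, add_zero] at h
  exact mul_ne_zero_iff.mp (h ▸ mul_ne_zero hw (theta0_zero_ne_zero hT))

lemma theta1_half_mul (w : ℂ) :
    theta1 w (T / 2) * theta2 0 (T / 2) = 2 * (theta1 w T * theta0 w T) := by
  rw [theta1_mul_theta2 hT, add_zero, sub_zero]; ring

lemma theta2_half_mul (w : ℂ) :
    theta2 w (T / 2) * theta2 0 (T / 2) = 2 * (theta2 w T * theta3 w T) := by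
  rw [theta2_mul_theta2 hT, add_zero, sub_zero]; ring

lemma theta_ne_zero {w : ℂ} (hw : theta1 (2 * w) T ≠ 0) :
    theta0 w T ≠ 0 ∧ theta1 w T ≠ 0 ∧ theta2 w T ≠ 0 ∧ theta3 w T ≠ 0 := by
  have ht : 0 < (T / 2).im := by simpa using hT
  obtain ⟨h1, h2⟩ := theta_half_ne_zero hT hw
  have h3 : 2 * (theta1 w T * theta0 w T) ≠ 0 :=
    theta1_half_mul hT w ▸ mul_ne_zero h1 (theta2_zero_ne_zero ht)
  have h4 : 2 * (theta2 w T * theta3 w T) ≠ 0 :=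
    theta2_half_mul hT w ▸ mul_ne_zero h2 (theta2_zero_ne_zero ht)
  simp only [mul_ne_zero_iff] at h3 h4
  exact ⟨h3.2.2, h3.2.1, h4.2.1, h4.2.2⟩

end Theta

lemma thetaConst_ne_zero {x r : ℝ} (hx₀ : 0 < x) (hx₁ : x < 1) (hr : 1 < r) :
    thetaConst x r ≠ 0 := by
  have h1 : (x : ℂ) ≠ 0 := ofReal_ne_zero.mpr hx₀.ne'
  have h2 : tau x r ≠ 0 := by
    intro h
    have := tau_im_pos hx₀ hx₁ hr
    rw [h] at this
    exact lt_irrefl _ this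
  refine mul_ne_zero (mul_ne_zero ?_ (exp_ne_zero _)) ?_
  · rw [Ne, cpow_eq_zero_iff]; tauto
  · rw [Ne, cpow_eq_zero_iff]; tauto

lemma br_ne_zero_iff {x r : ℝ} (hx₀ : 0 < x) (hx₁ : x < 1) (hr : 1 < r) (u : ℂ) :
    br x r u ≠ 0 ↔ theta1 (2 * (u / (2 * r))) (tau x r) ≠ 0 := by
  rw [br, mul_ne_zero_iff, and_iff_right (thetaConst_ne_zero hx₀ hx₁ hr),
    show 2 * (u / (2 * r)) = u / r by ring]

section Weights

variable {x r : ℝ} (hx₀ : 0 < x) (hx₁ : x < 1) (hr : 1 < r) {u : ℂ} (hu : br x r (1 + u) ≠ 0)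
include hx₀ hx₁ hr hu

/-- Exchanging u and 1 in the addition formula for ϑ₁ϑ₂ changes the sign of one of its two terms, so
the numerators of b and c add up to a single product, and one factor cancels against the denominator
by `theta1_half_mul`. The combinations b ± c and a ± d are the eigenvalues of R/R₀. -/
lemma wtB_add_wtC : (wtB x r u + wtC x r u) * theta0 ((u + 1) / (2 * r)) (tau x r) =
    theta0 ((u - 1) / (2 * r)) (tau x r) := by
  have hT := tau_im_pos hx₀ hx₁ hr
  have ht : 0 < (tau x r / 2).im := by simpa using hT
  rw [br_ne_zero_iff hx₀ hx₁ hr, add_comm] at hu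
  obtain ⟨h1, h2⟩ := theta_half_ne_zero hT hu
  obtain ⟨h3, h4, -, -⟩ := theta_ne_zero hT hu
  have h5 := theta2_zero_ne_zero ht
  have e1 := theta1_mul_theta2 hT (u / (2 * r)) (1 / (2 * r))
  have e2 := theta1_mul_theta2 hT (1 / (2 * r)) (u / (2 * r))
  rw [← neg_sub (u / (2 * r)), theta0_neg hT, theta1_neg, add_comm (1 / (2 * r) : ℂ)] at e2
  rw [← add_div, ← sub_div] at e1 e2
  have e3 := theta1_half_mul hT ((u + 1) / (2 * r))
  rw [wtB, wtC, ← add_div, mul_comm (theta2 0 _), add_comm 1 u, e3]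
  field_simp
  linear_combination e1 + e2

lemma wtB_sub_wtC : (wtB x r u - wtC x r u) * theta1 ((u + 1) / (2 * r)) (tau x r) =
    theta1 ((u - 1) / (2 * r)) (tau x r) := by
  have hT := tau_im_pos hx₀ hx₁ hr
  have ht : 0 < (tau x r / 2).im := by simpa using hT
  rw [br_ne_zero_iff hx₀ hx₁ hr, add_comm] at hu
  obtain ⟨h1, h2⟩ := theta_half_ne_zero hT hu
  obtain ⟨h3, h4, -, -⟩ := theta_ne_zero hT hu
  have h5 := theta2_zero_ne_zero ht
  have e1 := theta1_mul_theta2 hT (u / (2 * r)) (1 / (2 * r))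
  have e2 := theta1_mul_theta2 hT (1 / (2 * r)) (u / (2 * r))
  rw [← neg_sub (u / (2 * r)), theta0_neg hT, theta1_neg, add_comm (1 / (2 * r) : ℂ)] at e2
  rw [← add_div, ← sub_div] at e1 e2
  have e3 := theta1_half_mul hT ((u + 1) / (2 * r))
  rw [wtB, wtC, ← sub_div, mul_comm (theta2 0 _), add_comm 1 u, e3]
  field_simp
  linear_combination e1 - e2

lemma wtA_add_wtD : (wtA x r u + wtD x r u) * theta3 ((u + 1) / (2 * r)) (tau x r) =
    theta3 ((u - 1) / (2 * r)) (tau x r) := by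
  have hT := tau_im_pos hx₀ hx₁ hr
  have ht : 0 < (tau x r / 2).im := by simpa using hT
  rw [br_ne_zero_iff hx₀ hx₁ hr, add_comm] at hu
  obtain ⟨h1, h2⟩ := theta_half_ne_zero hT hu
  obtain ⟨-, -, h3, h4⟩ := theta_ne_zero hT hu
  have h5 := theta2_zero_ne_zero ht
  have e1 := theta2_mul_theta2 hT (u / (2 * r)) (1 / (2 * r))
  have e2 := theta1_mul_theta1 hT (u / (2 * r)) (1 / (2 * r))
  rw [← add_div, ← sub_div] at e1 e2
  have e3 := theta2_half_mul hT ((u + 1) / (2 * r))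
  rw [wtA, wtD, ← add_div, mul_comm (theta2 0 _), add_comm 1 u, e3]
  field_simp
  linear_combination e1 - e2

lemma wtA_sub_wtD : (wtA x r u - wtD x r u) * theta2 ((u + 1) / (2 * r)) (tau x r) =
    theta2 ((u - 1) / (2 * r)) (tau x r) := by
  have hT := tau_im_pos hx₀ hx₁ hr
  have ht : 0 < (tau x r / 2).im := by simpa using hT
  rw [br_ne_zero_iff hx₀ hx₁ hr, add_comm] at hu
  obtain ⟨h1, h2⟩ := theta_half_ne_zero hT hu
  obtain ⟨-, -, h3, h4⟩ := theta_ne_zero hT hu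
  have h5 := theta2_zero_ne_zero ht
  have e1 := theta2_mul_theta2 hT (u / (2 * r)) (1 / (2 * r))
  have e2 := theta1_mul_theta1 hT (u / (2 * r)) (1 / (2 * r))
  rw [← add_div, ← sub_div] at e1 e2
  have e3 := theta2_half_mul hT ((u + 1) / (2 * r))
  rw [wtA, wtD, ← sub_div, mul_comm (theta2 0 _), add_comm 1 u, e3]
  field_simp
  linear_combination e1 + e2

end Weights

/-- The vector `(ϑ₀, ϑ₃)` at modulus `τ / 2`. -/
def thetaVec (x r : ℝ) (ε : Bool) (z : ℂ) : ℂ :=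
  if ε then theta0 z (tau x r / 2) else theta3 z (tau x r / 2)

lemma psi_eq (x r : ℝ) (ε : Bool) (u : ℂ) (a b : ℤ) :
    psi x r ε u a b = thetaVec x r ε (((a - b) * u + a) / (2 * r)) := rfl

/-- To compute `R(u)` on `ψ ⊗ ψ'` it suffices to compare the four (anti)symmetric combinations of
components, on which `R(u)` is diagonal. -/
lemma Rmat_apply_thetaVec {x r : ℝ} (hx₀ : 0 < x) (hx₁ : x < 1) (hr : 1 < r) {u : ℂ}
    (hu : br x r (1 + u) ≠ 0) (X Y : ℂ) (G : Bool → Bool → ℂ)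
    (h0 : theta0 ((u - 1) / (2 * r)) (tau x r) *
      (2 * (theta0 (X + Y) (tau x r) * theta0 (X - Y) (tau x r))) =
      theta0 ((u + 1) / (2 * r)) (tau x r) * (G true false + G false true))
    (h1 : theta1 ((u - 1) / (2 * r)) (tau x r) *
      (2 * (theta1 (X + Y) (tau x r) * theta1 (X - Y) (tau x r))) =
      theta1 ((u + 1) / (2 * r)) (tau x r) * (G true false - G false true))
    (h2 : theta2 ((u - 1) / (2 * r)) (tau x r) *
      (2 * (theta2 (X + Y) (tau x r) * theta2 (X - Y) (tau x r))) =
      theta2 ((u + 1) / (2 * r)) (tau x r) * (G false false - G true true))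
    (h3 : theta3 ((u - 1) / (2 * r)) (tau x r) *
      (2 * (theta3 (X + Y) (tau x r) * theta3 (X - Y) (tau x r))) =
      theta3 ((u + 1) / (2 * r)) (tau x r) * (G true true + G false false)) (t₁ t₂ : Bool) :
    ∑ s₁, ∑ s₂, Rmat x r u s₁ s₂ t₁ t₂ * (thetaVec x r s₁ X * thetaVec x r s₂ Y) =
      R0 x r u * G t₁ t₂ := by
  have hT := tau_im_pos hx₀ hx₁ hr
  have hu' := hu
  rw [br_ne_zero_iff hx₀ hx₁ hr, add_comm] at hu'
  obtain ⟨n0, n1, n2, n3⟩ := theta_ne_zero hT hu'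
  -- The hypotheses become the eigenvalue equations multiplied by ϑ_i((u+1)/2r), which is nonzero
  -- and is cancelled below.
  rw [two_mul_theta0_mul hT, ← wtB_add_wtC hx₀ hx₁ hr hu, mul_comm (_ + _) (theta0 _ _),
    mul_assoc] at h0
  rw [two_mul_theta1_mul hT, ← wtB_sub_wtC hx₀ hx₁ hr hu, mul_comm (_ - _) (theta1 _ _),
    mul_assoc] at h1
  rw [two_mul_theta2_mul hT, ← wtA_sub_wtD hx₀ hx₁ hr hu, mul_comm (_ - _) (theta2 _ _),
    mul_assoc] at h2
  rw [two_mul_theta3_mul hT, ← wtA_add_wtD hx₀ hx₁ hr hu, mul_comm (_ + _) (theta3 _ _),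
    mul_assoc] at h3
  replace h0 := mul_left_cancel₀ n0 h0
  replace h1 := mul_left_cancel₀ n1 h1
  replace h2 := mul_left_cancel₀ n2 h2
  replace h3 := mul_left_cancel₀ n3 h3
  cases t₁ <;> cases t₂ <;> simp [Rmat, thetaVec]
  · linear_combination R0 x r u / 2 * (h3 + h2)
  · linear_combination R0 x r u / 2 * (h0 - h1)
  · linear_combination R0 x r u / 2 * (h0 + h1)
  · linear_combination R0 x r u / 2 * (h3 - h2)

/-! ### The vertex-face correspondence for the elementary weights -/

/-- This is the three-term relation at the points a - e(v+h), a + e(v+h), a - e(v-h), a. Their sums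
and differences are, up to sign, exactly the arguments that occur. The parity ε of F allows the same
proof for ϑ₁ and for the even functions; e is the direction of the first step down or up. -/
lemma turn_identity {θ F : ℂ → ℂ} {ε : ℂ} (hθ : ∀ z, θ (-z) = -θ z) (hF : ∀ z, F (-z) = ε * F z)
    (hε : ε * ε = 1)
    (h3 : ∀ x y z w, θ (x + y) * θ (x - y) * (F (z + w) * F (z - w)) +
      θ (y + z) * θ (y - z) * (F (x + w) * F (x - w)) +
      θ (z + x) * θ (z - x) * (F (y + w) * F (y - w)) = 0)
    {e : ℂ} (he : e = 1 ∨ e = -1) (a v h : ℂ) :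
    θ (2 * a) * θ (2 * (v + h)) * (F (v - h) * F (2 * a - e * (v - h))) =
      F (v + h) * (ε * (θ (2 * (a - e * v)) * θ (2 * h) * F (2 * a + e * (v + h))) +
        θ (2 * (a + e * h)) * θ (2 * v) * F (2 * a - e * (v + h))) := by
  have key := h3 (a - e * (v + h)) (a + e * (v + h)) (a - e * (v - h)) a
  rcases he with rfl | rfl
  · rw [show a - 1 * (v + h) + (a + 1 * (v + h)) = 2 * a by ring,
      show a - 1 * (v + h) - (a + 1 * (v + h)) = -(2 * (v + h)) by ring,
      show a - 1 * (v - h) + a = 2 * a - 1 * (v - h) by ring,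
      show a - 1 * (v - h) - a = -(v - h) by ring,
      show a + 1 * (v + h) + (a - 1 * (v - h)) = 2 * (a + 1 * h) by ring,
      show a + 1 * (v + h) - (a - 1 * (v - h)) = 2 * v by ring,
      show a - 1 * (v + h) + a = 2 * a - 1 * (v + h) by ring,
      show a - 1 * (v + h) - a = -(v + h) by ring,
      show a - 1 * (v - h) + (a - 1 * (v + h)) = 2 * (a - 1 * v) by ring,
      show a - 1 * (v - h) - (a - 1 * (v + h)) = 2 * h by ring,
      show a + 1 * (v + h) + a = 2 * a + 1 * (v + h) by ring,
      show a + 1 * (v + h) - a = v + h by ring, hF, hF, hθ] at key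
    linear_combination -ε * key - (θ (2 * a) * θ (2 * (v + h)) * (F (v - h) *
      F (2 * a - 1 * (v - h))) - F (v + h) * (θ (2 * (a + 1 * h)) * θ (2 * v) *
        F (2 * a - 1 * (v + h)))) * hε
  · rw [show a - -1 * (v + h) + (a + -1 * (v + h)) = 2 * a by ring,
      show a - -1 * (v + h) - (a + -1 * (v + h)) = 2 * (v + h) by ring,
      show a - -1 * (v - h) + a = 2 * a - -1 * (v - h) by ring,
      show a - -1 * (v - h) - a = v - h by ring,
      show a + -1 * (v + h) + (a - -1 * (v - h)) = 2 * (a + -1 * h) by ring,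
      show a + -1 * (v + h) - (a - -1 * (v - h)) = -(2 * v) by ring,
      show a - -1 * (v + h) + a = 2 * a - -1 * (v + h) by ring,
      show a - -1 * (v + h) - a = v + h by ring,
      show a - -1 * (v - h) + (a - -1 * (v + h)) = 2 * (a - -1 * v) by ring,
      show a - -1 * (v - h) - (a - -1 * (v + h)) = -(2 * h) by ring,
      show a + -1 * (v + h) + a = 2 * a + -1 * (v + h) by ring,
      show a + -1 * (v + h) - a = -(v + h) by ring, hF, hθ, hθ] at key
    linear_combination key

lemma theta0_turn {T : ℂ} (hT : 0 < T.im) {e : ℂ} (he : e = 1 ∨ e = -1) (a v h : ℂ) :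
    theta1 (2 * a) T * theta1 (2 * (v + h)) T * (theta0 (v - h) T * theta0 (2 * a - e * (v - h)) T) =
      theta0 (v + h) T * (1 * (theta1 (2 * (a - e * v)) T * theta1 (2 * h) T *
        theta0 (2 * a + e * (v + h)) T) +
        theta1 (2 * (a + e * h)) T * theta1 (2 * v) T * theta0 (2 * a - e * (v + h)) T) :=
  turn_identity (θ := fun z => theta1 z T) (F := fun z => theta0 z T) (ε := 1)
    (fun z => theta1_neg z T) (fun z => (theta0_neg hT z).trans (one_mul _).symm) (by norm_num)
    (theta0_three_term hT) he a v h

lemma theta1_turn {T : ℂ} (hT : 0 < T.im) {e : ℂ} (he : e = 1 ∨ e = -1) (a v h : ℂ) :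
    theta1 (2 * a) T * theta1 (2 * (v + h)) T * (theta1 (v - h) T * theta1 (2 * a - e * (v - h)) T) =
      theta1 (v + h) T * (-1 * (theta1 (2 * (a - e * v)) T * theta1 (2 * h) T *
        theta1 (2 * a + e * (v + h)) T) +
        theta1 (2 * (a + e * h)) T * theta1 (2 * v) T * theta1 (2 * a - e * (v + h)) T) :=
  turn_identity (θ := fun z => theta1 z T) (F := fun z => theta1 z T) (ε := -1)
    (fun z => theta1_neg z T) (fun z => (theta1_neg z T).trans (neg_one_mul _).symm) (by norm_num)
    (theta1_three_term hT) he a v h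

lemma theta2_turn {T : ℂ} (hT : 0 < T.im) {e : ℂ} (he : e = 1 ∨ e = -1) (a v h : ℂ) :
    theta1 (2 * a) T * theta1 (2 * (v + h)) T * (theta2 (v - h) T * theta2 (2 * a - e * (v - h)) T) =
      theta2 (v + h) T * (1 * (theta1 (2 * (a - e * v)) T * theta1 (2 * h) T *
        theta2 (2 * a + e * (v + h)) T) +
        theta1 (2 * (a + e * h)) T * theta1 (2 * v) T * theta2 (2 * a - e * (v + h)) T) :=
  turn_identity (θ := fun z => theta1 z T) (F := fun z => theta2 z T) (ε := 1)
    (fun z => theta1_neg z T) (fun z => (theta2_neg z T).trans (one_mul _).symm) (by norm_num)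
    (theta2_three_term hT) he a v h

lemma theta3_turn {T : ℂ} (hT : 0 < T.im) {e : ℂ} (he : e = 1 ∨ e = -1) (a v h : ℂ) :
    theta1 (2 * a) T * theta1 (2 * (v + h)) T * (theta3 (v - h) T * theta3 (2 * a - e * (v - h)) T) =
      theta3 (v + h) T * (1 * (theta1 (2 * (a - e * v)) T * theta1 (2 * h) T *
        theta3 (2 * a + e * (v + h)) T) +
        theta1 (2 * (a + e * h)) T * theta1 (2 * v) T * theta3 (2 * a - e * (v + h)) T) :=
  turn_identity (θ := fun z => theta1 z T) (F := fun z => theta3 z T) (ε := 1)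
    (fun z => theta1_neg z T) (fun z => (theta3_neg hT z).trans (one_mul _).symm) (by norm_num)
    (theta3_three_term hT) he a v h

section VertexFace

variable {x r : ℝ} (hx₀ : 0 < x) (hx₁ : x < 1) (hr : 1 < r)
include hx₀ hx₁ hr

/-- In a turn the two arguments differ by ±m in each of the three tensors. Hence the factor ϑ_i(m)
splits off from every term and only an identity in the sums p, q, q' remains; the opposite
difference in the middle tensor is visible only for odd ϑ₁, as the sign -1 in `h1`. -/
lemma Rmat_apply_of_turn {X Y X' Y' X'' Y'' p q q' m w₁ w₂ : ℂ} {u : ℂ}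
    (hu : br x r (1 + u) ≠ 0)
    (a1 : X + Y = p) (a2 : X - Y = -m) (a3 : X' + Y' = q) (a4 : X' - Y' = m)
    (a5 : X'' + Y'' = q') (a6 : X'' - Y'' = -m)
    (h0 : theta0 ((u - 1) / (2 * r)) (tau x r) * theta0 p (tau x r) = theta0 ((u + 1) / (2 * r))
      (tau x r) * (1 * (w₁ * theta0 q (tau x r)) + w₂ * theta0 q' (tau x r)))
    (h1 : theta1 ((u - 1) / (2 * r)) (tau x r) * theta1 p (tau x r) = theta1 ((u + 1) / (2 * r))
      (tau x r) * (-1 * (w₁ * theta1 q (tau x r)) + w₂ * theta1 q' (tau x r)))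
    (h2 : theta2 ((u - 1) / (2 * r)) (tau x r) * theta2 p (tau x r) = theta2 ((u + 1) / (2 * r))
      (tau x r) * (1 * (w₁ * theta2 q (tau x r)) + w₂ * theta2 q' (tau x r)))
    (h3 : theta3 ((u - 1) / (2 * r)) (tau x r) * theta3 p (tau x r) = theta3 ((u + 1) / (2 * r))
      (tau x r) * (1 * (w₁ * theta3 q (tau x r)) + w₂ * theta3 q' (tau x r))) (t₁ t₂ : Bool) :
    ∑ s₁, ∑ s₂, Rmat x r u s₁ s₂ t₁ t₂ * (thetaVec x r s₁ X * thetaVec x r s₂ Y) =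
      R0 x r u * (w₁ * (thetaVec x r t₁ X' * thetaVec x r t₂ Y') +
        w₂ * (thetaVec x r t₁ X'' * thetaVec x r t₂ Y'')) := by
  have hT := tau_im_pos hx₀ hx₁ hr
  refine Rmat_apply_thetaVec hx₀ hx₁ hr hu X Y (fun t₁ t₂ =>
    w₁ * (thetaVec x r t₁ X' * thetaVec x r t₂ Y') + w₂ * (thetaVec x r t₁ X'' * thetaVec x r t₂ Y''))
    ?_ ?_ ?_ ?_ t₁ t₂ <;> simp only [thetaVec, if_true, Bool.false_eq_true, if_false]
  · have c1 := two_mul_theta0_mul hT X' Y'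
    have c2 := two_mul_theta0_mul hT X'' Y''
    rw [a3, a4] at c1
    rw [a5, a6, theta0_neg hT] at c2
    rw [a1, a2, theta0_neg hT]
    linear_combination 2 * theta0 m (tau x r) * h0 +
      theta0 ((u + 1) / (2 * r)) (tau x r) * (w₁ * c1 + w₂ * c2)
  · have c1 := two_mul_theta1_mul hT X' Y'
    have c2 := two_mul_theta1_mul hT X'' Y''
    rw [a3, a4] at c1
    rw [a5, a6, theta1_neg] at c2
    rw [a1, a2, theta1_neg]
    linear_combination -2 * theta1 m (tau x r) * h1 +
      theta1 ((u + 1) / (2 * r)) (tau x r) * (w₁ * c1 + w₂ * c2)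
  · have c1 := two_mul_theta2_mul hT X' Y'
    have c2 := two_mul_theta2_mul hT X'' Y''
    rw [a3, a4] at c1
    rw [a5, a6, theta2_neg] at c2
    rw [a1, a2, theta2_neg]
    linear_combination 2 * theta2 m (tau x r) * h2 +
      theta2 ((u + 1) / (2 * r)) (tau x r) * (w₁ * c1 + w₂ * c2)
  · have c1 := two_mul_theta3_mul hT X' Y'
    have c2 := two_mul_theta3_mul hT X'' Y''
    rw [a3, a4] at c1
    rw [a5, a6, theta3_neg hT] at c2
    rw [a1, a2, theta3_neg hT]
    linear_combination 2 * theta3 m (tau x r) * h3 +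
      theta3 ((u + 1) / (2 * r)) (tau x r) * (w₁ * c1 + w₂ * c2)

variable {u₁ u₂ : ℂ} (hu : br x r (1 + (u₁ - u₂)) ≠ 0)
include hu

/-- The two tensors have the same sum of arguments, while the differences are -e(u+1)/2r and
-e(u-1)/2r with u = u₁ - u₂. Replacing one difference by the other is precisely multiplication by
the eigenvalues of R/R₀. -/
lemma Rmat_apply_straight {e : ℂ} (he : e = 1 ∨ e = -1) (A : ℂ) (t₁ t₂ : Bool) :
    ∑ s₁, ∑ s₂, Rmat x r (u₁ - u₂) s₁ s₂ t₁ t₂ * (thetaVec x r s₁ ((-e * u₁ + A) / (2 * r)) *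
      thetaVec x r s₂ ((-e * u₂ + (A + e)) / (2 * r))) =
    R0 x r (u₁ - u₂) * (thetaVec x r t₁ ((-e * u₁ + (A + e)) / (2 * r)) *
      thetaVec x r t₂ ((-e * u₂ + A) / (2 * r))) := by
  have hT := tau_im_pos hx₀ hx₁ hr
  have e1 : (-e * u₁ + A) / (2 * r) + (-e * u₂ + (A + e)) / (2 * r) =
    (-e * u₁ + (A + e)) / (2 * r) + (-e * u₂ + A) / (2 * r) := by ring
  have e2 : (-e * u₁ + A) / (2 * r) - (-e * u₂ + (A + e)) / (2 * r) =
    -e * ((u₁ - u₂ + 1) / (2 * r)) := by ring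
  have e3 : (-e * u₁ + (A + e)) / (2 * r) - (-e * u₂ + A) / (2 * r) =
    -e * ((u₁ - u₂ - 1) / (2 * r)) := by ring
  refine Rmat_apply_thetaVec hx₀ hx₁ hr hu _ _ (fun t₁ t₂ => thetaVec x r t₁ _ * thetaVec x r t₂ _)
    ?_ ?_ ?_ ?_ t₁ t₂ <;> simp only [thetaVec, if_true, Bool.false_eq_true, if_false]
  · rw [← two_mul_theta0_mul hT, e1, e2, e3]
    rcases he with rfl | rfl <;> simp only [neg_neg, one_mul, neg_mul, theta0_neg hT] <;> ring
  · rw [← two_mul_theta1_mul hT, e1, e2, e3]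
    rcases he with rfl | rfl <;> simp only [neg_neg, one_mul, neg_mul, theta1_neg] <;> ring
  · rw [← two_mul_theta2_mul hT, e1, e2, e3]
    rcases he with rfl | rfl <;> simp only [neg_neg, one_mul, neg_mul, theta2_neg] <;> ring
  · rw [← two_mul_theta3_mul hT, e1, e2, e3]
    rcases he with rfl | rfl <;> simp only [neg_neg, one_mul, neg_mul, theta3_neg hT] <;> ring

/-- In the variables a = A/2r, v = u/2r, h = 1/2r, the two face weights (apart from R₀) are the
coefficients on the right of `turn_identity` divided by the coefficient on the left. The variable s
below is the common difference of arguments up to the sign e. -/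
lemma Rmat_apply_turn {e : ℂ} (he : e = 1 ∨ e = -1) {A : ℂ} (hA : br x r A ≠ 0) (t₁ t₂ : Bool) :
    ∑ s₁, ∑ s₂, Rmat x r (u₁ - u₂) s₁ s₂ t₁ t₂ * (thetaVec x r s₁ ((-e * u₁ + A) / (2 * r)) *
      thetaVec x r s₂ ((e * u₂ + (A + e)) / (2 * r))) =
    R0 x r (u₁ - u₂) * (br x r (A - e * (u₁ - u₂)) * br x r 1) / (br x r A * br x r (1 + (u₁ - u₂)))
      * (thetaVec x r t₁ ((e * u₁ + (A + e)) / (2 * r)) *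
        thetaVec x r t₂ ((-e * u₂ + A) / (2 * r))) +
    R0 x r (u₁ - u₂) * (br x r (A + e) * br x r (u₁ - u₂)) / (br x r A * br x r (1 + (u₁ - u₂))) *
      (thetaVec x r t₁ ((-e * u₁ + (A - e)) / (2 * r)) *
        thetaVec x r t₂ ((e * u₂ + A) / (2 * r))) := by
  have hT := tau_im_pos hx₀ hx₁ hr
  obtain ⟨u, hudef⟩ : ∃ u, u = u₁ - u₂ := ⟨_, rfl⟩
  obtain ⟨a, ha⟩ : ∃ a, a = A / (2 * r) := ⟨_, rfl⟩
  obtain ⟨v, hv⟩ : ∃ v, v = u / (2 * r) := ⟨_, rfl⟩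
  obtain ⟨h, hh⟩ : ∃ h : ℂ, h = 1 / (2 * r) := ⟨_, rfl⟩
  obtain ⟨s, hs⟩ : ∃ s, s = (u₁ + u₂ + 1) / (2 * r) := ⟨_, rfl⟩
  rw [← hudef] at hu ⊢
  have a1 : (-e * u₁ + A) / (2 * r) + (e * u₂ + (A + e)) / (2 * r) = 2 * a - e * (v - h) := by
    rw [ha, hv, hh, hudef]; ring
  have a2 : (-e * u₁ + A) / (2 * r) - (e * u₂ + (A + e)) / (2 * r) = -(e * s) := by
    rw [hs]; ring
  have a3 : (e * u₁ + (A + e)) / (2 * r) + (-e * u₂ + A) / (2 * r) = 2 * a + e * (v + h) := by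
    rw [ha, hv, hh, hudef]; ring
  have a4 : (e * u₁ + (A + e)) / (2 * r) - (-e * u₂ + A) / (2 * r) = e * s := by
    rw [hs]; ring
  have a5 : (-e * u₁ + (A - e)) / (2 * r) + (e * u₂ + A) / (2 * r) = 2 * a - e * (v + h) := by
    rw [ha, hv, hh, hudef]; ring
  have a6 : (-e * u₁ + (A - e)) / (2 * r) - (e * u₂ + A) / (2 * r) = -(e * s) := by
    rw [hs]; ring
  have a7 : (u - 1) / (2 * r) = v - h := by rw [hv, hh]; ring
  have a8 : (u + 1) / (2 * r) = v + h := by rw [hv, hh]; ring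
  have b1 : br x r A = thetaConst x r * theta1 (2 * a) (tau x r) := by
    rw [br]; congr 2; rw [ha]; ring
  have b2 : br x r (1 + u) = thetaConst x r * theta1 (2 * (v + h)) (tau x r) := by
    rw [br]; congr 2; rw [hv, hh]; ring
  have b3 : br x r (A - e * u) = thetaConst x r * theta1 (2 * (a - e * v)) (tau x r) := by
    rw [br]; congr 2; rw [ha, hv]; ring
  have b4 : br x r 1 = thetaConst x r * theta1 (2 * h) (tau x r) := by
    rw [br]; congr 2; rw [hh]; ring
  have b5 : br x r (A + e) = thetaConst x r * theta1 (2 * (a + e * h)) (tau x r) := by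
    rw [br]; congr 2; rw [ha, hh]; ring
  have b6 : br x r u = thetaConst x r * theta1 (2 * v) (tau x r) := by
    rw [br]; congr 2; rw [hv]; ring
  have hC := thetaConst_ne_zero hx₀ hx₁ hr
  have n1 : theta1 (2 * a) (tau x r) ≠ 0 := by
    rw [b1] at hA; exact right_ne_zero_of_mul hA
  have n2 : theta1 (2 * (v + h)) (tau x r) ≠ 0 := by
    rw [b2] at hu; exact right_ne_zero_of_mul hu
  have key0 := theta0_turn hT he a v h
  have key1 := theta1_turn hT he a v h
  have key2 := theta2_turn hT he a v h
  have key3 := theta3_turn hT he a v h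
  obtain ⟨w₁, hw₁⟩ : ∃ w, w = br x r (A - e * u) * br x r 1 / (br x r A * br x r (1 + u)) :=
    ⟨_, rfl⟩
  obtain ⟨w₂, hw₂⟩ : ∃ w, w = br x r (A + e) * br x r u / (br x r A * br x r (1 + u)) := ⟨_, rfl⟩
  have d1 : w₁ * (theta1 (2 * a) (tau x r) * theta1 (2 * (v + h)) (tau x r)) =
      theta1 (2 * (a - e * v)) (tau x r) * theta1 (2 * h) (tau x r) := by
    rw [hw₁, b1, b2, b3, b4]; field_simp
  have d2 : w₂ * (theta1 (2 * a) (tau x r) * theta1 (2 * (v + h)) (tau x r)) =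
      theta1 (2 * (a + e * h)) (tau x r) * theta1 (2 * v) (tau x r) := by
    rw [hw₂, b1, b2, b5, b6]; field_simp
  rw [← d1, ← d2] at key0 key1 key2 key3
  have nn := mul_ne_zero n1 n2
  rw [mul_div_assoc (R0 x r u), mul_div_assoc (R0 x r u), ← hw₁, ← hw₂, mul_assoc, mul_assoc, ← mul_add]
  refine Rmat_apply_of_turn hx₀ hx₁ hr hu a1 a2 a3 a4 a5 a6 ?_ ?_ ?_ ?_ t₁ t₂ <;> rw [a7, a8] <;>
    refine mul_left_cancel₀ nn ?_
  · linear_combination key0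
  · linear_combination key1
  · linear_combination key2
  · linear_combination key3

end VertexFace

/-- The height increment of a step. -/
def step (σ : Bool) : ℤ := if σ then 1 else -1

/-- The vertex-face correspondence for the elementary weights. -/
theorem vertex_face {x r : ℝ} (hx₀ : 0 < x) (hx₁ : x < 1) (hr : 1 < r) {u₁ u₂ : ℂ}
    (hu : br x r (1 + (u₁ - u₂)) ≠ 0) (a : ℤ) (β γ : Bool) (ha : β ≠ γ → br x r a ≠ 0)
    (t₁ t₂ : Bool) :
    ∑ s₁, ∑ s₂, Rmat x r (u₁ - u₂) s₁ s₂ t₁ t₂ * (psi x r s₁ u₁ a (a + step β) *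
      psi x r s₂ u₂ (a + step β) (a + step β + step γ)) =
    ∑ δ, faceW x r a (a + step β) (a + step δ) (a + step β + step γ) (u₁ - u₂) *
      (psi x r t₁ u₁ (a + step δ) (a + step β + step γ) * psi x r t₂ u₂ a (a + step δ)) := by
  have hs1 := fun A => Rmat_apply_straight hx₀ hx₁ hr hu (Or.inl rfl) A t₁ t₂
  have hs2 := fun A => Rmat_apply_straight hx₀ hx₁ hr hu (Or.inr rfl) A t₁ t₂
  cases β <;> cases γ
  · refine Eq.trans ?_ ((hs2 a).trans ?_)
    · refine Finset.sum_congr rfl fun s₁ _ => Finset.sum_congr rfl fun s₂ _ => ?_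
      simp only [psi_eq, step, if_false, Bool.false_eq_true]
      congr 3 <;> (push_cast; ring)
    · have f1 : faceW x r a (a + step false) (a + step true) (a + step false + step false)
          (u₁ - u₂) = 0 := by
        simp only [faceW, step, if_true, if_false, Bool.false_eq_true]
        exact if_neg (by omega)
      have f2 : faceW x r a (a + step false) (a + step false) (a + step false + step false)
          (u₁ - u₂) = R0 x r (u₁ - u₂) := by
        simp only [faceW, step, if_true, if_false, Bool.false_eq_true]
        rw [if_pos (by omega), if_neg (by omega)]
      rw [Fintype.sum_bool, f1, f2, zero_mul, zero_add]
      simp only [psi_eq, step, if_false, Bool.false_eq_true]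
      congr 3 <;> (push_cast; ring)
  · refine Eq.trans ?_ ((Rmat_apply_turn hx₀ hx₁ hr hu (Or.inr rfl) (ha (by simp)) t₁ t₂).trans ?_)
    · refine Finset.sum_congr rfl fun s₁ _ => Finset.sum_congr rfl fun s₂ _ => ?_
      simp only [psi_eq, step, if_true, if_false, Bool.false_eq_true]
      congr 3 <;> (push_cast; ring)
    · have f1 : faceW x r a (a + step false) (a + step true) (a + step false + step true)
          (u₁ - u₂) = R0 x r (u₁ - u₂) * (br x r (a + -1) * br x r (u₁ - u₂)) /
            (br x r a * br x r (1 + (u₁ - u₂))) := by simp [faceW, step]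
      have f2 : faceW x r a (a + step false) (a + step false) (a + step false + step true)
          (u₁ - u₂) = R0 x r (u₁ - u₂) * (br x r (a - -1 * (u₁ - u₂)) * br x r 1) /
            (br x r a * br x r (1 + (u₁ - u₂))) := by simp [faceW, step]
      rw [Fintype.sum_bool, f1, f2, add_comm]
      simp only [psi_eq, step, if_true, if_false, Bool.false_eq_true]
      congr 4 <;> (push_cast; ring)
  · refine Eq.trans ?_ ((Rmat_apply_turn hx₀ hx₁ hr hu (Or.inl rfl) (ha (by simp)) t₁ t₂).trans ?_)
    · refine Finset.sum_congr rfl fun s₁ _ => Finset.sum_congr rfl fun s₂ _ => ?_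
      simp only [psi_eq, step, if_true, if_false, Bool.false_eq_true]
      congr 3 <;> (push_cast; ring)
    · have f1 : faceW x r a (a + step true) (a + step false) (a + step true + step false)
          (u₁ - u₂) = R0 x r (u₁ - u₂) * (br x r (a + 1) * br x r (u₁ - u₂)) /
            (br x r a * br x r (1 + (u₁ - u₂))) := by simp [faceW, step]
      have f2 : faceW x r a (a + step true) (a + step true) (a + step true + step false)
          (u₁ - u₂) = R0 x r (u₁ - u₂) * (br x r (a - 1 * (u₁ - u₂)) * br x r 1) /
            (br x r a * br x r (1 + (u₁ - u₂))) := by simp [faceW, step]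
      rw [Fintype.sum_bool, f1, f2]
      simp only [psi_eq, step, if_true, if_false, Bool.false_eq_true]
      congr 4 <;> (push_cast; ring)
  · refine Eq.trans ?_ ((hs1 a).trans ?_)
    · refine Finset.sum_congr rfl fun s₁ _ => Finset.sum_congr rfl fun s₂ _ => ?_
      simp only [psi_eq, step, if_true]
      congr 3 <;> (push_cast; ring)
    · have f1 : faceW x r a (a + step true) (a + step false) (a + step true + step true)
          (u₁ - u₂) = 0 := by
        simp only [faceW, step, if_true, if_false, Bool.false_eq_true]
        exact if_neg (by omega)
      have f2 : faceW x r a (a + step true) (a + step true) (a + step true + step true)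
          (u₁ - u₂) = R0 x r (u₁ - u₂) := by
        simp only [faceW, step, if_true]
        rw [if_pos (by omega), if_neg (by omega)]
      rw [Fintype.sum_bool, f1, f2, zero_mul, add_zero]
      simp only [psi_eq, step, if_true]
      congr 3 <;> (push_cast; ring)

/-! ### Duality and symmetry of the elementary intertwining vectors -/

lemma step_sq (σ : Bool) : (step σ : ℂ) * step σ = 1 := by cases σ <;> simp [step]

lemma psiStar_eq (x r : ℝ) (ε : Bool) (u : ℂ) (b : ℤ) (σ : Bool) :
    psiStar x r ε u (b + step σ) b = -(if ε then 1 else -1) * (step σ / (2 * br x r b * br x r u)) *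
      thetaConst x r ^ 2 * thetaVec x r (!ε) ((step σ * u + b) / (2 * r)) := by
  rw [psiStar, psi_eq]
  congr 2
  · push_cast; congr 2; ring
  · push_cast; congr 1; ring

lemma psi_step (x r : ℝ) (ε : Bool) (u : ℂ) (a : ℤ) (σ : Bool) :
    psi x r ε u a (a + step σ) = thetaVec x r ε ((-(step σ * u) + a) / (2 * r)) := by
  rw [psi_eq]
  congr 1
  push_cast
  ring

lemma br_neg (x r : ℝ) (u : ℂ) : br x r (-u) = -br x r u := by
  rw [br, br, neg_div, theta1_neg, mul_neg]

/-- The sign in the dual vector turns the sum over ε into a determinant of theta vectors, hence into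
a product of two brackets. For σ ≠ σ' one of them is [0] = 0; for σ = σ' they are [b] and [σu],
which the prefactor cancels. -/
lemma sum_psiStar_mul_psi {x r : ℝ} (hx₀ : 0 < x) (hx₁ : x < 1) (hr : 1 < r) {u : ℂ}
    (hu : br x r u ≠ 0) {b : ℤ} (hb : br x r b ≠ 0) (σ σ' : Bool) :
    ∑ ε, psiStar x r ε u (b + step σ) b * psi x r ε u b (b + step σ') =
      if σ = σ' then 1 else 0 := by
  have hT := tau_im_pos hx₀ hx₁ hr
  have key := two_mul_theta1_mul hT ((step σ * u + b) / (2 * r)) ((-(step σ' * u) + b) / (2 * r))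
  simp only [Fintype.sum_bool, psiStar_eq, psi_step, thetaVec, Bool.not_true, Bool.not_false,
    if_true, Bool.false_eq_true, if_false]
  have h1 : thetaConst x r * theta1 ((step σ * u + b) / (2 * r) + (-(step σ' * u) + b) / (2 * r))
      (tau x r) = br x r (((step σ - step σ') * u) / 2 + b) := by
    rw [br]; congr 2; ring
  have h2 : thetaConst x r * theta1 ((step σ * u + b) / (2 * r) - (-(step σ' * u) + b) / (2 * r))
      (tau x r) = br x r ((step σ + step σ') * u / 2) := by
    rw [br]; congr 2; ring
  have h3 : br x r ((step σ - step σ') * u / 2 + b) * br x r ((step σ + step σ') * u / 2) =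
      if σ = σ' then step σ * (br x r b * br x r u) else 0 := by
    have h0 : br x r 0 = 0 := by simp [br, theta1]
    cases σ <;> cases σ' <;> simp [step, h0]
    · rw [show (-1 + -1) * u / 2 = -u by ring, br_neg]; ring
    · left; congr 1; ring
  rw [← h1, ← h2] at h3
  have h4 := step_sq σ
  trans (step σ / (br x r b * br x r u)) * (if σ = σ' then step σ * (br x r b * br x r u) else 0)
  · rw [← h3]
    clear h1 h2 h3
    generalize (step σ * u + b) / (2 * r) = X at *
    generalize (-(step σ' * u) + b) / (2 * r) = Y at *
    field_simp
    linear_combination -(step σ : ℂ) * thetaConst x r ^ 2 * key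
  · split_ifs
    · field_simp
      linear_combination h4
    · simp

/-- Both sides have the argument -σu + a - σ. Consequently an up-down pair and a down-up pair, with
spectral parameters u+1 and u, carry the same two vectors in opposite order; this explains the
shifts in the fused vectors. -/
lemma psi_shift (x r : ℝ) (s : Bool) (u : ℂ) (a : ℤ) (σ : Bool) :
    psi x r s (u + 1) a (a + step σ) =
      psi x r s u (a + step (!σ)) (a + step (!σ) + step σ) := by
  rw [psi_step, psi_step]
  congr 2
  cases σ <;> simp [step] <;> ring

/-- On a straight path σu + (b+σ) = σ(u+1) + b up to the common shift of the definition, so both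
factors contain the same theta vector and exchanging signs has no effect. -/
lemma psiStar_straight_symm (x r : ℝ) (ε ε' : Bool) (u : ℂ) (b : ℤ) (σ : Bool) :
    psiStar x r ε (u + 1) (b + step σ) b * psiStar x r ε' u (b + step σ + step σ) (b + step σ) =
    psiStar x r ε' (u + 1) (b + step σ) b *
      psiStar x r ε u (b + step σ + step σ) (b + step σ) := by
  simp only [psiStar_eq]
  have : (step σ : ℂ) * u + ((b + step σ : ℤ) : ℂ) = step σ * (u + 1) + b := by push_cast; ring
  rw [this]
  ring

/-- The part antisymmetric in ε, ε' is a sum over the two intermediate heights of a determinant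
divided by [b±1]. Each determinant contains [b±1] as a factor; the remaining factors are negatives
of each other (`e3`), so the two terms cancel. -/
lemma psiStar_turn_symm {x r : ℝ} (hx₀ : 0 < x) (hx₁ : x < 1) (hr : 1 < r) (ε ε' : Bool) (u : ℂ)
    (b : ℤ) (hb : ∀ σ, br x r ((b + step σ : ℤ) : ℂ) ≠ 0) :
    ∑ σ, psiStar x r ε (u + 1) (b + step σ) b *
      psiStar x r ε' u (b + step σ + step (!σ)) (b + step σ) =
    ∑ σ, psiStar x r ε' (u + 1) (b + step σ) b *
      psiStar x r ε u (b + step σ + step (!σ)) (b + step σ) := by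
  have hT := tau_im_pos hx₀ hx₁ hr
  have hC := thetaConst_ne_zero hx₀ hx₁ hr
  have h1 := hb true
  have h2 := hb false
  have e1 : br x r ((b + step true : ℤ) : ℂ) = thetaConst x r *
      theta1 ((step true * (u + 1) + b) / (2 * r) +
        (step false * u + (b + step true : ℤ)) / (2 * r)) (tau x r) := by
    rw [br]; congr 2; simp [step]; ring
  have e2 : br x r ((b + step false : ℤ) : ℂ) = thetaConst x r *
      theta1 ((step false * (u + 1) + b) / (2 * r) +
        (step true * u + (b + step false : ℤ)) / (2 * r)) (tau x r) := by
    rw [br]; congr 2; simp [step]; ring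
  have e3 : theta1 ((step false * (u + 1) + b) / (2 * r) -
        (step true * u + (b + step false : ℤ)) / (2 * r)) (tau x r) =
      -theta1 ((step true * (u + 1) + b) / (2 * r) -
        (step false * u + (b + step true : ℤ)) / (2 * r)) (tau x r) := by
    rw [← theta1_neg]; congr 1; simp [step]; ring
  have k1 := two_mul_theta1_mul hT ((step true * (u + 1) + b) / (2 * r))
    ((step false * u + (b + step true : ℤ)) / (2 * r))
  have k2 := two_mul_theta1_mul hT ((step false * (u + 1) + b) / (2 * r))
    ((step true * u + (b + step false : ℤ)) / (2 * r))
  rw [e3] at k2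
  have hD : ∀ (p q p' q' : ℂ), (p - q) / br x r ((b + step true : ℤ) : ℂ) +
      (p' - q') / br x r ((b + step false : ℤ) : ℂ) = 0 →
      p / br x r ((b + step true : ℤ) : ℂ) + p' / br x r ((b + step false : ℤ) : ℂ) =
      q / br x r ((b + step true : ℤ) : ℂ) + q' / br x r ((b + step false : ℤ) : ℂ) := by
    intro p q p' q' h
    rw [sub_div, sub_div] at h
    linear_combination h
  have main : ∀ s t : Bool,
      thetaVec x r s ((step true * (u + 1) + b) / (2 * r)) *
        thetaVec x r t ((step false * u + (b + step true : ℤ)) / (2 * r)) /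
          br x r ((b + step true : ℤ) : ℂ) +
      thetaVec x r s ((step false * (u + 1) + b) / (2 * r)) *
        thetaVec x r t ((step true * u + (b + step false : ℤ)) / (2 * r)) /
          br x r ((b + step false : ℤ) : ℂ) =
      thetaVec x r t ((step true * (u + 1) + b) / (2 * r)) *
        thetaVec x r s ((step false * u + (b + step true : ℤ)) / (2 * r)) /
          br x r ((b + step true : ℤ) : ℂ) +
      thetaVec x r t ((step false * (u + 1) + b) / (2 * r)) *
        thetaVec x r s ((step true * u + (b + step false : ℤ)) / (2 * r)) /
          br x r ((b + step false : ℤ) : ℂ) := by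
    have base : (theta0 ((step true * (u + 1) + b) / (2 * r)) (tau x r / 2) *
        theta3 ((step false * u + (b + step true : ℤ)) / (2 * r)) (tau x r / 2) -
        theta3 ((step true * (u + 1) + b) / (2 * r)) (tau x r / 2) *
        theta0 ((step false * u + (b + step true : ℤ)) / (2 * r)) (tau x r / 2)) /
          br x r ((b + step true : ℤ) : ℂ) +
      (theta0 ((step false * (u + 1) + b) / (2 * r)) (tau x r / 2) *
        theta3 ((step true * u + (b + step false : ℤ)) / (2 * r)) (tau x r / 2) -
        theta3 ((step false * (u + 1) + b) / (2 * r)) (tau x r / 2) *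
        theta0 ((step true * u + (b + step false : ℤ)) / (2 * r)) (tau x r / 2)) /
          br x r ((b + step false : ℤ) : ℂ) = 0 := by
      rw [← k1, ← k2]
      rw [e1] at h1 ⊢
      rw [e2] at h2 ⊢
      have h1' := right_ne_zero_of_mul h1
      have h2' := right_ne_zero_of_mul h2
      clear e1 e2 e3 k1 k2 hD h1 h2
      generalize theta1 ((step true * (u + 1) + b) / (2 * r) +
        (step false * u + (b + step true : ℤ)) / (2 * r)) (tau x r) = α at *
      generalize theta1 ((step false * (u + 1) + b) / (2 * r) +
        (step true * u + (b + step false : ℤ)) / (2 * r)) (tau x r) = β at *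
      generalize theta1 ((step true * (u + 1) + b) / (2 * r) -
        (step false * u + (b + step true : ℤ)) / (2 * r)) (tau x r) = γ at *
      field_simp
      ring
    intro s t
    apply hD
    cases s <;> cases t <;> simp only [thetaVec, if_true, if_false, Bool.false_eq_true]
    · ring
    · linear_combination -base
    · exact base
    · ring
  simp only [Fintype.sum_bool, psiStar_eq, Bool.not_true, Bool.not_false]
  have := main (!ε) (!ε')
  linear_combination (-(if ε then (1:ℂ) else -1)) * (-(if ε' then (1:ℂ) else -1)) *
    thetaConst x r ^ 4 * (step true * step false) / (4 * br x r b * br x r (u + 1) * br x r u) *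
      this

/-! ### The fusion identities of the eight-vertex weights -/

section FusionWeights

variable {x r : ℝ} (hx₀ : 0 < x) (hx₁ : x < 1) (hr : 1 < r) {w : ℂ}
  (h1 : br x r (1 + w) ≠ 0) (h2 : br x r (2 + w) ≠ 0)
include hx₀ hx₁ hr h1 h2

/-- These are the scalar relations needed for R(w+1)R(w) to preserve antisymmetric tensors. The
first two hold after cancellation of common factors. For the third, all products at modulus τ/2 are
expanded at modulus τ, in the arguments 2v, 2h and 0, where the two sides agree as polynomials. -/
lemma wt_fusion :
    wtB x r w * wtD x r (w + 1) = wtD x r w * wtA x r (w + 1) ∧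
    wtC x r w * wtB x r (w + 1) = wtA x r w * wtC x r (w + 1) ∧
    wtB x r w * wtA x r (w + 1) + wtC x r w * wtC x r (w + 1) =
      wtA x r w * wtB x r (w + 1) + wtD x r w * wtD x r (w + 1) := by
  have hT := tau_im_pos hx₀ hx₁ hr
  have ht : 0 < (tau x r / 2).im := by simpa using hT
  have h0 := theta2_zero_ne_zero ht
  rw [br_ne_zero_iff hx₀ hx₁ hr, add_comm] at h1
  rw [br_ne_zero_iff hx₀ hx₁ hr] at h2
  obtain ⟨n1, n2⟩ := theta_half_ne_zero hT h1
  obtain ⟨n3, n4⟩ := theta_half_ne_zero hT h2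
  obtain ⟨v, hv⟩ : ∃ v, v = (w + 1) / (2 * r) := ⟨_, rfl⟩
  obtain ⟨h, hh⟩ : ∃ h : ℂ, h = 1 / (2 * r) := ⟨_, rfl⟩
  have e1 : w / (2 * r) = v - h := by rw [hv, hh]; ring
  have e2 : (2 + w) / (2 * r) = v + h := by rw [hv, hh]; ring
  rw [e2] at n3 n4
  rw [← hv] at n1 n2
  simp only [wtA, wtB, wtC, wtD, show 1 + (w + 1) = 2 + w by ring, add_comm 1 w, e1, e2, ← hv, ← hh]
  refine ⟨by field_simp, by field_simp, ?_⟩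
  have f1 := theta1_mul_theta1 hT (v + h) (v - h)
  have f2 := theta2_mul_theta2 hT (v + h) (v - h)
  have f3 := theta1_mul_theta1 hT v v
  have f4 := theta2_mul_theta2 hT v v
  have f5 := theta1_mul_theta1 hT h h
  have f6 := theta2_mul_theta2 hT h h
  rw [show v + h + (v - h) = v + v by ring, show v + h - (v - h) = h + h by ring] at f1 f2
  rw [sub_self] at f3 f4 f5 f6
  have key : theta2 h (tau x r / 2) * theta2 h (tau x r / 2) *
      (theta1 (v + h) (tau x r / 2) * theta1 (v - h) (tau x r / 2) *
        (theta2 v (tau x r / 2) * theta2 v (tau x r / 2)) -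
        theta2 (v + h) (tau x r / 2) * theta2 (v - h) (tau x r / 2) *
        (theta1 v (tau x r / 2) * theta1 v (tau x r / 2))) =
      theta1 h (tau x r / 2) * theta1 h (tau x r / 2) *
      (theta1 (v + h) (tau x r / 2) * theta1 (v - h) (tau x r / 2) *
        (theta1 v (tau x r / 2) * theta1 v (tau x r / 2)) -
        theta2 (v + h) (tau x r / 2) * theta2 (v - h) (tau x r / 2) *
        (theta2 v (tau x r / 2) * theta2 v (tau x r / 2))) := by
    rw [f1, f2, f3, f4, f5, f6]
    ring
  field_simp
  linear_combination key

end FusionWeights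

/-! ### Operators compatible with symmetrization -/

section Ring

variable {A : Type*} [Ring A]

/-- `X` maps the antisymmetric vectors of the involution `P` to antisymmetric vectors. -/
def PreservesAnti (P X : A) : Prop := (1 + P) * X * (1 - P) = 0

lemma PreservesAnti.of_commute {P X : A} (hP : P * P = 1) (h : Commute P X) :
    PreservesAnti P X := by
  unfold PreservesAnti
  have : (1 + P) * X = X * (1 + P) := by rw [add_mul, mul_add, h.eq]; simp
  rw [this, mul_assoc, show (1 + P) * (1 - P) = 1 - P * P by noncomm_ring, hP, sub_self, mul_zero]

/-- Interleaving of two products with commuting cross factors. -/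
lemma ofFn_prod_mul_ofFn_prod : ∀ {n : ℕ} (X Y : Fin n → A),
    (∀ i j, i ≠ j → Commute (X i) (Y j)) →
    (List.ofFn X).prod * (List.ofFn Y).prod = (List.ofFn fun i => X i * Y i).prod
  | 0, X, Y, _ => by simp
  | n + 1, X, Y, h => by
    rw [List.ofFn_succ, List.ofFn_succ, List.ofFn_succ, List.prod_cons, List.prod_cons,
      List.prod_cons, ← ofFn_prod_mul_ofFn_prod _ _ fun i j hij =>
        h i.succ j.succ fun e => hij (Fin.succ_injective _ e)]
    have : Commute (List.ofFn fun i => X (Fin.succ i)).prod (Y 0) := by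
      refine Commute.list_prod_left _ _ fun Z hZ => ?_
      obtain ⟨l, rfl⟩ := List.mem_ofFn.mp hZ
      exact h _ _ (Fin.succ_ne_zero l)
    simp only [mul_assoc]
    rw [← mul_assoc (List.ofFn fun i => X (Fin.succ i)).prod (Y 0), this.eq, mul_assoc]

variable [Algebra ℂ A]

lemma PreservesAnti.mul {P X Y : A} (hX : PreservesAnti P X)
    (hY : PreservesAnti P Y) : PreservesAnti P (X * Y) := by
  unfold PreservesAnti at *
  -- Since the image of Y(1-P) is antisymmetric, a further factor 1-P acts on it as multiplication
  -- by 2; inserting it allows the hypothesis on X to be used.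
  have h1 : (2 : ℂ) • (Y * (1 - P)) = (1 - P) * Y * (1 - P) := by
    have : (1 - P) * Y * (1 - P) = (2 : ℂ) • (Y * (1 - P)) - (1 + P) * Y * (1 - P) := by
      rw [two_smul]; noncomm_ring
    rw [this, hY, sub_zero]
  have h2 : (2 : ℂ) • ((1 + P) * (X * Y) * (1 - P)) = 0 := by
    calc (2 : ℂ) • ((1 + P) * (X * Y) * (1 - P)) = (1 + P) * X * ((2 : ℂ) • (Y * (1 - P))) := by
          rw [mul_smul_comm]; simp only [mul_assoc]
      _ = ((1 + P) * X * (1 - P)) * (Y * (1 - P)) := by rw [h1]; simp only [mul_assoc]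
      _ = 0 := by rw [hX, zero_mul]
  exact (smul_eq_zero.mp h2).resolve_left two_ne_zero

lemma PreservesAnti.list_prod {P : A} (hP : P * P = 1) :
    ∀ l : List A, (∀ X ∈ l, PreservesAnti P X) → PreservesAnti P l.prod
  | [], _ => PreservesAnti.of_commute hP (Commute.one_right P)
  | X :: l, h => by
    rw [List.prod_cons]
    exact (h X (by simp)).mul (PreservesAnti.list_prod hP l fun Y hY => h Y (by simp [hY]))

/-- Only the two consecutive factors at i and i+1 see the transposition; all others commute with it
and are covered by `PreservesAnti.of_commute`. -/
lemma PreservesAnti.ofFn_prod {P : A} (hP : P * P = 1) : ∀ {n : ℕ} (X : Fin n → A) (i : ℕ)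
    (hi : i + 1 < n), PreservesAnti P (X ⟨i, by omega⟩ * X ⟨i + 1, hi⟩) →
    (∀ l : Fin n, (l : ℕ) ≠ i → (l : ℕ) ≠ i + 1 → Commute P (X l)) →
    PreservesAnti P (List.ofFn X).prod
  | 0, X, i, hi, _, _ => by omega
  | 1, X, i, hi, _, _ => by omega
  | n + 2, X, 0, hi, h, hc => by
    rw [List.ofFn_succ, List.ofFn_succ, List.prod_cons, List.prod_cons, ← mul_assoc]
    refine PreservesAnti.mul h (PreservesAnti.list_prod hP _ fun Y hY => ?_)
    obtain ⟨l, rfl⟩ := List.mem_ofFn.mp hY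
    exact PreservesAnti.of_commute hP (hc _ (by simp) (by simp))
  | n + 2, X, i + 1, hi, h, hc => by
    rw [List.ofFn_succ, List.prod_cons]
    refine (PreservesAnti.of_commute hP (hc _ (by simp) (by simp))).mul ?_
    exact PreservesAnti.ofFn_prod hP (fun l => X l.succ) i (by omega) h fun l h1 h2 =>
      hc l.succ (by simpa using h1) (by simpa using h2)

/-- From S ρ(g) = S one gets 2 S M (1-P) = S(1+P)M(1-P) = 0 for every adjacent transposition P.
Adjacent transpositions generate the symmetric group, so S M ρ(g) = S M for all g, and averaging
gives the claim. The order in `hmul` is reversed because permutations act by precomposition. -/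
lemma symmetrizer_mul_mul {k : ℕ} {ρ : Equiv.Perm (Fin k) → A} (h1 : ρ 1 = 1)
    (hmul : ∀ g h, ρ g * ρ h = ρ (h * g)) {S : A}
    (hS : S = (k.factorial : ℂ)⁻¹ • ∑ g, ρ g) {M : A}
    (hM : ∀ (i : ℕ) (hi : i + 1 < k),
      PreservesAnti (ρ (Equiv.swap ⟨i, by omega⟩ ⟨i + 1, hi⟩)) M) :
    S * M * S = S * M := by
  have hSρ : ∀ g, S * ρ g = S := by
    intro g
    rw [hS, smul_mul_assoc, Finset.sum_mul]
    congr 1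
    exact Fintype.sum_equiv (Equiv.mulLeft g) _ _ fun h => by simp [hmul]
  have key : ∀ g, S * M * ρ g = S * M := by
    rcases k with _ | k
    · intro g
      rw [Subsingleton.elim g 1, h1, mul_one]
    · intro g
      have hg : g ∈ Submonoid.closure (Set.range fun i : Fin k =>
          Equiv.swap i.castSucc i.succ) := by
        rw [Equiv.Perm.mclosure_swap_castSucc_succ]; trivial
      induction hg using Submonoid.closure_induction with
      | mem x hx =>
        obtain ⟨i, rfl⟩ := hx
        have h := hM i (by omega)
        unfold PreservesAnti at h
        have h2 : S * ((1 + ρ (Equiv.swap i.castSucc i.succ)) * M *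
            (1 - ρ (Equiv.swap i.castSucc i.succ))) = 0 := by
          have : (Equiv.swap i.castSucc i.succ : Equiv.Perm (Fin (k + 1))) =
            Equiv.swap ⟨i, by omega⟩ ⟨i + 1, by omega⟩ := rfl
          rw [this, h, mul_zero]
        rw [← mul_assoc, ← mul_assoc, mul_add, mul_one, hSρ, ← two_smul ℂ, smul_mul_assoc,
          smul_mul_assoc] at h2
        have h3 := (smul_eq_zero.mp h2).resolve_left two_ne_zero
        rw [mul_sub, mul_one, sub_eq_zero] at h3
        exact h3.symm
      | one => rw [h1, mul_one]
      | mul x y _ _ hx hy => rw [← hmul, ← mul_assoc, hy, hx]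
  calc S * M * S = S * M * ((k.factorial : ℂ)⁻¹ • ∑ g, ρ g) := by rw [← hS]
    _ = S * M := ?_
  rw [mul_smul_comm, Finset.mul_sum, Finset.sum_congr rfl fun g _ => key g, Finset.sum_const,
    Finset.card_univ, Fintype.card_perm, Fintype.card_fin, ← Nat.cast_smul_eq_nsmul ℂ, smul_smul,
    inv_mul_cancel₀ (by exact_mod_cast k.factorial_ne_zero), one_smul]

lemma symmetrizer_mul_self {k : ℕ} {ρ : Equiv.Perm (Fin k) → A} (h1 : ρ 1 = 1)
    (hmul : ∀ g h, ρ g * ρ h = ρ (h * g)) {S : A}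
    (hS : S = (k.factorial : ℂ)⁻¹ • ∑ g, ρ g) : S * S = S := by
  have := symmetrizer_mul_mul h1 hmul hS (M := 1) fun i hi =>
    PreservesAnti.of_commute (by rw [hmul, Equiv.swap_mul_self, h1]) (Commute.one_right _)
  simpa using this

end Ring

/-! ### The operators on `V^{⊗k} ⊗ V^{⊗k}` -/

/-- Permutation of the factors of the first `V^{⊗k}`. -/
def perm1 {k : ℕ} (g : Equiv.Perm (Fin k)) : Matrix (Conf k) (Conf k) ℂ := fun t s =>
  if t.1 = s.1 ∘ g ∧ t.2 = s.2 then 1 else 0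

/-- Permutation of the factors of the second `V^{⊗k}`. -/
def perm2 {k : ℕ} (g : Equiv.Perm (Fin k)) : Matrix (Conf k) (Conf k) ℂ := fun t s =>
  if t.1 = s.1 ∧ t.2 = s.2 ∘ g then 1 else 0

lemma matrix_ext_mulVec {ι : Type*} [Fintype ι] [DecidableEq ι] {A B : Matrix ι ι ℂ}
    (h : ∀ F t, A.mulVec F t = B.mulVec F t) : A = B :=
  Matrix.mulVec_injective (funext fun F => funext fun t => h F t)

lemma perm1_mulVec {k : ℕ} (g : Equiv.Perm (Fin k)) (F : Conf k → ℂ) (t : Conf k) :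
    (perm1 g).mulVec F t = F (t.1 ∘ g.symm, t.2) := by
  rw [Matrix.mulVec, dotProduct, Finset.sum_eq_single (t.1 ∘ g.symm, t.2)]
  · simp [perm1, Function.comp_assoc]
  · intro s _ hs
    rw [perm1, if_neg, zero_mul]
    rintro ⟨h1, h2⟩
    apply hs
    ext <;> simp [h1, h2]
  · simp

lemma perm2_mulVec {k : ℕ} (g : Equiv.Perm (Fin k)) (F : Conf k → ℂ) (t : Conf k) :
    (perm2 g).mulVec F t = F (t.1, t.2 ∘ g.symm) := by
  rw [Matrix.mulVec, dotProduct, Finset.sum_eq_single (t.1, t.2 ∘ g.symm)]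
  · simp [perm2, Function.comp_assoc]
  · intro s _ hs
    rw [perm2, if_neg, zero_mul]
    rintro ⟨h1, h2⟩
    apply hs
    ext <;> simp [h1, h2]
  · simp

lemma perm1_one {k : ℕ} : (perm1 (1 : Equiv.Perm (Fin k))) = 1 := by
  refine matrix_ext_mulVec fun F t => ?_
  rw [perm1_mulVec, Matrix.one_mulVec]
  rfl

lemma perm2_one {k : ℕ} : (perm2 (1 : Equiv.Perm (Fin k))) = 1 := by
  refine matrix_ext_mulVec fun F t => ?_
  rw [perm2_mulVec, Matrix.one_mulVec]
  rfl

lemma perm1_mul {k : ℕ} (g h : Equiv.Perm (Fin k)) : perm1 g * perm1 h = perm1 (h * g) := by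
  refine matrix_ext_mulVec fun F t => ?_
  rw [← Matrix.mulVec_mulVec, perm1_mulVec, perm1_mulVec, perm1_mulVec]
  rfl

lemma perm2_mul {k : ℕ} (g h : Equiv.Perm (Fin k)) : perm2 g * perm2 h = perm2 (h * g) := by
  refine matrix_ext_mulVec fun F t => ?_
  rw [← Matrix.mulVec_mulVec, perm2_mulVec, perm2_mulVec, perm2_mulVec]
  rfl

lemma perm1_commute_perm2 {k : ℕ} (g h : Equiv.Perm (Fin k)) : Commute (perm1 g) (perm2 h) := by
  refine matrix_ext_mulVec fun F t => ?_
  rw [← Matrix.mulVec_mulVec, ← Matrix.mulVec_mulVec, perm1_mulVec, perm2_mulVec, perm2_mulVec,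
    perm1_mulVec]

lemma sym1_eq (k : ℕ) : sym1 k = (k.factorial : ℂ)⁻¹ • ∑ g, perm1 g := by
  ext t s
  simp [sym1, perm1, Matrix.sum_apply]

lemma sym2_eq (k : ℕ) : sym2 k = (k.factorial : ℂ)⁻¹ • ∑ g, perm2 g := by
  ext t s
  simp [sym2, perm2, Matrix.sum_apply]

lemma sym1_commute_sym2 (k : ℕ) : Commute (sym1 k) (sym2 k) := by
  rw [sym1_eq, sym2_eq]
  exact ((Commute.sum_left _ _ _ fun g _ => Commute.sum_right _ _ _ fun h _ =>
    perm1_commute_perm2 g h).smul_left _).smul_right _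

lemma Rsite_mulVec (x r : ℝ) {k : ℕ} (u : ℂ) (i j : Fin k) (F : Conf k → ℂ) (t : Conf k) :
    (Rsite x r u i j).mulVec F t = ∑ σ, ∑ τ, Rmat x r u σ τ (t.1 i) (t.2 j) *
      F (Function.update t.1 i σ, Function.update t.2 j τ) := by
  rw [Matrix.mulVec, dotProduct, ← Fintype.sum_prod_type' (f := fun σ τ =>
    Rmat x r u σ τ (t.1 i) (t.2 j) * F (Function.update t.1 i σ, Function.update t.2 j τ))]
  symm
  refine Finset.sum_of_injOn (fun p : Bool × Bool =>
    (Function.update t.1 i p.1, Function.update t.2 j p.2)) ?_ ?_ ?_ ?_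
  · rintro ⟨a, b⟩ _ ⟨c, d⟩ _ h
    simp only [Prod.mk.injEq] at h
    have h1 := congrFun h.1 i
    have h2 := congrFun h.2 j
    simp only [Function.update_self] at h1 h2
    rw [h1, h2]
  · intro _ _; simp
  · intro s _ hs
    rw [Rsite, if_neg, zero_mul]
    rintro ⟨h1, h2⟩
    refine hs ⟨(s.1 i, s.2 j), by simp, ?_⟩
    ext l
    · by_cases hl : l = i
      · subst hl; simp
      · simp [hl, h1 l hl]
    · by_cases hl : l = j
      · subst hl; simp
      · simp [hl, h2 l hl]
  · rintro ⟨a, b⟩ _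
    rw [Rsite, if_pos]
    · simp
    · exact ⟨fun l hl => by simp [hl], fun l hl => by simp [hl]⟩

lemma Rmat_symm (x r : ℝ) (u : ℂ) (s₁ s₂ t₁ t₂ : Bool) :
    Rmat x r u s₁ s₂ t₁ t₂ = Rmat x r u s₂ s₁ t₂ t₁ := by
  cases s₁ <;> cases s₂ <;> cases t₁ <;> cases t₂ <;> simp [Rmat]

lemma Rsite_commute_perm1 (x r : ℝ) {k : ℕ} (u : ℂ) {i i₁ i₂ j : Fin k} (h1 : i ≠ i₁)
    (h2 : i ≠ i₂) : Commute (perm1 (Equiv.swap i₁ i₂)) (Rsite x r u i j) := by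
  refine matrix_ext_mulVec fun F t => ?_
  rw [← Matrix.mulVec_mulVec, ← Matrix.mulVec_mulVec, perm1_mulVec, Rsite_mulVec, Rsite_mulVec]
  refine Finset.sum_congr rfl fun σ _ => Finset.sum_congr rfl fun τ _ => ?_
  rw [perm1_mulVec]
  have e : (Equiv.swap i₁ i₂) i = i := Equiv.swap_apply_of_ne_of_ne h1 h2
  simp only [Equiv.symm_swap, Function.comp_apply, e]
  congr 3
  rw [Function.update_comp_equiv, Equiv.symm_swap, e]

lemma Rsite_commute_perm2 (x r : ℝ) {k : ℕ} (u : ℂ) {i j j₁ j₂ : Fin k} (h1 : j ≠ j₁)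
    (h2 : j ≠ j₂) : Commute (perm2 (Equiv.swap j₁ j₂)) (Rsite x r u i j) := by
  refine matrix_ext_mulVec fun F t => ?_
  rw [← Matrix.mulVec_mulVec, ← Matrix.mulVec_mulVec, perm2_mulVec, Rsite_mulVec, Rsite_mulVec]
  refine Finset.sum_congr rfl fun σ _ => Finset.sum_congr rfl fun τ _ => ?_
  rw [perm2_mulVec]
  have e : (Equiv.swap j₁ j₂) j = j := Equiv.swap_apply_of_ne_of_ne h1 h2
  simp only [Equiv.symm_swap, Function.comp_apply, e]
  congr 3
  rw [Function.update_comp_equiv, Equiv.symm_swap, e]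

lemma Rsite_commute (x r : ℝ) {k : ℕ} (u v : ℂ) {i i' j j' : Fin k} (hi : i ≠ i') (hj : j ≠ j') :
    Commute (Rsite x r u i j) (Rsite x r v i' j') := by
  refine matrix_ext_mulVec fun F t => ?_
  simp only [← Matrix.mulVec_mulVec, Rsite_mulVec, Function.update_of_ne hi,
    Function.update_of_ne hj, Function.update_of_ne hi.symm, Function.update_of_ne hj.symm,
    Function.update_comm hi, Function.update_comm hj, Fintype.sum_bool]
  ring

/-- The composition `R(w+1) R(w)` on two neighbouring factors maps antisymmetric tensors to
antisymmetric tensors. -/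
lemma Rmat_fusion {x r : ℝ} (hx₀ : 0 < x) (hx₁ : x < 1) (hr : 1 < r) {w : ℂ}
    (h1 : br x r (1 + w) ≠ 0) (h2 : br x r (2 + w) ≠ 0) (φ : Bool → Bool → Bool → ℂ)
    (hφ : ∀ σ σ' τ, φ σ σ' τ = -φ σ' σ τ) (α β γ : Bool) :
    ∑ σ, ∑ τ, Rmat x r (w + 1) σ τ α γ * ∑ σ', ∑ τ', Rmat x r w σ' τ' β τ * φ σ σ' τ' +
    ∑ σ, ∑ τ, Rmat x r (w + 1) σ τ β γ * ∑ σ', ∑ τ', Rmat x r w σ' τ' α τ * φ σ σ' τ' = 0 := by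
  obtain ⟨e1, e2, e3⟩ := wt_fusion hx₀ hx₁ hr h1 h2
  have d1 : ∀ σ τ, φ σ σ τ = 0 := fun σ τ => by
    have := hφ σ σ τ
    exact self_eq_neg.mp this
  have d2 : ∀ τ, φ false true τ = -φ true false τ := fun τ => hφ false true τ
  simp only [Fintype.sum_bool, d1, d2]
  cases α <;> cases β <;> cases γ <;> simp [Rmat] <;>
  first
    | linear_combination R0 x r (w + 1) * R0 x r w * φ true false true * e1
    | linear_combination R0 x r (w + 1) * R0 x r w * φ true false false * e1
    | linear_combination -R0 x r (w + 1) * R0 x r w * φ true false true * e1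
    | linear_combination -R0 x r (w + 1) * R0 x r w * φ true false false * e1
    | linear_combination R0 x r (w + 1) * R0 x r w * φ true false true * e2
    | linear_combination R0 x r (w + 1) * R0 x r w * φ true false false * e2
    | linear_combination -R0 x r (w + 1) * R0 x r w * φ true false true * e2
    | linear_combination -R0 x r (w + 1) * R0 x r w * φ true false false * e2
    | linear_combination R0 x r (w + 1) * R0 x r w * φ true false true * e3
    | linear_combination R0 x r (w + 1) * R0 x r w * φ true false false * e3
    | linear_combination -R0 x r (w + 1) * R0 x r w * φ true false true * e3
    | linear_combination -R0 x r (w + 1) * R0 x r w * φ true false false * e3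

lemma preservesAnti_of_mulVec {k : ℕ} {P X : Matrix (Conf k) (Conf k) ℂ} (hP : P * P = 1)
    (h : ∀ F : Conf k → ℂ, (∀ t, P.mulVec F t = -F t) →
      ∀ t, X.mulVec F t + P.mulVec (X.mulVec F) t = 0) : PreservesAnti P X := by
  refine matrix_ext_mulVec fun F t => ?_
  have hF : ∀ t, P.mulVec ((1 - P).mulVec F) t = -((1 - P).mulVec F) t := by
    intro t
    rw [← Pi.neg_apply, Matrix.mulVec_mulVec, mul_sub, hP, mul_one, ← Matrix.neg_mulVec, neg_sub]
  have := h _ hF t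
  rw [Matrix.zero_mulVec, ← Matrix.mulVec_mulVec, ← Matrix.mulVec_mulVec, Matrix.add_mulVec,
    Matrix.one_mulVec]
  exact this

lemma perm1_swap_mul_self {k : ℕ} (i i' : Fin k) :
    perm1 (Equiv.swap i i') * perm1 (Equiv.swap i i') = 1 := by
  rw [perm1_mul, Equiv.swap_mul_self, perm1_one]

lemma perm2_swap_mul_self {k : ℕ} (i i' : Fin k) :
    perm2 (Equiv.swap i i') * perm2 (Equiv.swap i i') = 1 := by
  rw [perm2_mul, Equiv.swap_mul_self, perm2_one]

lemma update_update_comp_swap {k : ℕ} {i i' : Fin k} (hi : i ≠ i') (s : Fin k → Bool)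
    (σ σ' : Bool) : Function.update (Function.update s i σ) i' σ' ∘ (Equiv.swap i i') =
      Function.update (Function.update s i σ') i' σ := by
  ext l
  rcases eq_or_ne l i with rfl | h1
  · simp [hi]
  rcases eq_or_ne l i' with rfl | h2
  · simp [hi]
  · simp [Equiv.swap_apply_of_ne_of_ne h1 h2, h1, h2]

lemma update_update_swap {k : ℕ} {i i' : Fin k} (hi : i ≠ i') (s : Fin k → Bool)
    (σ σ' : Bool) : Function.update (Function.update (s ∘ (Equiv.swap i i')) i σ) i' σ' =
      Function.update (Function.update s i σ) i' σ' := by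
  ext l
  rcases eq_or_ne l i with rfl | h1
  · simp [hi]
  rcases eq_or_ne l i' with rfl | h2
  · simp
  · simp [Equiv.swap_apply_of_ne_of_ne h1 h2, h1, h2]

/-! ### Fusion: the products of elementary R-matrices preserve antisymmetric tensors -/

section Fusion

variable {x r : ℝ} (hx₀ : 0 < x) (hx₁ : x < 1) (hr : 1 < r)
include hx₀ hx₁ hr

lemma preservesAnti_Rsite1 {w : ℂ} (h1 : br x r (1 + w) ≠ 0) (h2 : br x r (2 + w) ≠ 0) {k : ℕ}
    {i i' : Fin k} (hi : i ≠ i') (j : Fin k) :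
    PreservesAnti (perm1 (Equiv.swap i i')) (Rsite x r (w + 1) i j * Rsite x r w i' j) := by
  refine preservesAnti_of_mulVec (perm1_swap_mul_self i i') fun F hF t => ?_
  simp only [perm1_mulVec, Equiv.symm_swap] at hF
  rw [perm1_mulVec, Equiv.symm_swap, ← Matrix.mulVec_mulVec]
  simp only [Rsite_mulVec, Function.update_of_ne hi.symm, Function.update_self,
    Function.update_idem, Function.comp_apply, Equiv.swap_apply_left, Equiv.swap_apply_right,
    update_update_swap hi]
  refine Rmat_fusion hx₀ hx₁ hr h1 h2 (fun σ σ' τ => F (Function.update (Function.update t.1 i σ) i'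
    σ', Function.update t.2 j τ)) (fun σ σ' τ => ?_) _ _ _
  rw [← hF, update_update_comp_swap hi]

/-- The same identity `Rmat_fusion` serves for the second space, because R is unchanged when its two
tensor factors are exchanged (`Rmat_symm`). -/
lemma preservesAnti_Rsite2 {w : ℂ} (h1 : br x r (1 + w) ≠ 0) (h2 : br x r (2 + w) ≠ 0) {k : ℕ}
    {j j' : Fin k} (hj : j ≠ j') (i : Fin k) :
    PreservesAnti (perm2 (Equiv.swap j j')) (Rsite x r (w + 1) i j * Rsite x r w i j') := by
  refine preservesAnti_of_mulVec (perm2_swap_mul_self j j') fun F hF t => ?_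
  simp only [perm2_mulVec, Equiv.symm_swap] at hF
  rw [perm2_mulVec, Equiv.symm_swap, ← Matrix.mulVec_mulVec]
  simp only [Rsite_mulVec, Function.update_of_ne hj.symm, Function.update_self,
    Function.update_idem, Function.comp_apply, Equiv.swap_apply_left, Equiv.swap_apply_right,
    update_update_swap hj]
  have := Rmat_fusion hx₀ hx₁ hr h1 h2 (fun σ σ' τ => F (Function.update t.1 i τ,
    Function.update (Function.update t.2 j σ) j' σ')) (fun σ σ' τ => by
      rw [← hF, update_update_comp_swap hj]) (t.2 j) (t.2 j') (t.1 i)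
  simp only [Fintype.sum_bool] at this ⊢
  simp only [Rmat_symm x r (w + 1) _ _ (t.1 i), Rmat_symm x r w _ _ _ (t.2 j),
    Rmat_symm x r w _ _ _ (t.2 j')]
  linear_combination this

end Fusion

/-- The product `R_{1 j̄}(u+k-1) ⋯ R_{k j̄}(u)` without the symmetrizer. -/
def rowProd (x r : ℝ) {k : ℕ} (u : ℂ) (j : Fin k) : Matrix (Conf k) (Conf k) ℂ :=
  (List.ofFn fun i : Fin k => Rsite x r (u + (k - 1 - (i : ℕ) : ℂ)) i j).prod

/-- The product of all `k²` elementary `R`-matrices in `R^{(k,k)}(u)`. -/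
def blockProd (x r : ℝ) (k : ℕ) (u : ℂ) : Matrix (Conf k) (Conf k) ℂ :=
  (List.ofFn fun j : Fin k => rowProd x r (u - ((j : ℕ) : ℂ)) j.rev).prod

lemma Generic.sub_natCast {x r : ℝ} {u : ℂ} (hu : Generic x r u) (n : ℕ) :
    Generic x r (u - n) := by
  intro m
  convert hu (m - n) using 2
  push_cast
  ring

section Fusion

variable {x r : ℝ} (hx₀ : 0 < x) (hx₁ : x < 1) (hr : 1 < r)
include hx₀ hx₁ hr

lemma preservesAnti_rowProd {k : ℕ} {u : ℂ} (hu : Generic x r u) (j : Fin k) (i : ℕ)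
    (hi : i + 1 < k) :
    PreservesAnti (perm1 (Equiv.swap (⟨i, by omega⟩ : Fin k) ⟨i + 1, hi⟩)) (rowProd x r u j) := by
  refine PreservesAnti.ofFn_prod (perm1_swap_mul_self _ _) _ i hi ?_ fun l h1 h2 =>
    Rsite_commute_perm1 x r _ (fun h => h1 (congrArg Fin.val h)) (fun h => h2 (congrArg Fin.val h))
  have e : u + (k - 1 - (i : ℕ) : ℂ) = u + (k - 1 - ((i + 1 : ℕ) : ℂ)) + 1 := by push_cast; ring
  simp only
  rw [e]
  refine preservesAnti_Rsite1 hx₀ hx₁ hr ?_ ?_ (by simp) j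
  · convert hu (k - 1 - i) using 2; push_cast; ring
  · convert hu (k - i) using 2; push_cast; ring

lemma preservesAnti_blockProd1 {k : ℕ} {u : ℂ} (hu : Generic x r u) (i : ℕ) (hi : i + 1 < k) :
    PreservesAnti (perm1 (Equiv.swap (⟨i, by omega⟩ : Fin k) ⟨i + 1, hi⟩)) (blockProd x r k u) := by
  refine PreservesAnti.list_prod (perm1_swap_mul_self _ _) _ fun Y hY => ?_
  obtain ⟨l, rfl⟩ := List.mem_ofFn.mp hY
  exact preservesAnti_rowProd hx₀ hx₁ hr (hu.sub_natCast _) _ i hi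

lemma preservesAnti_blockProd2 {k : ℕ} {u : ℂ} (hu : Generic x r u) (p : ℕ) (hp : p + 1 < k) :
    PreservesAnti (perm2 (Equiv.swap (⟨p, by omega⟩ : Fin k) ⟨p + 1, hp⟩)) (blockProd x r k u) := by
  have hP := perm2_swap_mul_self (⟨p, by omega⟩ : Fin k) ⟨p + 1, hp⟩
  -- The rows are multiplied in decreasing order of their place in the second space, so places p+1
  -- and p occur at the positions k-2-p and k-1-p of the list.
  refine PreservesAnti.ofFn_prod hP _ (k - 2 - p) (by omega) ?_ fun l h1 h2 => ?_
  · have r1 : Fin.rev (⟨k - 2 - p, by omega⟩ : Fin k) = ⟨p + 1, hp⟩ := by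
      ext; simp only [Fin.val_rev]; omega
    have r2 : Fin.rev (⟨k - 2 - p + 1, by omega⟩ : Fin k) = ⟨p, by omega⟩ := by
      ext; simp only [Fin.val_rev]; omega
    simp only [r1, r2]
    -- Factors of the two rows in different columns commute; interleaving the rows brings the two
    -- factors of each column together as R(w+1)R(w).
    rw [rowProd, rowProd, ofFn_prod_mul_ofFn_prod]
    · refine PreservesAnti.list_prod hP _ fun Y hY => ?_
      obtain ⟨l, rfl⟩ := List.mem_ofFn.mp hY
      have e : u - ((k - 2 - p : ℕ) : ℂ) + (k - 1 - (l : ℕ) : ℂ) =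
        u - ((k - 2 - p + 1 : ℕ) : ℂ) + (k - 1 - (l : ℕ) : ℂ) + 1 := by push_cast; ring
      rw [e, Equiv.swap_comm]
      refine preservesAnti_Rsite2 hx₀ hx₁ hr ?_ ?_ (by simp) l
      · convert hu (1 - (k - 2 - p + 1 : ℕ) + (k - 1 - (l : ℕ))) using 2; push_cast; ring
      · convert hu (2 - (k - 2 - p + 1 : ℕ) + (k - 1 - (l : ℕ))) using 2; push_cast; ring
    · exact fun i j hij => Rsite_commute x r _ _ hij (by simp)
  · refine Commute.list_prod_right _ _ fun Y hY => ?_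
    obtain ⟨i, rfl⟩ := List.mem_ofFn.mp hY
    refine Rsite_commute_perm2 x r _ (fun h => h2 ?_) (fun h => h1 ?_) <;>
    · have := congrArg Fin.val h
      simp only [Fin.val_rev] at this
      omega

end Fusion

/-! ### Components of symmetric tensors -/

/-- The sum of the entries of a tensor over the configurations with `e` and `f` plus signs. -/
def weightSum {k : ℕ} (e f : ℕ) (F : Conf k → ℂ) : ℂ :=
  ∑ t : Conf k, if plus t.1 = e ∧ plus t.2 = f then F t else 0

lemma plus_comp {k : ℕ} (s : Fin k → Bool) (g : Equiv.Perm (Fin k)) : plus (s ∘ g) = plus s := by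
  unfold plus
  refine Finset.card_bij (fun i _ => g i) (by simp) (by simp) fun i hi => ⟨g.symm i, ?_⟩
  simpa using hi

lemma weightSum_perm1 {k : ℕ} (e f : ℕ) (g : Equiv.Perm (Fin k)) (F : Conf k → ℂ) :
    weightSum e f ((perm1 g).mulVec F) = weightSum e f F := by
  unfold weightSum
  simp only [perm1_mulVec]
  refine Fintype.sum_equiv ((Equiv.arrowCongr g (Equiv.refl Bool)).prodCongr (Equiv.refl _)) _ _
    fun t => ?_
  simp [Equiv.arrowCongr, plus_comp]
  rfl

lemma weightSum_perm2 {k : ℕ} (e f : ℕ) (g : Equiv.Perm (Fin k)) (F : Conf k → ℂ) :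
    weightSum e f ((perm2 g).mulVec F) = weightSum e f F := by
  unfold weightSum
  simp only [perm2_mulVec]
  refine Fintype.sum_equiv ((Equiv.refl _).prodCongr (Equiv.arrowCongr g (Equiv.refl Bool))) _ _
    fun t => ?_
  simp [Equiv.arrowCongr, plus_comp]
  rfl

lemma weightSum_add {k : ℕ} (e f : ℕ) (F G : Conf k → ℂ) :
    weightSum e f (F + G) = weightSum e f F + weightSum e f G := by
  unfold weightSum
  rw [← Finset.sum_add_distrib]
  refine Finset.sum_congr rfl fun t _ => ?_
  split_ifs <;> simp

lemma weightSum_smul {k : ℕ} (e f : ℕ) (c : ℂ) (F : Conf k → ℂ) :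
    weightSum e f (c • F) = c * weightSum e f F := by
  unfold weightSum
  rw [Finset.mul_sum]
  refine Finset.sum_congr rfl fun t _ => ?_
  split_ifs <;> simp

/-- `weightSum` as a linear form. -/
def weightForm (k e f : ℕ) : (Conf k → ℂ) →ₗ[ℂ] ℂ where
  toFun := weightSum e f
  map_add' := weightSum_add e f
  map_smul' := weightSum_smul e f

lemma weightForm_symmetrizer {k : ℕ} (e f : ℕ) {ρ : Equiv.Perm (Fin k) → Matrix (Conf k) (Conf k) ℂ}
    (hρ : ∀ g F, weightSum e f ((ρ g).mulVec F) = weightSum e f F) (F : Conf k → ℂ) :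
    weightForm k e f (((k.factorial : ℂ)⁻¹ • ∑ g, ρ g).mulVec F) = weightForm k e f F := by
  have hρ' : ∀ g, weightForm k e f ((ρ g).mulVec F) = weightForm k e f F := fun g => hρ g F
  rw [Matrix.smul_mulVec, Matrix.sum_mulVec, map_smul, map_sum,
    Finset.sum_congr rfl fun g _ => hρ' g, Finset.sum_const, Finset.card_univ,
    Fintype.card_perm, Fintype.card_fin, ← Nat.cast_smul_eq_nsmul ℂ, smul_smul,
    inv_mul_cancel₀ (by exact_mod_cast k.factorial_ne_zero), one_smul]

lemma weightForm_sym1 {k : ℕ} (e f : ℕ) (F : Conf k → ℂ) :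
    weightForm k e f ((sym1 k).mulVec F) = weightForm k e f F := by
  rw [sym1_eq, weightForm_symmetrizer e f fun g F => weightSum_perm1 e f g F]

lemma weightForm_sym2 {k : ℕ} (e f : ℕ) (F : Conf k → ℂ) :
    weightForm k e f ((sym2 k).mulVec F) = weightForm k e f F := by
  rw [sym2_eq, weightForm_symmetrizer e f fun g F => weightSum_perm2 e f g F]

/-- Since S X S = S X, the projection in front of each factor is absorbed by the projection on its
left, and only the leftmost survives. -/
lemma mul_list_prod_map {A : Type*} [Monoid A] {S : A} (hS : S * S = S) :
    ∀ l : List A, (∀ X ∈ l, S * X * S = S * X) → S * (l.map (S * ·)).prod = S * l.prod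
  | [], _ => by simp
  | X :: l, h => by
    have hX := h X (by simp)
    have ih := mul_list_prod_map hS l fun Y hY => h Y (by simp [hY])
    rw [List.map_cons, List.prod_cons, List.prod_cons, ← mul_assoc, ← mul_assoc S S, hS, ← hX,
      mul_assoc (S * X), ih, ← mul_assoc, hX, mul_assoc]

/-- All symmetrizers, those inside the fused matrix and those on the argument, are absorbed into one
pair on the left, and `weightForm` does not see that pair. Matrix elements of the fused R-matrix can
therefore be computed from the bare product. -/
lemma weightForm_Rkk {x r : ℝ} (hx₀ : 0 < x) (hx₁ : x < 1) (hr : 1 < r) {k : ℕ} {u : ℂ}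
    (hu : Generic x r u) (e f : ℕ) (F : Conf k → ℂ) :
    weightForm k e f ((Rkk x r k u).mulVec ((sym1 k * sym2 k).mulVec F)) =
      weightForm k e f ((blockProd x r k u).mulVec F) := by
  have s1 := symmetrizer_mul_self perm1_one perm1_mul (sym1_eq k)
  have hrow : ∀ (n : ℕ) (j : Fin k), sym1 k * rowProd x r (u - n) j * sym1 k =
      sym1 k * rowProd x r (u - n) j := fun n j =>
    symmetrizer_mul_mul perm1_one perm1_mul (sym1_eq k) fun i hi =>
      preservesAnti_rowProd hx₀ hx₁ hr (hu.sub_natCast n) j i hi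
  have h1 := symmetrizer_mul_mul perm1_one perm1_mul (sym1_eq k) fun i hi =>
    preservesAnti_blockProd1 hx₀ hx₁ hr hu i hi
  have h2 := symmetrizer_mul_mul perm2_one perm2_mul (sym2_eq k) fun i hi =>
    preservesAnti_blockProd2 hx₀ hx₁ hr hu i hi
  have h3 := mul_list_prod_map s1 (List.ofFn fun j : Fin k => rowProd x r (u - ((j : ℕ) : ℂ)) j.rev)
    fun X hX => by
      obtain ⟨l, rfl⟩ := List.mem_ofFn.mp hX
      exact hrow _ _
  rw [List.map_ofFn] at h3
  have hc := (sym1_commute_sym2 k).eq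
  have h4 : sym1 k * sym2 k * (Rkk x r k u * (sym1 k * sym2 k)) =
      sym1 k * sym2 k * blockProd x r k u := by
    have s2 := symmetrizer_mul_self perm2_one perm2_mul (sym2_eq k)
    have h5 : Rkk x r k u = sym2 k * (List.ofFn ((fun X => sym1 k * X) ∘ fun j : Fin k =>
      rowProd x r (u - ((j : ℕ) : ℂ)) j.rev)).prod := rfl
    have h6 : sym1 k * Rkk x r k u = sym2 k * (sym1 k * blockProd x r k u) := by
      rw [h5, ← mul_assoc, hc, mul_assoc, h3, blockProd]
    calc sym1 k * sym2 k * (Rkk x r k u * (sym1 k * sym2 k))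
        = sym2 k * (sym1 k * Rkk x r k u) * (sym1 k * sym2 k) := by
          rw [hc]; simp only [mul_assoc]
      _ = sym2 k * sym2 k * (sym1 k * blockProd x r k u * sym1 k) * sym2 k := by
          rw [h6]; simp only [mul_assoc]
      _ = sym1 k * (sym2 k * blockProd x r k u * sym2 k) := by
          rw [s2, h1, ← mul_assoc (sym2 k), ← hc]; simp only [mul_assoc]
      _ = sym1 k * sym2 k * blockProd x r k u := by rw [h2, ← mul_assoc]
  have h7 : ∀ G : Conf k → ℂ, weightForm k e f ((sym1 k * sym2 k).mulVec G) =
      weightForm k e f G := fun G => by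
    rw [← Matrix.mulVec_mulVec, weightForm_sym1, weightForm_sym2]
  rw [← h7, ← h7 ((blockProd x r k u).mulVec F), Matrix.mulVec_mulVec, Matrix.mulVec_mulVec,
    Matrix.mulVec_mulVec, mul_assoc, h4]

/-! ### The basis of symmetric tensors -/

lemma exists_perm_of_plus_eq {k : ℕ} {s t : Fin k → Bool} (h : plus s = plus t) :
    ∃ g : Equiv.Perm (Fin k), s = t ∘ g := by
  have h1 : Fintype.card {i // s i = true} = Fintype.card {i // t i = true} := by
    rw [Fintype.card_subtype, Fintype.card_subtype]; exact h
  have h2 : Fintype.card {i // ¬ s i = true} = Fintype.card {i // ¬ t i = true} := by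
    rw [Fintype.card_subtype_compl, Fintype.card_subtype_compl, h1]
  refine ⟨Equiv.subtypeCongr (Fintype.equivOfCardEq h1) (Fintype.equivOfCardEq h2), ?_⟩
  ext i
  by_cases hi : s i = true
  · simp only [Function.comp_apply, Equiv.subtypeCongr, Equiv.trans_apply,
      Equiv.sumCompl_symm_apply_of_pos (p := fun i => s i = true) hi, Equiv.sumCongr_apply,
      Sum.map_inl, Equiv.sumCompl_apply_inl]
    rw [hi, (Fintype.equivOfCardEq h1 ⟨i, hi⟩).2]
  · simp only [Function.comp_apply, Equiv.subtypeCongr, Equiv.trans_apply,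
      Equiv.sumCompl_symm_apply_of_neg (p := fun i => s i = true) hi, Equiv.sumCongr_apply,
      Sum.map_inr, Equiv.sumCompl_apply_inr]
    have := (Fintype.equivOfCardEq h2 ⟨i, hi⟩).2
    rw [Bool.not_eq_true] at hi this
    rw [hi, this]

lemma plus_le {k : ℕ} (s : Fin k → Bool) : plus s ≤ k :=
  (Finset.card_filter_le _ _).trans (by simp)

lemma plus_canon {k e : ℕ} (h : e ≤ k) : plus (canon k e) = e := by
  simp only [plus, canon, decide_eq_true_eq]
  rw [Fin.card_filter_val_lt, min_eq_right h]

/-- The components of the symmetrization of a tensor in the basis `v^{(k)}_e` are the sums of its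
entries over the configurations with `e` plus signs. -/
lemma sum_vSym {k : ℕ} (A : (Fin k → Bool) → ℂ) (t : Fin k → Bool) :
    ∑ e : Fin (k + 1), (∑ s, if plus s = e then A s else 0) * vSym k e t =
      (k.factorial : ℂ)⁻¹ * ∑ g : Equiv.Perm (Fin k), A (t ∘ g.symm) := by
  have h1 : ∀ s : Fin k → Bool, vSym k (plus s) t =
      (k.factorial : ℂ)⁻¹ * ∑ g : Equiv.Perm (Fin k), if t = s ∘ g then 1 else 0 := by
    intro s
    obtain ⟨h, hh⟩ := exists_perm_of_plus_eq (plus_canon (plus_le s))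
    rw [vSym, hh]
    congr 1
    exact Fintype.sum_equiv (Equiv.mulLeft h) _ _ fun g => rfl
  calc ∑ e : Fin (k + 1), (∑ s, if plus s = e then A s else 0) * vSym k e t
      = ∑ s, ∑ e : Fin (k + 1), (if plus s = e then A s * vSym k e t else 0) := by
        rw [Finset.sum_comm]
        refine Finset.sum_congr rfl fun e _ => ?_
        rw [Finset.sum_mul]
        refine Finset.sum_congr rfl fun s _ => ?_
        split_ifs <;> simp
    _ = ∑ s, A s * vSym k (plus s) t := by
        refine Finset.sum_congr rfl fun s _ => ?_
        rw [Finset.sum_eq_single ⟨plus s, Nat.lt_succ_of_le (plus_le s)⟩]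
        · simp
        · intro e _ he
          rw [if_neg]
          exact fun h => he (Fin.ext h.symm)
        · simp
    _ = (k.factorial : ℂ)⁻¹ * ∑ g : Equiv.Perm (Fin k), ∑ s, if t = s ∘ g then A s else 0 := by
        rw [Finset.sum_comm, Finset.mul_sum]
        refine Finset.sum_congr rfl fun s _ => ?_
        rw [h1, mul_left_comm, Finset.mul_sum]
        congr 2
        funext g
        split_ifs <;> simp
    _ = _ := by
        congr 1
        refine Finset.sum_congr rfl fun g _ => ?_
        rw [Finset.sum_eq_single (t ∘ g.symm)]
        · rw [if_pos]; ext i; simp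
        · intro s _ hs
          rw [if_neg]
          rintro rfl
          exact hs (by ext i; simp)
        · simp

lemma sym1_mul_sym2_mulVec {k : ℕ} (A B : (Fin k → Bool) → ℂ) :
    (sym1 k * sym2 k).mulVec (fun t => A t.1 * B t.2) = fun t =>
      ((k.factorial : ℂ)⁻¹ * ∑ g : Equiv.Perm (Fin k), A (t.1 ∘ g.symm)) *
        ((k.factorial : ℂ)⁻¹ * ∑ g : Equiv.Perm (Fin k), B (t.2 ∘ g.symm)) := by
  funext t
  rw [← Matrix.mulVec_mulVec, sym1_eq, sym2_eq]
  simp only [Matrix.smul_mulVec, Matrix.sum_mulVec, Pi.smul_apply, Finset.sum_apply, perm1_mulVec,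
    perm2_mulVec, smul_eq_mul, Matrix.mulVec_smul]
  simp only [← Finset.mul_sum, ← Finset.sum_mul]
  ring

/-- Fused matrix elements, contracted with the components of two tensors. -/
lemma sum_RkkComp {x r : ℝ} (hx₀ : 0 < x) (hx₁ : x < 1) (hr : 1 < r) {k : ℕ} {u : ℂ}
    (hu : Generic x r u) (A B : (Fin k → Bool) → ℂ) (f₁ f₂ : Fin (k + 1)) :
    ∑ e₁ : Fin (k + 1), ∑ e₂ : Fin (k + 1), RkkComp x r k u e₁ e₂ f₁ f₂ *
      ((∑ s, if plus s = e₁ then A s else 0) * ∑ s, if plus s = e₂ then B s else 0) =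
    weightForm k f₁ f₂ ((blockProd x r k u).mulVec fun t => A t.1 * B t.2) := by
  rw [← weightForm_Rkk hx₀ hx₁ hr hu, sym1_mul_sym2_mulVec]
  simp only [← sum_vSym]
  have h1 : (fun t : Conf k => (∑ e : Fin (k + 1), (∑ s, if plus s = e then A s else 0) *
        vSym k e t.1) * ∑ e : Fin (k + 1), (∑ s, if plus s = e then B s else 0) * vSym k e t.2) =
      ∑ e₁ : Fin (k + 1), ∑ e₂ : Fin (k + 1), ((∑ s, if plus s = e₁ then A s else 0) *
        ∑ s, if plus s = e₂ then B s else 0) • fun t : Conf k => vSym k e₁ t.1 * vSym k e₂ t.2 := by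
    funext t
    rw [Finset.sum_mul_sum, Finset.sum_apply]
    refine Finset.sum_congr rfl fun e₁ _ => ?_
    rw [Finset.sum_apply]
    refine Finset.sum_congr rfl fun e₂ _ => ?_
    rw [Pi.smul_apply, smul_eq_mul]
    ring
  rw [h1]
  simp only [Matrix.mulVec_sum, map_sum, Matrix.mulVec_smul, map_smul, smul_eq_mul]
  refine Finset.sum_congr rfl fun e₁ _ => Finset.sum_congr rfl fun e₂ _ => ?_
  rw [mul_comm]
  rfl

/-! ### Paths of heights -/

/-- The sum over paths with `n` steps `±1` from `a` of the product of the step weights `w i`,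
starting with `w i₀`, times a function of the end point. -/
def pathSum (w : ℕ → ℤ → ℤ → ℂ) : ℕ → ℕ → ℤ → (ℤ → ℂ) → ℂ
  | 0, _, a, F => F a
  | n + 1, i, a, F => ∑ σ, w i a (a + step σ) * pathSum w n (i + 1) (a + step σ) F

lemma walk_zero {k : ℕ} (a : ℤ) (s : Fin k → Bool) : walk a s 0 = a := by simp [walk]

lemma walk_cons_succ {k : ℕ} (a : ℤ) (σ : Bool) (s : Fin k → Bool) (i : ℕ) :
    walk a (Fin.cons σ s : Fin (k + 1) → Bool) (i + 1) = walk (a + step σ) s i := by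
  simp only [walk, Fin.sum_univ_succ, Fin.cons_zero, Fin.cons_succ, Fin.val_succ, Fin.val_zero,
    Nat.succ_lt_succ_iff, Nat.zero_lt_succ, if_true, step, add_assoc]

lemma walk_succ {k : ℕ} (a : ℤ) (s : Fin k → Bool) (i : Fin k) :
    walk a s (i + 1) = walk a s i + step (s i) := by
  have h : ∀ j : Fin k, (if (j : ℕ) < i + 1 then (if s j then (1 : ℤ) else -1) else 0) =
      (if (j : ℕ) < i then (if s j then (1 : ℤ) else -1) else 0) +
        if j = i then step (s i) else 0 := by
    intro j
    rcases lt_trichotomy (j : ℕ) i with h | h | h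
    · have : j ≠ i := fun e => by rw [e] at h; omega
      simp [h, this, Nat.lt_succ_of_lt h]
    · have : j = i := Fin.ext h
      subst this
      simp [step]
    · have h1 : j ≠ i := fun e => by rw [e] at h; omega
      have h2 : ¬ (j : ℕ) < i + 1 := by omega
      have h3 : ¬ (j : ℕ) < i := by omega
      simp [h1, h2, h3]
  simp only [walk, h, Finset.sum_add_distrib]
  simp [add_assoc]

lemma pathSum_eq (w : ℕ → ℤ → ℤ → ℂ) (F : ℤ → ℂ) : ∀ (n i : ℕ) (a : ℤ), pathSum w n i a F =
    ∑ q : Fin n → Bool, (∏ l : Fin n, w (i + l) (walk a q l) (walk a q (l + 1))) * F (walk a q n)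
  | 0, i, a => by simp [pathSum, walk]
  | n + 1, i, a => by
    rw [pathSum, ← (Fin.consEquiv fun _ : Fin (n + 1) => Bool).sum_comp, Fintype.sum_prod_type]
    refine Finset.sum_congr rfl fun σ _ => ?_
    rw [pathSum_eq w F n, Finset.mul_sum]
    refine Finset.sum_congr rfl fun q _ => ?_
    have e : ∀ l : ℕ, i + 1 + l = i + (l + 1) := fun l => by ring
    simp only [Fin.consEquiv, Equiv.coe_fn_mk, Fin.prod_univ_succ, Fin.val_zero, walk_zero,
      Fin.val_succ, walk_cons_succ, add_zero, e]
    rw [mul_assoc]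

lemma pathSum_succ (w : ℕ → ℤ → ℤ → ℂ) : ∀ (n i : ℕ) (a : ℤ) (F : ℤ → ℂ),
    pathSum w (n + 1) i a F = pathSum w n i a fun b => ∑ σ, w (i + n) b (b + step σ) * F (b + step σ)
  | 0, i, a, F => rfl
  | n + 1, i, a, F => by
    rw [pathSum, pathSum]
    refine Finset.sum_congr rfl fun σ _ => ?_
    rw [pathSum_succ w n, show i + 1 + n = i + (n + 1) by ring]

lemma pathSum_congr {w w' : ℕ → ℤ → ℤ → ℂ} (F : ℤ → ℂ) : ∀ (n i : ℕ) (a : ℤ),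
    (∀ l, i ≤ l → l < i + n → w l = w' l) → pathSum w n i a F = pathSum w' n i a F
  | 0, _, _, _ => rfl
  | n + 1, i, a, h => by
    rw [pathSum, pathSum]
    refine Finset.sum_congr rfl fun σ _ => ?_
    rw [h i le_rfl (by omega), pathSum_congr F n (i + 1) _ fun l h1 h2 => h l (by omega) (by omega)]

/-- The function is only evaluated at heights within n of the start. This removes configurations
whose prescribed end is unreachable, for which no condition [n] ≠ 0 is available. -/
lemma pathSum_eq_zero (w : ℕ → ℤ → ℤ → ℂ) {F : ℤ → ℂ} : ∀ (n i : ℕ) (a : ℤ),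
    (∀ b, |b - a| ≤ n → F b = 0) → pathSum w n i a F = 0
  | 0, _, a, h => h a (by simp)
  | n + 1, i, a, h => by
    rw [pathSum]
    refine Finset.sum_eq_zero fun σ _ => ?_
    rw [pathSum_eq_zero w n, mul_zero]
    intro b hb
    refine h b ?_
    rw [abs_le] at hb ⊢
    cases σ <;> simp only [step, if_true, if_false, Bool.false_eq_true] at hb <;> push_cast <;>
      constructor <;> linarith [hb.1, hb.2]

lemma walk_end {k : ℕ} (a : ℤ) (s : Fin k → Bool) : walk a s k = a + 2 * plus s - k := by
  have h : (plus s : ℤ) = ∑ i, if s i = true then 1 else 0 := by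
    rw [plus, Finset.card_filter]; push_cast; rfl
  have h2 : (k : ℤ) = ∑ _i : Fin k, 1 := by simp
  have h3 : walk a s k = a + ∑ i, ((2 : ℤ) * (if s i = true then 1 else 0) - 1) := by
    rw [walk]
    congr 1
    refine Finset.sum_congr rfl fun i _ => ?_
    rw [if_pos i.2]
    split_ifs <;> norm_num
  rw [h3, Finset.sum_sub_distrib, ← Finset.mul_sum, ← h, ← h2]
  ring

lemma adm_iff {k : ℕ} {a b : ℤ} : Adm k a b ↔ ∃ s : Fin k → Bool, walk b s k = a := by
  constructor
  · rintro ⟨j, hj⟩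
    refine ⟨canon k j, ?_⟩
    rw [walk_end, plus_canon (by omega)]
    omega
  · rintro ⟨s, hs⟩
    rw [walk_end] at hs
    exact ⟨⟨plus s, Nat.lt_succ_of_le (plus_le s)⟩, by simp only; omega⟩

lemma Adm.symm {k : ℕ} {a b : ℤ} (h : Adm k a b) : Adm k b a := by
  obtain ⟨j, hj⟩ := h
  refine ⟨j.rev, ?_⟩
  rw [Fin.val_rev]
  omega

lemma Adm.abs_le {k : ℕ} {a b : ℤ} (h : Adm k a b) : |a - b| ≤ k := by
  obtain ⟨j, hj⟩ := h
  rw [_root_.abs_le]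
  omega

/-- The reference path is a path. -/
lemma refPath_eq_walk {k : ℕ} {a b : ℤ} (h : Adm k a b) :
    ∃ s : Fin k → Bool, walk a s k = b ∧ ∀ i ≤ k, refPath k a b i = walk a s i := by
  obtain ⟨j, hj⟩ := h.symm
  have key : ∀ i ≤ k, refPath k a b i = walk a (canon k j) i := by
    intro i
    induction i with
    | zero =>
      intro _
      rw [walk_zero, refPath]
      omega
    | succ i ih =>
      intro hi
      have := walk_succ a (canon k j) ⟨i, hi⟩
      simp only at this
      rw [this, ← ih (by omega), refPath, refPath]
      by_cases h : i < j
      · simp only [canon, h, decide_true, step, if_true]; push_cast; omega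
      · simp only [canon, h, decide_false, step, if_false, Bool.false_eq_true]; push_cast; omega
  refine ⟨canon k j, ?_, key⟩
  rw [walk_end, plus_canon (by omega)]
  omega

lemma refPath_zero {k : ℕ} {a b : ℤ} (h : Adm k a b) : refPath k a b 0 = a := by
  obtain ⟨s, -, hs⟩ := refPath_eq_walk h
  rw [hs 0 (by omega), walk_zero]

lemma refPath_end {k : ℕ} {a b : ℤ} (h : Adm k a b) : refPath k a b k = b := by
  obtain ⟨s, h1, hs⟩ := refPath_eq_walk h
  rw [hs k le_rfl, h1]

lemma refPath_succ {k : ℕ} {a b : ℤ} (h : Adm k a b) {i : ℕ} (hi : i < k) :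
    ∃ σ, refPath k a b (i + 1) = refPath k a b i + step σ := by
  obtain ⟨s, -, hs⟩ := refPath_eq_walk h
  exact ⟨s ⟨i, hi⟩, by rw [hs _ (by omega), hs _ (by omega), ← walk_succ a s ⟨i, hi⟩]⟩

lemma refPath_abs_left {k : ℕ} {a b : ℤ} (h : Adm k a b) {i : ℕ} :
    |refPath k a b i - a| ≤ i := by
  have := h.abs_le
  rw [abs_le] at this ⊢
  rw [refPath]
  obtain ⟨j, hj⟩ := h
  omega

lemma refPath_abs_right {k : ℕ} {a b : ℤ} (h : Adm k a b) {i : ℕ} (hi : i ≤ k) :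
    |refPath k a b i - b| ≤ k - i := by
  have := h.abs_le
  rw [abs_le] at this ⊢
  rw [refPath]
  obtain ⟨j, hj⟩ := h
  omega

/-! ### Independence of the symmetrized intertwining vectors of the path -/

/-- The tensor `ψ(u+k-1)^{p_0}_{p_1} ⊗ ⋯ ⊗ ψ(u)^{p_{k-1}}_{p_k}`. -/
def pathVec (x r : ℝ) {k : ℕ} (u : ℂ) (p : ℕ → ℤ) (s : Fin k → Bool) : ℂ :=
  ∏ i : Fin k, psi x r (s i) (u + (k - 1 - (i : ℕ) : ℂ)) (p i) (p (i + 1))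

/-- The generating polynomial of the components of `ψ(u)^a_b`. -/
def psiPoly (x r : ℝ) (u : ℂ) (a b : ℤ) : Polynomial ℂ :=
  Polynomial.C (psi x r true u a b) * Polynomial.X + Polynomial.C (psi x r false u a b)

/-- Components of a symmetrized tensor are coefficients of a product of linear polynomials, so that
symmetrization becomes commutativity of polynomial multiplication. -/
lemma coeff_prod_psiPoly (x r : ℝ) {k : ℕ} (u : ℂ) (p : ℕ → ℤ) (e : ℕ) :
    (∏ i : Fin k, psiPoly x r (u + (k - 1 - (i : ℕ) : ℂ)) (p i) (p (i + 1))).coeff e =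
      ∑ s : Fin k → Bool, if plus s = e then pathVec x r u p s else 0 := by
  have h : ∀ i : Fin k, psiPoly x r (u + (k - 1 - (i : ℕ) : ℂ)) (p i) (p (i + 1)) =
      ∑ b, Polynomial.C (psi x r b (u + (k - 1 - (i : ℕ) : ℂ)) (p i) (p (i + 1))) *
        Polynomial.X ^ (if b = true then 1 else 0) := by
    intro i; simp [psiPoly]
  simp only [h]
  rw [Finset.prod_univ_sum, Fintype.piFinset_univ, Polynomial.finsetSum_coeff]
  refine Finset.sum_congr rfl fun s _ => ?_
  rw [Finset.prod_mul_distrib, Finset.prod_pow_eq_pow_sum, ← Finset.card_filter, ← map_prod,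
    Polynomial.coeff_C_mul_X_pow]
  simp only [pathVec, plus, eq_comm]

/-- The product of the generating polynomials along a list of steps. -/
def listPoly (x r : ℝ) (u : ℂ) : ℤ → List Bool → Polynomial ℂ
  | _, [] => 1
  | a, σ :: l => psiPoly x r (u + l.length) a (a + step σ) * listPoly x r u (a + step σ) l

/-- By `psi_shift`, exchanging two neighbouring opposite steps only exchanges two polynomial
factors. -/
lemma listPoly_perm (x r : ℝ) (u : ℂ) {l l' : List Bool} (h : l.Perm l') :
    ∀ a, listPoly x r u a l = listPoly x r u a l' := by
  induction h with
  | nil => intro a; rfl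
  | cons σ h ih => intro a; rw [listPoly, listPoly, ih, h.length_eq]
  | swap σ τ l =>
    intro a
    by_cases hst : σ = τ
    · rw [hst]
    · obtain rfl : τ = !σ := by cases σ <;> cases τ <;> simp_all
      simp only [listPoly, List.length_cons]
      have e : ∀ σ : Bool, psiPoly x r (u + (l.length + 1 : ℕ)) a (a + step σ) =
          psiPoly x r (u + l.length) (a + step (!σ)) (a + step (!σ) + step σ) := by
        intro σ
        simp only [psiPoly, Nat.cast_add, Nat.cast_one, ← add_assoc, psi_shift]
      rw [e, e, Bool.not_not, show a + step (!σ) + step σ = a + step σ + step (!σ) by ring]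
      ring
  | trans _ _ ih₁ ih₂ => intro a; rw [ih₁, ih₂]

lemma listPoly_ofFn (x r : ℝ) (u : ℂ) : ∀ {k : ℕ} (a : ℤ) (s : Fin k → Bool),
    listPoly x r u a (List.ofFn s) = ∏ i : Fin k, psiPoly x r (u + (k - 1 - (i : ℕ) : ℂ))
      (walk a s i) (walk a s (i + 1))
  | 0, a, s => by simp [listPoly]
  | k + 1, a, s => by
    obtain ⟨σ, s', rfl⟩ : ∃ (σ : Bool) (s' : Fin k → Bool), s = Fin.cons σ s' :=
      ⟨s 0, Fin.tail s, (Fin.cons_self_tail s).symm⟩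
    have e0 : u + (((k + 1 : ℕ) : ℂ) - 1 - ((0 : ℕ) : ℂ)) = u + (k : ℂ) := by push_cast; ring
    have e1 : ∀ i : ℕ, u + (((k + 1 : ℕ) : ℂ) - 1 - ((i + 1 : ℕ) : ℂ)) = u + (k - 1 - (i : ℂ)) := by
      intro i; push_cast; ring
    rw [List.ofFn_cons, listPoly, Fin.prod_univ_succ, listPoly_ofFn, List.length_ofFn]
    simp only [Fin.val_zero, Fin.val_succ, walk_cons_succ, walk_zero, e0, e1]

/-- The symmetrized tensor of intertwining vectors along a path depends only on its end points. -/
lemma sum_pathVec_walk (x r : ℝ) {k : ℕ} (u : ℂ) (a : ℤ) {s s' : Fin k → Bool}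
    (h : walk a s k = walk a s' k) (e : ℕ) :
    ∑ t : Fin k → Bool, (if plus t = e then pathVec x r u (walk a s) t else 0) =
      ∑ t : Fin k → Bool, if plus t = e then pathVec x r u (walk a s') t else 0 := by
  rw [← coeff_prod_psiPoly, ← coeff_prod_psiPoly, ← listPoly_ofFn, ← listPoly_ofFn]
  rw [walk_end, walk_end] at h
  obtain ⟨g, rfl⟩ := exists_perm_of_plus_eq (s := s) (t := s') (by omega)
  rw [listPoly_perm x r u (Equiv.Perm.ofFn_comp_perm g s')]

/-- The tensor of intertwining vectors along the reference path. -/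
def refVec (x r : ℝ) (k : ℕ) (u : ℂ) (a b : ℤ) (s : Fin k → Bool) : ℂ :=
  if Adm k a b then pathVec x r u (refPath k a b) s else 0

lemma psiK_eq (x r : ℝ) (k : ℕ) (e : Fin (k + 1)) (u : ℂ) (a b : ℤ) :
    psiK x r k e u a b = ∑ s : Fin k → Bool, if plus s = e then refVec x r k u a b s else 0 := by
  unfold psiK refVec pathVec
  split_ifs <;> simp

lemma sum_refVec (x r : ℝ) {k : ℕ} (u : ℂ) (a : ℤ) (s : Fin k → Bool) (e : ℕ) :
    ∑ t : Fin k → Bool, (if plus t = e then refVec x r k u a (walk a s k) t else 0) =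
      ∑ t : Fin k → Bool, if plus t = e then pathVec x r u (walk a s) t else 0 := by
  have hA : Adm k a (walk a s k) := (adm_iff.mpr ⟨s, rfl⟩).symm
  obtain ⟨s', h1, h2⟩ := refPath_eq_walk hA
  have h3 : ∀ t : Fin k → Bool, refVec x r k u a (walk a s k) t = pathVec x r u (walk a s') t := by
    intro t
    rw [refVec, if_pos hA, pathVec, pathVec]
    refine Finset.prod_congr rfl fun i _ => ?_
    rw [h2 i (by omega), h2 (i + 1) (by omega)]
  simp only [h3]
  exact sum_pathVec_walk x r u a h1 e

/-! ### The action of the fused `R`-matrix on tensors of intertwining vectors -/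

/-- The rightmost factor acts first and takes F n to F (n-1), and so on down to F 0. Each step need
only hold after applying S: the condition S X S = S X says that X respects equality modulo the
kernel of S. -/
lemma mulVec_ofFn_prod {ι : Type*} [Fintype ι] [DecidableEq ι] {S : Matrix ι ι ℂ} :
    ∀ {n : ℕ} (X : Fin n → Matrix ι ι ℂ) (F : ℕ → ι → ℂ), (∀ i, S * X i * S = S * X i) →
    (∀ i : Fin n, S.mulVec ((X i).mulVec (F (i + 1))) = S.mulVec (F i)) →
    S.mulVec ((List.ofFn X).prod.mulVec (F n)) = S.mulVec (F 0)
  | 0, X, F, _, _ => by simp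
  | n + 1, X, F, hS, hF => by
    have ih := mulVec_ofFn_prod (S := S) (fun i => X i.succ) (fun i => F (i + 1))
      (fun i => hS i.succ) fun i => hF i.succ
    have h0 : S.mulVec ((X 0).mulVec (F 1)) = S.mulVec (F 0) := hF 0
    rw [List.ofFn_succ, List.prod_cons, ← Matrix.mulVec_mulVec, ← h0, Matrix.mulVec_mulVec,
      ← hS, ← Matrix.mulVec_mulVec, ih, Matrix.mulVec_mulVec, hS, ← Matrix.mulVec_mulVec]

/-- The spin at a place given by a natural number. -/
def spin {k : ℕ} (s : Fin k → Bool) (l : ℕ) : Bool := if h : l < k then s ⟨l, h⟩ else false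

lemma spin_val {k : ℕ} (s : Fin k → Bool) (l : Fin k) : spin s l = s l := by simp [spin]

lemma spin_update {k : ℕ} (s : Fin k → Bool) {j : Fin k} (τ : Bool) {l : ℕ} (h : l ≠ j) :
    spin (Function.update s j τ) l = spin s l := by
  unfold spin
  split_ifs with hl
  · rw [Function.update_of_ne]
    intro e
    exact h (congrArg Fin.val e)
  · rfl

/-- A face weight vanishes unless its lower right height is adjacent to both the upper right and the
lower left one. The sum over that height may therefore be parametrized by the step from either
neighbour. -/
lemma sum_step_comm {g : ℤ → ℂ} {a : ℤ} (β δ : Bool)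
    (h : ∀ d, g d ≠ 0 → |d - (a + step β)| = 1 ∧ |d - (a + step δ)| = 1) :
    ∑ γ, g (a + step β + step γ) = ∑ σ, g (a + step δ + step σ) := by
  have h0 : ∀ d, ¬ (|d - (a + step β)| = 1 ∧ |d - (a + step δ)| = 1) → g d = 0 := fun d hd =>
    not_not.mp fun h1 => hd (h d h1)
  cases β <;> cases δ <;> simp only [Fintype.sum_bool, step, if_true, if_false,
    Bool.false_eq_true] at h0 ⊢
  · rw [h0 (a + -1 + -1) (by ring_nf; norm_num), h0 (a + 1 + 1) (by ring_nf; norm_num)]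
    ring_nf
  · rw [h0 (a + -1 + -1) (by ring_nf; norm_num), h0 (a + 1 + 1) (by ring_nf; norm_num)]
    ring_nf

lemma faceW_ne_zero {x r : ℝ} {a b d c : ℤ} {u : ℂ} (h : faceW x r a b d c u ≠ 0) :
    |c - b| = 1 ∧ |c - d| = 1 := by
  unfold faceW at h
  split_ifs at h with h1
  all_goals first
    | exact absurd rfl h
    | rw [Int.abs_eq_natAbs, Int.abs_eq_natAbs]; exact ⟨by omega, by omega⟩

section Action

variable {x r : ℝ} (hx₀ : 0 < x) (hx₁ : x < 1) (hr : 1 < r)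
include hx₀ hx₁ hr

/-- The weight of a path of lower heights in a row with upper heights `p`. -/
def rowStep (x r : ℝ) {k : ℕ} (u₁ u₂ : ℂ) (p : ℕ → ℤ) (s : Fin k → Bool) (l : ℕ) (d d' : ℤ) : ℂ :=
  faceW x r (p l) (p (l + 1)) d d' (u₁ - u₂ + (k - 1 - (l : ℂ))) *
    psi x r (spin s l) (u₁ + (k - 1 - (l : ℂ))) d d'

/-- The state after the action of the sites `i, …, k - 1` of a row. -/
def rowState (x r : ℝ) {k : ℕ} (u₁ u₂ : ℂ) (p : ℕ → ℤ) (c : ℤ) (j : Fin k)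
    (ρ : (Fin k → Bool) → ℂ) (i : ℕ) (t : Conf k) : ℂ :=
  (∏ l : Fin k, if (l : ℕ) < i then
      psi x r (t.1 l) (u₁ + (k - 1 - ((l : ℕ) : ℂ))) (p l) (p (l + 1)) else 1) *
    ∑ σ, pathSum (rowStep x r u₁ u₂ p t.1) (k - i) i (p i + step σ) (fun d => if d = c then 1 else 0) *
      psi x r (t.2 j) u₂ (p i) (p i + step σ) * ρ t.2

/-- One use of `vertex_face`, at the face in column i. It moves the vector of the second space from
the right edge of the face to its left edge and the vector of the i-th factor from the upper path to
the lower one. -/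
lemma Rsite_mulVec_rowState {k : ℕ} {u₁ u₂ : ℂ} (hu : Generic x r (u₁ - u₂)) {p : ℕ → ℤ} {c : ℤ}
    (j : Fin k) {ρ : (Fin k → Bool) → ℂ} (hρ : ∀ s τ, ρ (Function.update s j τ) = ρ s) (i : Fin k)
    (hp : ∃ β, p (i + 1) = p i + step β)
    (hreg : |p i - c| ≤ k - 1 - i → br x r (p i) ≠ 0) :
    (Rsite x r (u₁ - u₂ + (k - 1 - ((i : ℕ) : ℂ))) i j).mulVec
      (rowState x r u₁ u₂ p c j ρ (i + 1)) = rowState x r u₁ u₂ p c j ρ i := by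
  obtain ⟨β, hβ⟩ := hp
  funext t
  have hupd : ∀ σ, pathSum (rowStep x r u₁ u₂ p (Function.update t.1 i σ)) (k - (i + 1)) (i + 1) =
      pathSum (rowStep x r u₁ u₂ p t.1) (k - (i + 1)) (i + 1) := by
    intro σ
    funext a F
    refine pathSum_congr F _ _ _ fun l h1 h2 => ?_
    funext d d'
    rw [rowStep, rowStep, spin_update _ _ (by omega)]
  have hprod : ∀ σ, (∏ l : Fin k, if (l : ℕ) < i + 1 then
      psi x r (Function.update t.1 i σ l) (u₁ + (k - 1 - ((l : ℕ) : ℂ))) (p l) (p (l + 1)) else 1) =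
      psi x r σ (u₁ + (k - 1 - ((i : ℕ) : ℂ))) (p i) (p (i + 1)) *
      ∏ l : Fin k, if (l : ℕ) < i then
        psi x r (t.1 l) (u₁ + (k - 1 - ((l : ℕ) : ℂ))) (p l) (p (l + 1)) else 1 := by
    intro σ
    rw [← Finset.mul_prod_erase _ _ (Finset.mem_univ i),
      ← Finset.mul_prod_erase _ (fun l : Fin k => if (l : ℕ) < i then _ else _) (Finset.mem_univ i)]
    rw [if_pos (Nat.lt_succ_self _), Function.update_self, if_neg (lt_irrefl _), one_mul]
    congr 1
    refine Finset.prod_congr rfl fun l hl => ?_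
    have hl' : l ≠ i := (Finset.mem_erase.mp hl).1
    have hl2 : (l : ℕ) ≠ i := fun e => hl' (Fin.ext e)
    rw [Function.update_of_ne hl']
    by_cases h : (l : ℕ) < i
    · rw [if_pos h, if_pos (by omega)]
    · rw [if_neg h, if_neg (by omega)]
  rw [Rsite_mulVec]
  simp only [rowState, hupd, hprod, Function.update_self, hρ]
  set P := ∏ l : Fin k, if (l : ℕ) < i then
        psi x r (t.1 l) (u₁ + (k - 1 - ((l : ℕ) : ℂ))) (p l) (p (l + 1)) else 1
  set Z := fun d => pathSum (rowStep x r u₁ u₂ p t.1) (k - (i + 1)) (i + 1) d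
    fun d => if d = c then 1 else 0 with hZ
  set v := u₁ + (k - 1 - ((i : ℕ) : ℂ)) with hv
  have hv2 : u₁ - u₂ + (k - 1 - ((i : ℕ) : ℂ)) = v - u₂ := by rw [hv]; ring
  have hvf : ∀ γ, Z (p i + step β + step γ) * ∑ σ, ∑ τ, Rmat x r (v - u₂) σ τ (t.1 i) (t.2 j) *
      (psi x r σ v (p i) (p i + step β) * psi x r τ u₂ (p i + step β) (p i + step β + step γ)) =
      Z (p i + step β + step γ) * ∑ δ, faceW x r (p i) (p i + step β) (p i + step δ)
        (p i + step β + step γ) (v - u₂) *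
        (psi x r (t.1 i) v (p i + step δ) (p i + step β + step γ) *
          psi x r (t.2 j) u₂ (p i) (p i + step δ)) := by
    intro γ
    -- The denominator [p i] occurs only in a turn, where the path is back at height p i. If c
    -- cannot be reached from there, Z vanishes and nothing is needed; otherwise `hreg` applies.
    by_cases h0 : Z (p i + step β + step γ) = 0
    · rw [h0, zero_mul, zero_mul]
    · rw [vertex_face hx₀ hx₁ hr]
      · have := hu (1 + (k - 1 - i))
        rw [← hv2]
        convert this using 2
        push_cast
        ring
      · intro hβγ
        refine hreg ?_
        by_contra hlt
        refine h0 (pathSum_eq_zero _ _ _ _ fun b hb => if_neg ?_)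
        rintro rfl
        refine hlt ?_
        have e : p i + step β + step γ = p i := by
          cases β <;> cases γ <;> simp_all [step]
        rw [e, abs_sub_comm] at hb
        have := i.2
        omega
  have hL : ∑ σ, ∑ τ, Rmat x r (u₁ - u₂ + (k - 1 - ((i : ℕ) : ℂ))) σ τ (t.1 i) (t.2 j) *
      (psi x r σ v (p i) (p (i + 1)) * P *
        ∑ γ, Z (p (i + 1) + step γ) * psi x r τ u₂ (p (i + 1)) (p (i + 1) + step γ) * ρ t.2) =
      P * ρ t.2 * ∑ γ, Z (p i + step β + step γ) *
        ∑ σ, ∑ τ, Rmat x r (v - u₂) σ τ (t.1 i) (t.2 j) *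
      (psi x r σ v (p i) (p i + step β) * psi x r τ u₂ (p i + step β) (p i + step β + step γ)) := by
    simp only [hv2, hβ, Fintype.sum_bool]
    ring
  rw [hL]
  simp only [hvf]
  have hR : ∀ δ, pathSum (rowStep x r u₁ u₂ p t.1) (k - i) i (p i + step δ)
      (fun d => if d = c then 1 else 0) =
      ∑ γ, Z (p i + step β + step γ) * (faceW x r (p i) (p i + step β) (p i + step δ)
        (p i + step β + step γ) (v - u₂) *
        psi x r (t.1 i) v (p i + step δ) (p i + step β + step γ)) := by
    intro δ
    rw [show k - (i : ℕ) = k - (i + 1) + 1 by have := i.2; omega, pathSum,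
      sum_step_comm (g := fun d => Z d * (faceW x r (p i) (p i + step β) (p i + step δ)
        d (v - u₂) * psi x r (t.1 i) v (p i + step δ) d)) β δ]
    · refine Finset.sum_congr rfl fun σ _ => ?_
      rw [rowStep, spin_val, hv2, hβ, mul_comm]
    · intro d hd
      exact faceW_ne_zero (left_ne_zero_of_mul (right_ne_zero_of_mul hd))
  simp only [hR, Fintype.sum_bool]
  ring

/-- The action of a row of elementary `R`-matrices. -/
lemma rowProd_mulVec {k : ℕ} {u₁ u₂ : ℂ} (hu : Generic x r (u₁ - u₂)) {p : ℕ → ℤ}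
    (hp : ∀ i < k, ∃ β, p (i + 1) = p i + step β) (γ : Bool)
    (hreg : ∀ i : ℕ, i < k → |p i - (p k + step γ)| ≤ k - 1 - i → br x r (p i) ≠ 0)
    (j : Fin k) {ρ : (Fin k → Bool) → ℂ} (hρ : ∀ s τ, ρ (Function.update s j τ) = ρ s) :
    (rowProd x r (u₁ - u₂) j).mulVec (fun t => pathVec x r u₁ p t.1 *
        (psi x r (t.2 j) u₂ (p k) (p k + step γ) * ρ t.2)) =
      fun t => ∑ σ, ∑ q : Fin k → Bool, if walk (p 0 + step σ) q k = p k + step γ then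
        (∏ l : Fin k, faceW x r (p l) (p (l + 1)) (walk (p 0 + step σ) q l)
          (walk (p 0 + step σ) q (l + 1)) (u₁ - u₂ + (k - 1 - ((l : ℕ) : ℂ)))) *
        (pathVec x r u₁ (walk (p 0 + step σ) q) t.1 *
          (psi x r (t.2 j) u₂ (p 0) (p 0 + step σ) * ρ t.2)) else 0 := by
  -- Within a row the face-by-face identities are exact, so no symmetrizer is needed.
  have key := mulVec_ofFn_prod (S := 1)
    (fun i : Fin k => Rsite x r (u₁ - u₂ + (k - 1 - ((i : ℕ) : ℂ))) i j)
    (rowState x r u₁ u₂ p (p k + step γ) j ρ) (by simp) fun i => by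
      rw [Rsite_mulVec_rowState hx₀ hx₁ hr hu j hρ i (hp i i.2) (hreg i i.2)]
  simp only [Matrix.one_mulVec] at key
  rw [rowProd]
  convert key using 2
  · funext t
    have h0 : ∀ l : Fin k, (l : ℕ) < k := fun l => l.2
    have hs : ∀ σ, step σ = step γ ↔ σ = γ := by intro σ; cases σ <;> cases γ <;> simp [step]
    simp [rowState, h0, pathSum, pathVec, hs]
  · rename_i t
    rw [rowState]
    simp only [not_lt_zero, if_false, Finset.prod_const_one, one_mul, Nat.sub_zero, pathSum_eq,
      zero_add, rowStep, spin_val]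
    refine Finset.sum_congr rfl fun σ _ => ?_
    rw [Finset.sum_mul, Finset.sum_mul]
    refine Finset.sum_congr rfl fun q _ => ?_
    rw [Finset.prod_mul_distrib, pathVec]
    split_ifs
    · ring
    · ring

omit hx₀ hx₁ hr in
lemma sym1_mulVec_prod {k : ℕ} (A B : (Fin k → Bool) → ℂ) :
    (sym1 k).mulVec (fun t => A t.1 * B t.2) = fun t =>
      (∑ e : Fin (k + 1), (∑ s, if plus s = e then A s else 0) * vSym k e t.1) * B t.2 := by
  funext t
  rw [sum_vSym, sym1_eq, Matrix.smul_mulVec, Matrix.sum_mulVec]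
  simp only [Pi.smul_apply, Finset.sum_apply, perm1_mulVec, smul_eq_mul, Finset.sum_mul, mul_assoc]

omit hx₀ hx₁ hr in
lemma sym1_mulVec_congr {k : ℕ} {A A' : (Fin k → Bool) → ℂ}
    (h : ∀ e : ℕ, ∑ s, (if plus s = e then A s else 0) = ∑ s, if plus s = e then A' s else 0)
    (B : (Fin k → Bool) → ℂ) :
    (sym1 k).mulVec (fun t => A t.1 * B t.2) = (sym1 k).mulVec (fun t => A' t.1 * B t.2) := by
  rw [sym1_mulVec_prod, sym1_mulVec_prod]
  simp only [h]

/-- The action of a row on symmetrized tensors of intertwining vectors. -/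
lemma sym1_rowProd_mulVec {k : ℕ} {u₁ u₂ : ℂ} (hu : Generic x r (u₁ - u₂)) (a b : ℤ) (γ : Bool)
    (hreg : Adm k a b → ∀ i : ℕ, i < k → |refPath k a b i - (b + step γ)| ≤ k - 1 - i →
      br x r (refPath k a b i) ≠ 0)
    (j : Fin k) {ρ : (Fin k → Bool) → ℂ} (hρ : ∀ s τ, ρ (Function.update s j τ) = ρ s) :
    (sym1 k).mulVec ((rowProd x r (u₁ - u₂) j).mulVec (fun t => refVec x r k u₁ a b t.1 *
        (psi x r (t.2 j) u₂ b (b + step γ) * ρ t.2))) =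
      (sym1 k).mulVec fun t => ∑ σ, Wk1 x r k a b (a + step σ) (b + step γ) (u₁ - u₂) *
        (refVec x r k u₁ (a + step σ) (b + step γ) t.1 *
          (psi x r (t.2 j) u₂ a (a + step σ) * ρ t.2)) := by
  by_cases hA : Adm k a b
  swap
  · simp only [refVec, Wk1, if_neg hA, zero_mul, Finset.sum_const_zero]
    congr 1
    exact Matrix.mulVec_zero _
  have h := rowProd_mulVec hx₀ hx₁ hr hu (p := refPath k a b) (fun i hi => refPath_succ hA hi) γ
    (by rw [refPath_end hA]; exact hreg hA) j hρ
  rw [refPath_end hA, refPath_zero hA] at h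
  have e1 : (fun t : Conf k => refVec x r k u₁ a b t.1 *
        (psi x r (t.2 j) u₂ b (b + step γ) * ρ t.2)) = fun t : Conf k =>
        pathVec x r u₁ (refPath k a b) t.1 * (psi x r (t.2 j) u₂ b (b + step γ) * ρ t.2) := by
    funext t; rw [refVec, if_pos hA]
  rw [e1, h]
  have swap : ∀ f : Bool → (Fin k → Bool) → Conf k → ℂ,
      (sym1 k).mulVec (fun t => ∑ σ, ∑ q, f σ q t) =
        ∑ σ, ∑ q, (sym1 k).mulVec (f σ q) := by
    intro f
    have : (fun t => ∑ σ, ∑ q, f σ q t) = ∑ σ, ∑ q, f σ q := by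
      funext t; simp only [Finset.sum_apply]
    rw [this, Matrix.mulVec_sum]
    simp only [Matrix.mulVec_sum]
  have e2 : ∀ t : Conf k, (∑ σ, Wk1 x r k a b (a + step σ) (b + step γ) (u₁ - u₂) *
        (refVec x r k u₁ (a + step σ) (b + step γ) t.1 *
          (psi x r (t.2 j) u₂ a (a + step σ) * ρ t.2))) =
      ∑ σ, ∑ q : Fin k → Bool, if walk (a + step σ) q k = b + step γ then
        (∏ l : Fin k, faceW x r (refPath k a b l) (refPath k a b (l + 1)) (walk (a + step σ) q l)
          (walk (a + step σ) q (l + 1)) (u₁ - u₂ + (k - 1 - ((l : ℕ) : ℂ)))) *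
        (refVec x r k u₁ (a + step σ) (b + step γ) t.1 *
          (psi x r (t.2 j) u₂ a (a + step σ) * ρ t.2)) else 0 := by
    intro t
    refine Finset.sum_congr rfl fun σ _ => ?_
    rw [Wk1, if_pos hA, Finset.sum_mul]
    refine Finset.sum_congr rfl fun q _ => ?_
    split_ifs <;> simp
  simp only [e2]
  rw [swap, swap]
  refine Finset.sum_congr rfl fun σ _ => Finset.sum_congr rfl fun q _ => ?_
  split_ifs with hq
  · have e3 : ∀ (c : ℂ) (F : Conf k → ℂ), (sym1 k).mulVec (fun t => c * F t) =
        c • (sym1 k).mulVec F := fun c F => Matrix.mulVec_smul _ c F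
    rw [e3, e3]
    congr 1
    -- Under the symmetrizer the tensor along the lower path q may be replaced by the one along the
    -- reference path with the same end points, which prepares the next row.
    refine (sym1_mulVec_congr (fun e => ?_)
      (fun s => psi x r (s j) u₂ a (a + step σ) * ρ s)).symm
    rw [← hq]
    exact sum_refVec x r u₁ (a + step σ) q e
  · rfl

end Action

/-! ### From rows to the block: the fused vertex-face correspondence -/

section Block

variable {x r : ℝ} (hx₀ : 0 < x) (hx₁ : x < 1) (hr : 1 < r)

/-- The weight of a path of left heights in a block with right heights `b`. -/
def blockStep (x r : ℝ) {k : ℕ} (u₁ u₂ : ℂ) (b : ℕ → ℤ) (s : Fin k → Bool) (l : ℕ) (c c' : ℤ) : ℂ :=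
  Wk1 x r k c (b l) c' (b (l + 1)) (u₁ - u₂ - k + 1 + (l : ℂ)) *
    psi x r (spin s l) (u₂ + (k - 1 - (l : ℂ))) c c'

/-- The state after the action of the rows `0, …, j - 1` of a block. -/
def blockState (x r : ℝ) {k : ℕ} (u₁ u₂ : ℂ) (b : ℕ → ℤ) (c : ℤ) (j : ℕ) (t : Conf k) : ℂ :=
  pathSum (blockStep x r u₁ u₂ b t.2) j 0 c (fun d => refVec x r k u₁ d (b j) t.1) *
    ∏ l : Fin k, if j ≤ l then
      psi x r (t.2 l) (u₂ + (k - 1 - ((l : ℕ) : ℂ))) (b l) (b (l + 1)) else 1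

lemma abs_walk_sub_le {n : ℕ} (c : ℤ) (q : Fin n → Bool) : |walk c q n - c| ≤ n := by
  rw [walk_end]
  have := plus_le q
  rw [abs_le]
  omega

include hx₀ hx₁ hr

/-- For each fixed path q of left heights above row j, everything that depends on the spins of the
second space other than the j-th is collected in ρ. The row does not touch ρ, and the claim becomes
`sym1_rowProd_mulVec` with second parameter v. -/
lemma sym1_rowProd_mulVec_blockState {k : ℕ} {u₁ u₂ : ℂ} (hu : Generic x r (u₁ - u₂)) {b : ℕ → ℤ}
    (c : ℤ) (j : Fin k) (hb : ∃ γ, b (j + 1) = b j + step γ)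
    (hreg : ∀ n, |n - c| + |n - b (j + 1)| ≤ k - 1 + j → br x r n ≠ 0) :
    (sym1 k).mulVec ((rowProd x r (u₁ - u₂ - k + 1 + ((j : ℕ) : ℂ)) j).mulVec
      (blockState x r u₁ u₂ b c j)) = (sym1 k).mulVec (blockState x r u₁ u₂ b c (j + 1)) := by
  obtain ⟨γ, hγ⟩ := hb
  set v := u₂ + (k - 1 - ((j : ℕ) : ℂ)) with hv
  have hv1 : u₁ - u₂ - k + 1 + ((j : ℕ) : ℂ) = u₁ - v := by rw [hv]; ring
  have huv : Generic x r (u₁ - v) := by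
    intro n
    convert hu (n - (k - 1 - j)) using 2
    rw [hv]; push_cast; ring
  set ρ : (Fin j → Bool) → (Fin k → Bool) → ℂ := fun q s =>
    (∏ l : Fin j, blockStep x r u₁ u₂ b s l (walk c q l) (walk c q (l + 1))) *
      ∏ l : Fin k, if (j : ℕ) + 1 ≤ l then
        psi x r (s l) (u₂ + (k - 1 - ((l : ℕ) : ℂ))) (b l) (b (l + 1)) else 1 with hρdef
  have hρ : ∀ q s τ, ρ q (Function.update s j τ) = ρ q s := by
    intro q s τ
    simp only [hρdef]
    congr 1
    · refine Finset.prod_congr rfl fun l _ => ?_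
      rw [blockStep, blockStep, spin_update]
      exact l.2.ne
    · refine Finset.prod_congr rfl fun l _ => ?_
      split_ifs with h
      · rw [Function.update_of_ne]
        rintro rfl
        omega
      · rfl
  have e0 : blockState x r u₁ u₂ b c j = ∑ q : Fin j → Bool, fun t =>
      refVec x r k u₁ (walk c q j) (b j) t.1 * (psi x r (t.2 j) v (b j) (b j + step γ) * ρ q t.2) := by
    funext t
    rw [blockState, pathSum_eq, Finset.sum_mul, Finset.sum_apply]
    refine Finset.sum_congr rfl fun q _ => ?_
    have hprod : (∏ l : Fin k, if (j : ℕ) ≤ l then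
        psi x r (t.2 l) (u₂ + (k - 1 - ((l : ℕ) : ℂ))) (b l) (b (l + 1)) else 1) =
        psi x r (t.2 j) v (b j) (b j + step γ) * ∏ l : Fin k, if (j : ℕ) + 1 ≤ l then
          psi x r (t.2 l) (u₂ + (k - 1 - ((l : ℕ) : ℂ))) (b l) (b (l + 1)) else 1 := by
      rw [← Finset.mul_prod_erase _ _ (Finset.mem_univ j),
        ← Finset.mul_prod_erase _ (fun l : Fin k => if (j : ℕ) + 1 ≤ l then _ else _)
          (Finset.mem_univ j)]
      rw [if_pos le_rfl, if_neg (by omega), one_mul, hγ]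
      congr 1
      refine Finset.prod_congr rfl fun l hl => ?_
      have hl' : (l : ℕ) ≠ j := fun e => (Finset.mem_erase.mp hl).1 (Fin.ext e)
      by_cases h : (j : ℕ) ≤ l
      · rw [if_pos h, if_pos (by omega)]
      · rw [if_neg h, if_neg (by omega)]
    rw [hprod]
    simp only [hρdef, zero_add]
    ring
  have e1 : blockState x r u₁ u₂ b c (j + 1) = ∑ q : Fin j → Bool, fun t =>
      ∑ σ, Wk1 x r k (walk c q j) (b j) (walk c q j + step σ) (b j + step γ) (u₁ - v) *
        (refVec x r k u₁ (walk c q j + step σ) (b j + step γ) t.1 *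
          (psi x r (t.2 j) v (walk c q j) (walk c q j + step σ) * ρ q t.2)) := by
    funext t
    rw [blockState, pathSum_succ, pathSum_eq, Finset.sum_mul, Finset.sum_apply]
    refine Finset.sum_congr rfl fun q _ => ?_
    rw [Finset.mul_sum, Finset.sum_mul]
    refine Finset.sum_congr rfl fun σ _ => ?_
    have e2 : blockStep x r u₁ u₂ b t.2 (0 + j) (walk c q j) (walk c q j + step σ) =
        Wk1 x r k (walk c q j) (b j) (walk c q j + step σ) (b j + step γ) (u₁ - v) *
          psi x r (t.2 j) v (walk c q j) (walk c q j + step σ) := by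
      rw [zero_add, blockStep, spin_val, hγ, hv1]
    rw [e2, hγ]
    simp only [hρdef, zero_add]
    ring
  rw [e0, e1, hv1, Matrix.mulVec_sum, Matrix.mulVec_sum, Matrix.mulVec_sum]
  refine Finset.sum_congr rfl fun q _ => ?_
  refine sym1_rowProd_mulVec hx₀ hx₁ hr huv (walk c q j) (b j) γ (fun hA i hi hle => ?_) j (hρ q)
  -- A height in column i is within i of the left end of the row, which is within j of c, and within
  -- k-1-i of the lower right corner of the row. Together this gives k-1+j.
  refine hreg _ ?_
  rw [hγ]
  have h1 := abs_walk_sub_le c q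
  have h2 := refPath_abs_left hA (i := i)
  have h3 := abs_sub_le (refPath k (walk c q j) (b j) i) (walk c q j) c
  omega

lemma sym1_blockProd_mulVec {k : ℕ} {u₁ u₂ : ℂ} (hu : Generic x r (u₁ - u₂)) {b : ℕ → ℤ} (c : ℤ)
    (hb : ∀ j < k, ∃ γ, b (j + 1) = b j + step γ)
    (hreg : ∀ j < k, ∀ n, |n - c| + |n - b (j + 1)| ≤ k - 1 + j → br x r n ≠ 0) :
    (sym1 k).mulVec ((blockProd x r k (u₁ - u₂)).mulVec (blockState x r u₁ u₂ b c 0)) =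
      (sym1 k).mulVec (blockState x r u₁ u₂ b c k) := by
  -- The rightmost factor belongs to the place 0 of the second space and acts first, whence the
  -- reversed index k - i of the states.
  have key := mulVec_ofFn_prod (S := sym1 k)
    (fun j : Fin k => rowProd x r (u₁ - u₂ - ((j : ℕ) : ℂ)) j.rev)
    (fun i => blockState x r u₁ u₂ b c (k - i)) (fun j => symmetrizer_mul_mul perm1_one perm1_mul
      (sym1_eq k) fun i hi => preservesAnti_rowProd hx₀ hx₁ hr (hu.sub_natCast _) _ i hi)
    fun j => by
      have := sym1_rowProd_mulVec_blockState hx₀ hx₁ hr hu c j.rev (hb _ j.rev.2) (hreg _ j.rev.2)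
      have h1 : ((j.rev : ℕ) : ℂ) = k - (j + 1) := by
        rw [Fin.val_rev, Nat.cast_sub (by omega)]; push_cast; ring
      rw [h1, show (j.rev : ℕ) = k - (j + 1) from Fin.val_rev j,
        show k - ((j : ℕ) + 1) + 1 = k - j by omega] at this
      rw [← this]
      congr 4
      ring
  simpa [blockProd] using key

omit hx₀ hx₁ hr in
lemma weightForm_prod {k : ℕ} (e f : ℕ) (A B : (Fin k → Bool) → ℂ) :
    weightForm k e f (fun t => A t.1 * B t.2) =
      (∑ s, if plus s = e then A s else 0) * ∑ s, if plus s = f then B s else 0 := by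
  change weightSum e f _ = _
  rw [weightSum, Fintype.sum_prod_type, Finset.sum_mul_sum]
  refine Finset.sum_congr rfl fun s _ => Finset.sum_congr rfl fun s' _ => ?_
  split_ifs <;> simp_all

omit hx₀ hx₁ hr in
lemma sum_adm {k : ℕ} (f : ℤ → ℂ) (a d : ℤ) (hf : ¬ Adm k d a → f d = 0) :
    ∑ j : Fin (k + 1), (if d = a + 2 * (j : ℕ) - k then f d else 0) = f d := by
  by_cases h : Adm k d a
  · obtain ⟨j, hj⟩ := h
    rw [Finset.sum_eq_single j, if_pos (by omega)]
    · intro i _ hi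
      exact if_neg fun e => hi (Fin.ext (by omega))
    · simp
  · rw [hf h]; simp

/-- The vertex-face correspondence for the fused weights. -/
theorem sum_RkkComp_psiK {k : ℕ} {u₁ u₂ : ℂ} (hu : Generic x r (u₁ - u₂)) {c d a : ℤ}
    (hda : Adm k d a) (hreg : FaceRegular x r k c a) (e₁ e₂ : Fin (k + 1)) :
    ∑ e₁', ∑ e₂', RkkComp x r k (u₁ - u₂) e₁' e₂' e₁ e₂ *
        (psiK x r k e₁' u₁ c d * psiK x r k e₂' u₂ d a) =
      ∑ j : Fin (k + 1), Wkk x r k c d (a + 2 * (j : ℕ) - k) a (u₁ - u₂) *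
        (psiK x r k e₁ u₁ (a + 2 * (j : ℕ) - k) a * psiK x r k e₂ u₂ c (a + 2 * (j : ℕ) - k)) := by
  set b := refPath k d a with hbdef
  have hb0 : b 0 = d := refPath_zero hda
  have hbk : b k = a := refPath_end hda
  have h0 : (fun t : Conf k => refVec x r k u₁ c d t.1 * refVec x r k u₂ d a t.2) =
      blockState x r u₁ u₂ b c 0 := by
    funext t
    simp only [blockState, pathSum, hb0, Nat.zero_le, if_true]
    congr 1
    rw [refVec, if_pos hda, pathVec]
  -- The bound k-1+j relative to c and b (j+1), together with |b (j+1) - a| ≤ k-1-j, gives the bound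
  -- 2k-2 of `FaceRegular` in every row.
  have hblock := sym1_blockProd_mulVec hx₀ hx₁ hr hu (b := b) c (fun j hj => refPath_succ hda hj)
    fun j hj n hn => hreg n (by
      have h1 := refPath_abs_right hda (i := j + 1) hj
      have h2 := abs_sub_le n (b (j + 1)) a
      rw [← hbdef] at h1
      push_cast at h1
      omega)
  have hend : blockState x r u₁ u₂ b c k = ∑ q : Fin k → Bool,
      (∏ l : Fin k, Wk1 x r k (walk c q l) (b l) (walk c q (l + 1)) (b (l + 1))
        (u₁ - u₂ - k + 1 + ((l : ℕ) : ℂ))) •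
      fun t : Conf k => refVec x r k u₁ (walk c q k) a t.1 * pathVec x r u₂ (walk c q) t.2 := by
    funext t
    have hlt : ∀ l : Fin k, ¬ k ≤ (l : ℕ) := fun l => by omega
    simp only [blockState, pathSum_eq, hlt, if_false, Finset.prod_const_one, mul_one, hbk,
      Finset.sum_apply, Pi.smul_apply, smul_eq_mul, blockStep, zero_add, spin_val,
      Finset.prod_mul_distrib, pathVec]
    refine Finset.sum_congr rfl fun q _ => ?_
    ring
  simp only [psiK_eq]
  rw [sum_RkkComp hx₀ hx₁ hr hu, h0, ← weightForm_sym1, hblock, weightForm_sym1, hend, map_sum]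
  simp only [map_smul, smul_eq_mul, weightForm_prod, ← sum_refVec, ← psiK_eq]
  have hf : ∀ q : Fin k → Bool, ¬ Adm k (walk c q k) a →
      psiK x r k e₁ u₁ (walk c q k) a * psiK x r k e₂ u₂ c (walk c q k) = 0 := by
    intro q hq
    rw [psiK, if_neg hq, zero_mul]
  simp only [Wkk, if_pos hda, Finset.sum_mul]
  rw [Finset.sum_comm]
  refine Finset.sum_congr rfl fun q _ => ?_
  rw [← sum_adm (fun d => psiK x r k e₁ u₁ d a * psiK x r k e₂ u₂ c d) a _ (hf q), Finset.mul_sum]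
  refine Finset.sum_congr rfl fun j _ => ?_
  split_ifs with h
  · rw [← h]
  · simp

end Block

/-! ### Components of operators on direct sums -/

section BlockAlgebra

lemma linearMap_comp_sum {U V W α : Type*} [AddCommGroup U] [Module ℂ U] [AddCommGroup V]
    [Module ℂ V] [AddCommGroup W] [Module ℂ W] (g : V →ₗ[ℂ] W) (s : Finset α)
    (T : α → U →ₗ[ℂ] V) : g ∘ₗ (∑ i ∈ s, T i) = ∑ i ∈ s, g ∘ₗ T i := by
  ext v
  simp

lemma linearMap_sum_comp {U V W α : Type*} [AddCommGroup U] [Module ℂ U] [AddCommGroup V]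
    [Module ℂ V] [AddCommGroup W] [Module ℂ W] (g : U →ₗ[ℂ] V) (s : Finset α)
    (T : α → V →ₗ[ℂ] W) : (∑ i ∈ s, T i) ∘ₗ g = ∑ i ∈ s, T i ∘ₗ g := by
  ext v
  simp

variable {ι κ : Type*} [DecidableEq ι] {M : ι → Type*} {N : κ → Type*}
    [∀ i, AddCommGroup (M i)] [∀ i, Module ℂ (M i)] [∀ i, AddCommGroup (N i)]
    [∀ i, Module ℂ (N i)]

lemma block_smul (z : ℂ) (T : (⨁ i, M i) →ₗ[ℂ] (⨁ i, N i)) (b : κ) (a : ι) :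
    block (z • T) b a = z • block T b a := by
  simp only [block, LinearMap.smul_comp, LinearMap.comp_smul]

lemma block_sum {α : Type*} (s : Finset α) (T : α → (⨁ i, M i) →ₗ[ℂ] (⨁ i, N i)) (b : κ) (a : ι) :
    block (∑ i ∈ s, T i) b a = ∑ i ∈ s, block (T i) b a := by
  simp only [block, linearMap_sum_comp, linearMap_comp_sum]

lemma component_comp_lof_comp [DecidableEq κ] {V : Type*} [AddCommGroup V] [Module ℂ V]
    (T : ∀ b, V →ₗ[ℂ] N b) (b d : κ) :
    DirectSum.component ℂ κ N b ∘ₗ (DirectSum.lof ℂ κ N d ∘ₗ T d) = if d = b then T b else 0 := by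
  split_ifs with h
  · subst h
    ext v
    simp [DirectSum.component.lof_self]
  · ext v
    simp [DirectSum.component.of, h]

lemma block_id (b a : ι) (hba : b ≠ a) :
    block (LinearMap.id : (⨁ i, M i) →ₗ[ℂ] (⨁ i, M i)) b a = 0 := by
  ext v
  simp [block, DirectSum.component.of, hba.symm]

lemma block_id_self (a : ι) :
    block (LinearMap.id : (⨁ i, M i) →ₗ[ℂ] (⨁ i, M i)) a a = LinearMap.id := by
  ext v
  simp [block]

end BlockAlgebra

/-! ### Banded operators on direct sums and the exchange relation -/

section Band

variable {k : ℕ} {m : ℤ} {H : (ℓ : ℕ) → Height m ℓ → Type*}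
  [∀ ℓ a, AddCommGroup (H ℓ a)] [∀ ℓ a, Module ℂ (H ℓ a)]

lemma adm_nbr {ℓ ℓ' : ℕ} (h : ℓ + ℓ' = k) (a : Height m ℓ) (j : Fin (k + 1)) :
    Adm k (nbr h a j) a := ⟨j, by simp only [nbr]; ring⟩

lemma exists_nbr {ℓ ℓ' : ℕ} (h : ℓ + ℓ' = k) {b : Height m ℓ'} {a : Height m ℓ}
    (hba : Adm k b a) : ∃ j, nbr h a j = b := by
  obtain ⟨j, hj⟩ := hba
  exact ⟨j, Subtype.ext (by simp only [nbr]; omega)⟩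

lemma nbr_injective {ℓ ℓ' : ℕ} (h : ℓ + ℓ' = k) (a : Height m ℓ) :
    Function.Injective (nbr h a : Fin (k + 1) → Height m ℓ') := by
  intro i j hij
  have := congrArg Subtype.val hij
  simp only [nbr] at this
  exact Fin.ext (by omega)

/-- The operator `⨁_{a, b ∈ a + I_k} T_{b,a}`. -/
def bandOp {ℓ ℓ' : ℕ} (h : ℓ + ℓ' = k) (T : ∀ (b : Height m ℓ') (a : Height m ℓ), H ℓ a →ₗ[ℂ] H ℓ' b) :
    (⨁ a : Height m ℓ, H ℓ a) →ₗ[ℂ] (⨁ b : Height m ℓ', H ℓ' b) :=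
  DirectSum.toModule ℂ (Height m ℓ) (⨁ b : Height m ℓ', H ℓ' b) fun a =>
    ∑ j : Fin (k + 1), DirectSum.lof ℂ (Height m ℓ') (H ℓ') (nbr h a j) ∘ₗ T (nbr h a j) a

lemma bandOp_comp_lof {ℓ ℓ' : ℕ} (h : ℓ + ℓ' = k)
    (T : ∀ (b : Height m ℓ') (a : Height m ℓ), H ℓ a →ₗ[ℂ] H ℓ' b) (a : Height m ℓ) :
    bandOp h T ∘ₗ DirectSum.lof ℂ (Height m ℓ) (H ℓ) a =
      ∑ j : Fin (k + 1), DirectSum.lof ℂ (Height m ℓ') (H ℓ') (nbr h a j) ∘ₗ T (nbr h a j) a := by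
  refine LinearMap.ext fun v => ?_
  rw [LinearMap.comp_apply, bandOp, DirectSum.toModule_lof]

lemma block_bandOp {ℓ ℓ' : ℕ} (h : ℓ + ℓ' = k)
    (T : ∀ (b : Height m ℓ') (a : Height m ℓ), H ℓ a →ₗ[ℂ] H ℓ' b) (b : Height m ℓ')
    (a : Height m ℓ) : block (bandOp h T) b a = if Adm k b a then T b a else 0 := by
  rw [block, bandOp_comp_lof, linearMap_comp_sum]
  simp only [component_comp_lof_comp fun b => T b a]
  split_ifs with hA
  · obtain ⟨j, rfl⟩ := exists_nbr h hA
    simp only [(nbr_injective h a).eq_iff]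
    simp
  · refine Finset.sum_eq_zero fun j _ => if_neg ?_
    rintro rfl
    exact hA (adm_nbr h a j)

lemma block_bandOp_comp_bandOp {ℓ ℓ' : ℕ} (h : ℓ + ℓ' = k) (h' : ℓ' + ℓ = k)
    (S : ∀ (b : Height m ℓ) (a : Height m ℓ'), H ℓ' a →ₗ[ℂ] H ℓ b)
    (T : ∀ (b : Height m ℓ') (a : Height m ℓ), H ℓ a →ₗ[ℂ] H ℓ' b) (c a : Height m ℓ) :
    block (bandOp h' S ∘ₗ bandOp h T) c a =
      ∑ j : Fin (k + 1), (if Adm k c (nbr h a j) then S c (nbr h a j) else 0) ∘ₗ T (nbr h a j) a := by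
  rw [block, LinearMap.comp_assoc, bandOp_comp_lof, linearMap_comp_sum, linearMap_comp_sum]
  refine Finset.sum_congr rfl fun j _ => ?_
  rw [← block_bandOp h' S, block]
  rfl

variable {x r : ℝ} (Φ : ∀ {ℓ ℓ' : ℕ}, ℓ + ℓ' = k → (b : Height m ℓ') → (a : Height m ℓ) → ℂ →
    (H ℓ a →ₗ[ℂ] H ℓ' b))

lemma vertexHTM_eq (f : ℂ → ℂ) (u₀ : ℂ) {ℓ ℓ' : ℕ} (h : ℓ + ℓ' = k) (e : Fin (k + 1)) (u : ℂ) :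
    vertexHTM x r Φ f u₀ h e u =
      f (u - u₀) • bandOp h fun b a => psiK x r k e (u - u₀) b a • Φ h b a u := by
  simp only [vertexHTM, bandOp, LinearMap.comp_smul]

lemma vertexDualHTM_eq (f : ℂ → ℂ) (u₀ : ℂ) {ℓ ℓ' : ℕ} (h : ℓ + ℓ' = k) (e : Fin (k + 1)) (u : ℂ) :
    vertexDualHTM x r Φ f u₀ h e u =
      (f (u - u₀))⁻¹ • bandOp h fun b a => psiStarK x r k e (u - u₀) b a • dualHTM x r Φ h b a u := by
  simp only [vertexDualHTM, bandOp, LinearMap.comp_smul]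

lemma block_vertexHTM_comp_vertexHTM (f : ℂ → ℂ) (u₀ : ℂ) {ℓ ℓ' : ℕ} (h : ℓ + ℓ' = k)
    (h' : ℓ' + ℓ = k) (e₁ e₂ : Fin (k + 1)) (u₁ u₂ : ℂ) (c a : Height m ℓ) :
    block (vertexHTM x r Φ f u₀ h' e₂ u₂ ∘ₗ vertexHTM x r Φ f u₀ h e₁ u₁) c a =
      (f (u₁ - u₀) * f (u₂ - u₀)) • ∑ j : Fin (k + 1),
        (psiK x r k e₁ (u₁ - u₀) (nbr h a j) a * psiK x r k e₂ (u₂ - u₀) c (nbr h a j)) •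
          (Φ h' c (nbr h a j) u₂ ∘ₗ Φ h (nbr h a j) a u₁) := by
  rw [vertexHTM_eq, vertexHTM_eq, LinearMap.smul_comp, LinearMap.comp_smul, smul_smul, block_smul,
    block_bandOp_comp_bandOp, mul_comm]
  congr 1
  refine Finset.sum_congr rfl fun j _ => ?_
  split_ifs with hA
  · rw [LinearMap.smul_comp, LinearMap.comp_smul, smul_smul, mul_comm]
  · rw [psiK.eq_def x r k e₂, if_neg hA, mul_zero, zero_smul, LinearMap.zero_comp]

/-- The exchange relation of the vertex operators. -/
theorem vertexHTM_exchange (hx₀ : 0 < x) (hx₁ : x < 1) (hr : 1 < r)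
    (hΦ : IsSOSHalfTransfer x r Φ) (f : ℂ → ℂ) (u₀ : ℂ) {ℓ ℓ' : ℕ} (h : ℓ + ℓ' = k)
    (h' : ℓ' + ℓ = k) {u₁ u₂ : ℂ} (hu : Generic x r (u₁ - u₂)) (e₁ e₂ : Fin (k + 1))
    (c a : Height m ℓ) (hreg : FaceRegular x r k c a) :
    block (vertexHTM x r Φ f u₀ h' e₂ u₂ ∘ₗ vertexHTM x r Φ f u₀ h e₁ u₁) c a =
      block (∑ e₁' : Fin (k + 1), ∑ e₂' : Fin (k + 1), RkkComp x r k (u₁ - u₂) e₁' e₂' e₁ e₂ •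
        (vertexHTM x r Φ f u₀ h' e₁' u₁ ∘ₗ vertexHTM x r Φ f u₀ h e₂' u₂)) c a := by
  have huv : u₁ - u₂ = (u₁ - u₀) - (u₂ - u₀) := by ring
  simp only [block_sum, block_smul, block_vertexHTM_comp_vertexHTM]
  have hL : ∀ j : Fin (k + 1),
      (psiK x r k e₁ (u₁ - u₀) (nbr h a j) a * psiK x r k e₂ (u₂ - u₀) c (nbr h a j)) •
          (Φ h' c (nbr h a j) u₂ ∘ₗ Φ h (nbr h a j) a u₁) =
      ∑ i : Fin (k + 1), (Wkk x r k c (nbr h a i) (nbr h a j) a (u₁ - u₂) *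
        (psiK x r k e₁ (u₁ - u₀) (nbr h a j) a * psiK x r k e₂ (u₂ - u₀) c (nbr h a j))) •
        (Φ h' c (nbr h a i) u₁ ∘ₗ Φ h (nbr h a i) a u₂) := by
    intro j
    by_cases hA : Adm k c (nbr h a j)
    · rw [hΦ.exchange h h' c (nbr h a j) a u₁ u₂ hA (adm_nbr h a j) hreg hu, Finset.smul_sum]
      simp only [smul_smul, mul_comm]
    · rw [psiK.eq_def x r k e₂, if_neg hA]
      simp
  -- For a fixed intermediate height after the exchange, the sum over the one before it is the
  -- face-weight side of the fused correspondence `sum_RkkComp_psiK`.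
  have hF : ∀ i : Fin (k + 1), ∑ j : Fin (k + 1), Wkk x r k c (nbr h a i) (nbr h a j) a (u₁ - u₂) *
        (psiK x r k e₁ (u₁ - u₀) (nbr h a j) a * psiK x r k e₂ (u₂ - u₀) c (nbr h a j)) =
      ∑ e₁', ∑ e₂', RkkComp x r k (u₁ - u₂) e₁' e₂' e₁ e₂ *
        (psiK x r k e₁' (u₁ - u₀) c (nbr h a i) * psiK x r k e₂' (u₂ - u₀) (nbr h a i) a) := by
    intro i
    rw [huv, sum_RkkComp_psiK hx₀ hx₁ hr (huv ▸ hu) (adm_nbr h a i) hreg e₁ e₂]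
    rfl
  simp only [hL]
  rw [Finset.sum_comm]
  simp only [← Finset.sum_smul, hF]
  simp only [Finset.sum_smul, Finset.smul_sum, smul_smul]
  rw [Finset.sum_comm]
  refine Finset.sum_congr rfl fun e₁' _ => ?_
  rw [Finset.sum_comm]
  refine Finset.sum_congr rfl fun e₂' _ => Finset.sum_congr rfl fun i _ => ?_
  congr 1
  ring

end Band

/-! ### The fused dual intertwining vectors -/

/-- The sum over paths from `a` to `c` of the products of dual intertwining vectors with the
given signs. -/
def starSum (x r : ℝ) (u : ℂ) (c : ℤ) : List Bool → ℤ → ℂ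
  | [], a => if a = c then 1 else 0
  | ε :: l, a => ∑ σ, psiStar x r ε (u + l.length) (a + step σ) a * starSum x r u c l (a + step σ)

lemma abs_step (σ : Bool) : |step σ| = 1 := by cases σ <;> simp [step]

lemma starSum_eq_zero (x r : ℝ) (u : ℂ) (c : ℤ) : ∀ (l : List Bool) (a : ℤ), l.length < |a - c| →
    starSum x r u c l a = 0
  | [], a, h => by
    rw [starSum, if_neg]
    rintro rfl
    simp at h
  | ε :: l, a, h => by
    rw [starSum]
    refine Finset.sum_eq_zero fun σ _ => ?_
    rw [starSum_eq_zero x r u c l, mul_zero]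
    have h1 := abs_step σ
    have h2 : |a - c| ≤ |a + step σ - c| + |step σ| := by
      have := abs_sub (a + step σ - c) (step σ)
      rwa [show a + step σ - c - step σ = a - c by ring] at this
    simp only [List.length_cons, Nat.cast_add, Nat.cast_one] at h
    omega

lemma starSum_ofFn (x r : ℝ) (u : ℂ) (c : ℤ) : ∀ {k : ℕ} (ε : Fin k → Bool) (a : ℤ),
    starSum x r u c (List.ofFn ε) a = ∑ s : Fin k → Bool, if walk a s k = c then
      ∏ i : Fin k, psiStar x r (ε i) (u + (k - 1 - (i : ℕ) : ℂ)) (walk a s (i + 1)) (walk a s i)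
      else 0
  | 0, ε, a => by simp [starSum, walk_zero]
  | k + 1, ε, a => by
    have e0 : u + (((k + 1 : ℕ) : ℂ) - 1 - ((0 : ℕ) : ℂ)) = u + (k : ℂ) := by push_cast; ring
    have e1 : ∀ i : ℕ, u + (((k + 1 : ℕ) : ℂ) - 1 - ((i + 1 : ℕ) : ℂ)) = u + (k - 1 - (i : ℂ)) := by
      intro i; push_cast; ring
    rw [List.ofFn_succ, starSum, ← (Fin.consEquiv fun _ : Fin (k + 1) => Bool).sum_comp,
      Fintype.sum_prod_type]
    refine Finset.sum_congr rfl fun σ _ => ?_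
    rw [starSum_ofFn, Finset.mul_sum, List.length_ofFn]
    refine Finset.sum_congr rfl fun q _ => ?_
    simp only [Fin.consEquiv, Equiv.coe_fn_mk, Fin.prod_univ_succ, Fin.val_zero, walk_zero,
      Fin.val_succ, walk_cons_succ, e0, e1, mul_ite, mul_zero]

lemma psiStarK_eq (x r : ℝ) (k : ℕ) (e : Fin (k + 1)) (u : ℂ) (a b : ℤ) :
    psiStarK x r k e u a b = starSum x r u a (List.ofFn (canon k e)) b := by
  rw [starSum_ofFn, psiStarK]

/-! ### Sign symmetry and biorthogonality of the fused dual vectors -/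

section Inversion

variable {x r : ℝ} (hx₀ : 0 < x) (hx₁ : x < 1) (hr : 1 < r)
include hx₀ hx₁ hr

/-- It suffices to exchange two neighbouring signs. Paths making two equal steps there are invariant
one by one (`psiStar_straight_symm`); those which return to the same height are invariant after
summing over the intermediate height (`psiStar_turn_symm`). -/
lemma starSum_perm (u : ℂ) {c : ℤ} {l l' : List Bool} (h : l.Perm l') :
    (∀ n : ℤ, |n - c| ≤ l.length → br x r n ≠ 0) →
    ∀ a, starSum x r u c l a = starSum x r u c l' a := by
  induction h with
  | nil => intro _ a; rfl
  | @cons ε l l' h ih =>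
    intro hc a
    rw [starSum, starSum, h.length_eq]
    refine Finset.sum_congr rfl fun σ _ => ?_
    rw [ih fun n hn => hc n (by rw [List.length_cons]; push_cast; omega)]
  | swap ε ε' l =>
    intro hc a
    have hturn : (∑ σ, psiStar x r ε' (u + l.length + 1) (a + step σ) a *
          psiStar x r ε (u + l.length) (a + step σ + step (!σ)) (a + step σ)) *
          starSum x r u c l a =
        (∑ σ, psiStar x r ε (u + l.length + 1) (a + step σ) a *
          psiStar x r ε' (u + l.length) (a + step σ + step (!σ)) (a + step σ)) *
          starSum x r u c l a := by
      -- If c is out of reach from a, the common remaining sum is zero. Otherwise the intermediate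
      -- heights a ± 1 are close enough to c for `hc`.
      by_cases h0 : (l.length : ℤ) < |a - c|
      · rw [starSum_eq_zero x r u c l a h0, mul_zero, mul_zero]
      · rw [psiStar_turn_symm hx₀ hx₁ hr]
        intro σ
        refine hc _ ?_
        have h1 := abs_step σ
        have h2 := abs_add_le (a - c) (step σ)
        rw [show a - c + step σ = a + step σ - c by ring] at h2
        simp only [List.length_cons, Nat.cast_add, Nat.cast_one]
        omega
    have e : ∀ ε ε' : Bool, starSum x r u c (ε :: ε' :: l) a =
        (∑ σ, psiStar x r ε (u + l.length + 1) (a + step σ) a *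
          psiStar x r ε' (u + l.length) (a + step σ + step σ) (a + step σ) *
            starSum x r u c l (a + step σ + step σ)) +
        (∑ σ, psiStar x r ε (u + l.length + 1) (a + step σ) a *
          psiStar x r ε' (u + l.length) (a + step σ + step (!σ)) (a + step σ)) *
          starSum x r u c l a := by
      intro ε ε'
      have h1 : a + step true + step false = a := by simp [step]
      have h2 : a + step false + step true = a := by simp [step]
      simp only [starSum, List.length_cons, Nat.cast_add, Nat.cast_one, Fintype.sum_bool,
        Bool.not_true, Bool.not_false, h1, h2, ← add_assoc]
      ring
    rw [e, e, hturn]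
    congr 1
    refine Finset.sum_congr rfl fun σ _ => ?_
    rw [psiStar_straight_symm]
  | trans h₁ h₂ ih₁ ih₂ =>
    intro hc a
    rw [ih₁ hc, ih₂ fun n hn => hc n (by rwa [h₁.length_eq])]

/-- Both products begin at height a with the same parameter u + n. Summing over the first sign
forces the dual path to make the same first step as the given path, and induction continues from the
next height. -/
lemma sum_starSum_mul_psi {c : ℤ} (u : ℂ) : ∀ {n : ℕ} (s : Fin n → Bool) (a : ℤ),
    (∀ j < n, br x r (u + j) ≠ 0) → (∀ h : ℤ, |h - c| ≤ n → br x r h ≠ 0) →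
    ∑ ε : Fin n → Bool, starSum x r u c (List.ofFn ε) a * pathVec x r u (walk a s) ε =
      if walk a s n = c then 1 else 0
  | 0, s, a, _, _ => by simp [starSum, pathVec, walk_zero]
  | n + 1, s, a, hu, hc => by
    -- When c is out of reach both sides vanish; this leaves only heights a with [a] ≠ 0 for the
    -- orthogonality of the first step.
    by_cases ha : ((n + 1 : ℕ) : ℤ) < |a - c|
    · rw [if_neg]
      · refine Finset.sum_eq_zero fun ε _ => ?_
        rw [starSum_eq_zero, zero_mul]
        rwa [List.length_ofFn]
      · intro h
        have := abs_walk_sub_le a s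
        rw [h, abs_sub_comm] at this
        omega
    obtain ⟨σ', s', rfl⟩ : ∃ (σ : Bool) (s' : Fin n → Bool), s = Fin.cons σ s' :=
      ⟨s 0, Fin.tail s, (Fin.cons_self_tail s).symm⟩
    have ih := sum_starSum_mul_psi (c := c) u s' (a + step σ') (fun j hj => hu j (by omega))
      fun h hh => hc h (by push_cast; omega)
    have e0 : u + (((n + 1 : ℕ) : ℂ) - 1 - ((0 : ℕ) : ℂ)) = u + (n : ℂ) := by push_cast; ring
    have e1 : ∀ i : ℕ, u + (((n + 1 : ℕ) : ℂ) - 1 - ((i + 1 : ℕ) : ℂ)) = u + (n - 1 - (i : ℂ)) := by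
      intro i; push_cast; ring
    have hv : ∀ (ε : Bool) (ε' : Fin n → Bool),
        pathVec x r u (walk a (Fin.cons σ' s' : Fin (n + 1) → Bool)) (Fin.cons ε ε') =
        psi x r ε (u + n) a (a + step σ') * pathVec x r u (walk (a + step σ') s') ε' := by
      intro ε ε'
      simp only [pathVec, Fin.prod_univ_succ, Fin.val_zero, walk_zero, Fin.val_succ,
        walk_cons_succ, e0, e1, Fin.cons_zero, Fin.cons_succ]
    have horth := fun σ => sum_psiStar_mul_psi hx₀ hx₁ hr (hu n (by omega)) (hc a (not_lt.mp ha)) σ σ'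
    rw [walk_cons_succ, ← ih, ← (Fin.consEquiv fun _ : Fin (n + 1) => Bool).sum_comp,
      Fintype.sum_prod_type, Finset.sum_comm]
    refine Finset.sum_congr rfl fun ε' _ => ?_
    simp only [Fin.consEquiv, Equiv.coe_fn_mk, List.ofFn_cons, starSum, hv, List.length_ofFn]
    have : ∀ σ, starSum x r u c (List.ofFn ε') (a + step σ) *
        (∑ ε, psiStar x r ε (u + n) (a + step σ) a * psi x r ε (u + n) a (a + step σ')) =
        if σ = σ' then starSum x r u c (List.ofFn ε') (a + step σ) else 0 := by
      intro σ
      rw [horth]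
      split_ifs <;> simp
    have h2 := Fintype.sum_congr _ _ this
    rw [Finset.sum_ite_eq' Finset.univ σ', if_pos (Finset.mem_univ _)] at h2
    rw [← h2]
    simp only [Fintype.sum_bool]
    ring

/-- The dual intertwining vectors invert the intertwining vectors. -/
theorem sum_psiStarK_mul_psiK {k : ℕ} {u : ℂ} (hu : ∀ j < k, br x r (u + j) ≠ 0) {a b c : ℤ}
    (hba : Adm k b a) (hc : HeightRegular x r k c) :
    ∑ e, psiStarK x r k e u c b * psiK x r k e u b a = if a = c then 1 else 0 := by
  obtain ⟨s, h1, h2⟩ := refPath_eq_walk hba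
  have hvec : ∀ t : Fin k → Bool, refVec x r k u b a t = pathVec x r u (walk b s) t := by
    intro t
    rw [refVec, if_pos hba, pathVec, pathVec]
    refine Finset.prod_congr rfl fun i _ => ?_
    rw [h2 i (by omega), h2 (i + 1) (by omega)]
  rw [← h1, ← sum_starSum_mul_psi hx₀ hx₁ hr u s b hu hc]
  simp only [h1, psiK_eq, hvec, psiStarK_eq, Finset.mul_sum]
  rw [Finset.sum_comm]
  refine Finset.sum_congr rfl fun ε _ => ?_
  rw [Finset.sum_eq_single ⟨plus ε, Nat.lt_succ_of_le (plus_le ε)⟩]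
  · simp only [if_true]
    congr 1
    -- The fused dual vector is defined with the signs in canonical order. Its symmetry lets it be
    -- paired with every arrangement ε having the same number of plus signs.
    refine starSum_perm hx₀ hx₁ hr u ?_ (by simpa [HeightRegular] using hc) b
    obtain ⟨g, hg⟩ := exists_perm_of_plus_eq (plus_canon (plus_le ε))
    rw [hg]
    exact Equiv.Perm.ofFn_comp_perm g ε
  · intro e _ he
    rw [if_neg, mul_zero]
    intro h
    exact he (Fin.ext h.symm)
  · simp

end Inversion

/-! ### Inversion relation of the vertex operators -/

section Dual

variable {k : ℕ} {m : ℤ} {H : (ℓ : ℕ) → Height m ℓ → Type*}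
  [∀ ℓ a, AddCommGroup (H ℓ a)] [∀ ℓ a, Module ℂ (H ℓ a)]
  {x r : ℝ} (Φ : ∀ {ℓ ℓ' : ℕ}, ℓ + ℓ' = k → (b : Height m ℓ') → (a : Height m ℓ) → ℂ →
    (H ℓ a →ₗ[ℂ] H ℓ' b))

/-- The inversion relation of the vertex operators. -/
theorem vertexDualHTM_inversion (hx₀ : 0 < x) (hx₁ : x < 1) (hr : 1 < r)
    (hΦ : IsSOSHalfTransfer x r Φ) (f : ℂ → ℂ) (u₀ : ℂ) {ℓ ℓ' : ℕ} (h : ℓ + ℓ' = k)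
    (h' : ℓ' + ℓ = k) {u : ℂ} (hu : ∀ j : ℕ, j < k → br x r (u - u₀ + j) ≠ 0)
    (hf : f (u - u₀) ≠ 0) (c a : Height m ℓ) (hreg : HeightRegular x r k c) :
    block (∑ e : Fin (k + 1),
      vertexDualHTM x r Φ f u₀ h' e u ∘ₗ vertexHTM x r Φ f u₀ h e u) c a =
      block LinearMap.id c a := by
  have hE : ∀ e, block (vertexDualHTM x r Φ f u₀ h' e u ∘ₗ vertexHTM x r Φ f u₀ h e u) c a =
      ∑ j : Fin (k + 1), (psiStarK x r k e (u - u₀) c (nbr h a j) *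
        psiK x r k e (u - u₀) (nbr h a j) a) •
        ((if Adm k c (nbr h a j) then dualHTM x r Φ h' c (nbr h a j) u else 0) ∘ₗ
          Φ h (nbr h a j) a u) := by
    intro e
    rw [vertexHTM_eq, vertexDualHTM_eq, LinearMap.smul_comp, LinearMap.comp_smul, smul_smul,
      block_smul, block_bandOp_comp_bandOp, inv_mul_cancel₀ hf, one_smul]
    refine Finset.sum_congr rfl fun j _ => ?_
    split_ifs
    · rw [LinearMap.smul_comp, LinearMap.comp_smul, smul_smul]
    · simp
  simp only [block_sum, hE]
  rw [Finset.sum_comm]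
  -- The sum over e gives the same scalar, 1 or 0, for every intermediate height; on the diagonal it
  -- leaves the SOS inversion relation.
  simp only [← Finset.sum_smul, sum_psiStarK_mul_psiK hx₀ hx₁ hr hu (adm_nbr h a _) hreg]
  by_cases hca : c = a
  · subst hca
    rw [block_id_self, ← hΦ.inversion h h' c u hreg]
    refine Finset.sum_congr rfl fun j _ => ?_
    rw [if_pos rfl, one_smul, if_pos (adm_nbr h c j).symm]
  · have : a.1 ≠ c.1 := fun e => hca (Subtype.ext e.symm)
    rw [block_id _ _ hca]
    simp [this]

end Dual

/-! ### The gauge factor and the dual operator -/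

lemma sqrtBr_ne_zero {x r : ℝ} {a : ℤ} (h : br x r a ≠ 0) : sqrtBr x r a ≠ 0 := by
  rw [sqrtBr, Complex.cpow_ne_zero_iff]
  exact Or.inl h

lemma gFac_ne_zero {x r : ℝ} {a : ℤ} (h : br x r a ≠ 0) : gFac x r a ≠ 0 := by
  refine mul_ne_zero ?_ (sqrtBr_ne_zero h)
  unfold heightSign
  split_ifs <;> norm_num

lemma ellBinom_ne_zero {x r : ℝ} {k B : ℕ} (hgen : ∀ j : ℕ, 1 ≤ j → j ≤ k → br x r j ≠ 0)
    (hB : B ≤ k) : ellBinom x r k B ≠ 0 := by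
  refine Finset.prod_ne_zero_iff.mpr fun i hi => ?_
  have hi' := Finset.mem_range.mp hi
  have h1 := hgen (k - i) (by omega) (by omega)
  have h2 := hgen (B - i) (by omega) (by omega)
  rw [Nat.cast_sub (by omega)] at h1 h2
  exact div_ne_zero h1 h2

/-- The heights in the product of the gauge factor run from (a+b-k)/2 to (a+b+k)/2, and these are
exactly the heights allowed by `EdgeRegular`; the elliptic binomial is covered by `hgen`. -/
lemma gaugeG_ne_zero {x r : ℝ} {k : ℕ} (hgen : ∀ j : ℕ, 1 ≤ j → j ≤ k → br x r j ≠ 0) {a b : ℤ}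
    (hA : Adm k a b) (hreg : EdgeRegular x r k a b) : gaugeG x r k a b ≠ 0 := by
  have hab := hA.abs_le
  have ha : br x r a ≠ 0 := hreg a (by simpa using hab)
  have hb : br x r b ≠ 0 := hreg b (by rw [abs_sub_comm] at hab; simpa using hab)
  obtain ⟨j, hj⟩ := hA
  refine div_ne_zero (gFac_ne_zero ha) (mul_ne_zero (gFac_ne_zero hb) (div_ne_zero (mul_ne_zero
    (inv_ne_zero (ellBinom_ne_zero hgen ?_)) (Finset.prod_ne_zero_iff.mpr fun i hi => hreg _ ?_))
    (mul_ne_zero (sqrtBr_ne_zero ha) (sqrtBr_ne_zero hb))))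
  · omega
  · have := Finset.mem_range.mp hi
    rw [Int.abs_eq_natAbs, Int.abs_eq_natAbs]
    omega

section Dual

variable {k : ℕ} {m : ℤ} {H : (ℓ : ℕ) → Height m ℓ → Type*}
  [∀ ℓ a, AddCommGroup (H ℓ a)] [∀ ℓ a, Module ℂ (H ℓ a)]
  {x r : ℝ} (Φ : ∀ {ℓ ℓ' : ℕ}, ℓ + ℓ' = k → (b : Height m ℓ') → (a : Height m ℓ) → ℂ →
    (H ℓ a →ₗ[ℂ] H ℓ' b))

/-- The dual vertex operator is a transform of the vertex operator. -/
theorem block_vertexDualHTM_eq (hgen : ∀ j : ℕ, 1 ≤ j → j ≤ k → br x r j ≠ 0)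
    (f : ℂ → ℂ) (u₀ : ℂ) {ℓ ℓ' : ℕ} (h : ℓ + ℓ' = k) {u Cu : ℂ} {q : Fin (k + 1) → ℂ}
    {e : Fin (k + 1)} {b : Height m ℓ'} {a : Height m ℓ} (hreg : EdgeRegular x r k b a)
    (hq : Adm k b a → psiStarK x r k e (u - u₀) b a = Cu * gaugeG x r k b a *
      ∑ e' : Fin (k + 1), q e' * psiK x r k e' (u - u₀ - 1) b a)
    (hf : f (u - u₀) ≠ 0) (hC : f (u - u₀) * f (u - u₀ - 1) = Cu) :
    block (vertexDualHTM x r Φ f u₀ h e u) b a =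
      block (∑ e' : Fin (k + 1), q e' • vertexHTM x r Φ f u₀ h e' (u - 1)) b a := by
  simp only [vertexDualHTM_eq, vertexHTM_eq, block_sum, block_smul, block_bandOp, dualHTM]
  split_ifs with hA
  -- The inverse gauge factor of the dual half transfer matrix cancels the one in the crossing
  -- relation, and f(v)⁻¹ times Cu leaves f(v-1), the normalization of the operator at u - 1.
  · have hG := gaugeG_ne_zero hgen hA hreg
    rw [hq hA, ← hC, show u - 1 - u₀ = u - u₀ - 1 by ring]
    simp only [smul_smul, ← Finset.sum_smul]
    congr 1
    have : ∀ e', q e' * (f (u - u₀ - 1) * psiK x r k e' (u - u₀ - 1) b a) =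
        f (u - u₀ - 1) * (q e' * psiK x r k e' (u - u₀ - 1) b a) := fun e' => by ring
    simp only [← mul_assoc] at this ⊢
    simp only [this, mul_assoc, ← Finset.mul_sum]
    field_simp
  · simp

end Dual

end FusionVF

end

theorem mainTheorem2 (x r : ℝ) (hx₀ : 0 < x) (hx₁ : x < 1) (hr : 1 < r)
    (k : ℕ) (hk : 0 < k) (hgen : ∀ j : ℕ, 1 ≤ j → j ≤ k → FusionVF.br x r j ≠ 0)
    (m : ℤ) {H : (ℓ : ℕ) → FusionVF.Height m ℓ → Type*}
    [∀ ℓ a, AddCommGroup (H ℓ a)] [∀ ℓ a, Module ℂ (H ℓ a)]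
    (Φ : ∀ {ℓ ℓ' : ℕ}, ℓ + ℓ' = k → (b : FusionVF.Height m ℓ') → (a : FusionVF.Height m ℓ) →
      ℂ → (H ℓ a →ₗ[ℂ] H ℓ' b))
    (hΦ : FusionVF.IsSOSHalfTransfer x r Φ)
    (f : ℂ → ℂ) (u₀ : ℂ) (ℓ ℓ' : ℕ) (h : ℓ + ℓ' = k) (h' : ℓ' + ℓ = k) :
    -- the exchange relation with the fused R-matrix
    (∀ (u₁ u₂ : ℂ), FusionVF.Generic x r (u₁ - u₂) →
      ∀ (e₁ e₂ : Fin (k + 1)) (c a : FusionVF.Height m ℓ), FusionVF.FaceRegular x r k c a →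
      FusionVF.block
        (FusionVF.vertexHTM x r Φ f u₀ h' e₂ u₂ ∘ₗ FusionVF.vertexHTM x r Φ f u₀ h e₁ u₁) c a =
      FusionVF.block
        (∑ e₁' : Fin (k + 1), ∑ e₂' : Fin (k + 1),
          FusionVF.RkkComp x r k (u₁ - u₂) e₁' e₂' e₁ e₂ •
            (FusionVF.vertexHTM x r Φ f u₀ h' e₁' u₁ ∘ₗ
              FusionVF.vertexHTM x r Φ f u₀ h e₂' u₂)) c a) ∧
    -- the inversion relation
    (∀ u : ℂ, (∀ j : ℕ, j < k → FusionVF.br x r (u - u₀ + j) ≠ 0) → f (u - u₀) ≠ 0 →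
      ∀ c a : FusionVF.Height m ℓ, FusionVF.HeightRegular x r k c →
      FusionVF.block
        (∑ e : Fin (k + 1),
          FusionVF.vertexDualHTM x r Φ f u₀ h' e u ∘ₗ FusionVF.vertexHTM x r Φ f u₀ h e u) c a =
      FusionVF.block LinearMap.id c a) ∧
    -- the dual operator is the transform by `Q` of the operator at `u - 1`, when `f` is normalised
    -- against the crossing relation of the fused intertwining vectors
    (∀ (u Cu : ℂ) (Q : Matrix (Fin (k + 1)) (Fin (k + 1)) ℂ),
      (∀ j : ℕ, j < k → FusionVF.br x r (u - u₀ + j) ≠ 0) →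
      (∀ (e : Fin (k + 1)) (b : FusionVF.Height m ℓ') (a : FusionVF.Height m ℓ),
        FusionVF.Adm k b a → FusionVF.EdgeRegular x r k b a →
        FusionVF.psiStarK x r k e (u - u₀) b a =
          Cu * FusionVF.gaugeG x r k b a *
            ∑ e' : Fin (k + 1), Q e' e * FusionVF.psiK x r k e' (u - u₀ - 1) b a) →
      f (u - u₀) ≠ 0 → f (u - u₀) * f (u - u₀ - 1) = Cu →
      ∀ (e : Fin (k + 1)) (b : FusionVF.Height m ℓ') (a : FusionVF.Height m ℓ),
        FusionVF.EdgeRegular x r k b a →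
        FusionVF.block (FusionVF.vertexDualHTM x r Φ f u₀ h e u) b a =
        FusionVF.block
          (∑ e' : Fin (k + 1), Q e' e • FusionVF.vertexHTM x r Φ f u₀ h e' (u - 1)) b a) := by
  exact ⟨fun u₁ u₂ hu e₁ e₂ c a hreg =>
      FusionVF.vertexHTM_exchange Φ hx₀ hx₁ hr hΦ f u₀ h h' hu e₁ e₂ c a hreg,
    fun u hu hf c a hreg =>
      FusionVF.vertexDualHTM_inversion Φ hx₀ hx₁ hr hΦ f u₀ h h' hu hf c a hreg,
    fun u Cu Q _ hQ hf hC e b a hreg =>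
      FusionVF.block_vertexDualHTM_eq Φ hgen f u₀ h hreg (fun hA => hQ e b a hA hreg) hf hC⟩
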